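/- Theorem. Let $N$ be a smooth time-oriented Lorentzian four-manifold of signature $(-,+,+,+)$ with Levi-Civita connection $\nabla^N$, and let $M$ be a smooth (immersed) spacelike hypersurface in $N$ with boundary $\Sigma=\partial M$. Let $g$ be the induced metric on $M$, with Levi-Civita connection $D$; let $e_4$ be the future timelike unit normal of $M$ in $N$; let $p(u,v)=\langle\nabla^N_u e_4,v\rangle$ be the second fundamental form; and let $e_3$ be the outward unit normal of $\Sigma$ in $M$. Let $\sigma$ be the induced metric on $\Sigma$ and $H$ the mean curvature vector of $\Sigma$ in $N$, that is, the trace with respect to $\sigma$ of $(u,v)\mapsto(\nabla^N_uv)^\perp$. Let $f$ be a smooth function on $M$ that solves Jang's equation $$\Big(g^{ij}-\frac{f^if^j}{1+|Df|^2}\Big)\Big(\frac{D_iD_jf}{\sqrt{1+|Df|^2}}-p_{ij}\Big)=0\quad\text{on } M,\qquad f=\tau\ \text{ on }\Sigma.$$ Let $\tilde\Omega\subset M\times\mathbb R$ be the graph of $f$, which through $x\mapsto(x,f(x))$ is $M$ with the metric $\tilde g=g+df\otimes df$. Let $\tilde\Sigma=\partial\tilde\Omega$ be the graph of $\tau$ over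 $\Sigma$, let $\tilde\nu$ be its outward unit normal in $\tilde\Omega$, and let $k$ be the mean curvature of $\tilde\Sigma$ in $\tilde\Omega$ with respect to $\tilde\nu$ (the trace of $\langle\tilde\nabla_{\cdot}\tilde\nu,\cdot\rangle$). Let $V$ be the Schoen-Yau vector field on $\tilde\Omega$, dual with respect to $\tilde g$ to the one-form $$V_j=\frac{f^i}{\sqrt{1+|Df|^2}}\Big(\frac{D_iD_jf}{\sqrt{1+|Df|^2}}-p_{ij}\Big).$$ On $\Sigma$ let $\nabla\tau$ and $|\nabla\tau|$ be taken with respect to $\sigma$, define $\phi$ by $\sinh\phi=\dfrac{-e_3(f)}{\sqrt{1+|\nabla\tau|^2}}$, and put $e_3'=\cosh\phi\,e_3+\sinh\phi\,e_4$ and $e_4'=\sinh\phi\,e_3+\cosh\phi\,e_4$. Then, under the natural identification of points of $\tilde\Sigma$ and $\Sigma$, $$k-\langle V,\tilde\nu\rangle=-\langle H,e_3'\rangle-\frac{1}{\sqrt{1+|\nabla\tau|^2}}\,\langle\nabla^N_{\nabla\tau}e_3',e_4'\rangle .$$ Moreover, suppose that $(M,g,p)$ is Minkowskian with defining function $f$: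 there is a smooth map $X=(f,Y):M\to\mathbb R^{3,1}$ whose induced metric is $g$ and whose second fundamental form with respect to the future unit normal is $p$. Let $\hat H$ be the mean curvature of the projected surface $\hat\Sigma=Y(\Sigma)\subset\mathbb R^3$ with respect to its unit normal pointing out of $Y(M)$ (the unit normal $\hat\nu$ with $\langle\hat\nu,dY(e_3)\rangle>0$). Then $k-\langle V,\tilde\nu\rangle=\hat H$ and $\langle H,e_4'\rangle=\dfrac{-\Delta\tau}{\sqrt{1+|\nabla\tau|^2}}$, where $\Delta$ is the Laplacian of $\sigma$; that is, $(e_3',e_4')$ is the canonical gauge. Consequently the pointwise conservation law holds: $$\hat H=-\langle H,e_3'\rangle-\frac{1}{\sqrt{1+|\nabla\tau|^2}}\,\langle\nabla^N_{\nabla\tau}e_3',e_4'\rangle .$$ -/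

import Mathlib

open Bundle Manifold
open scoped ContDiff BigOperators

noncomputable section

namespace QuasiLocal

section Connection

variable {E : Type*} [NormedAddCommGroup E] [NormedSpace ℝ E]
  {H : Type*} [TopologicalSpace H] {I : ModelWithCorners ℝ E H}
  {A : Type*} [TopologicalSpace A] [ChartedSpace H A]
  {E' : Type*} [NormedAddCommGroup E'] [NormedSpace ℝ E']
  {H' : Type*} [TopologicalSpace H'] {I' : ModelWithCorners ℝ E' H'}
  {B : Type*} [TopologicalSpace B] [ChartedSpace H' B]

/-- Fields of bilinear forms on the tangent spaces. Riemannian and Lorentzian metrics are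
such fields. -/
abbrev FormField (I : ModelWithCorners ℝ E H) (A : Type*) [TopologicalSpace A]
    [ChartedSpace H A] : Type _ :=
  ∀ x : A, TangentSpace I x →L[ℝ] TangentSpace I x →L[ℝ] ℝ

/-- The bilinear form `(u, v) ↦ b (L u) (L v)`. -/
def pullForm {T T' : Type*} [TopologicalSpace T] [AddCommGroup T] [Module ℝ T]
    [IsTopologicalAddGroup T] [ContinuousSMul ℝ T]
    [TopologicalSpace T'] [AddCommGroup T'] [Module ℝ T']
    [IsTopologicalAddGroup T'] [ContinuousSMul ℝ T']
    (L : T →L[ℝ] T') (b : T' →L[ℝ] T' →L[ℝ] ℝ) : T →L[ℝ] T →L[ℝ] ℝ :=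
  (ContinuousLinearMap.precomp ℝ L) ∘L b ∘L L

/-- The pull-back `F^* G` (first fundamental form of `F`). -/
def pullback [IsManifold I 1 A] [IsManifold I' 1 B] (G : FormField I' B) (F : A → B) :
    FormField I A :=
  fun a => pullForm (mfderiv I I' F a) (G (F a))

/-- The vector field which has the constant components `v` in the preferred chart at `x`. -/
def coordField [IsManifold I 1 A] (x : A) (v : E) (y : A) : TangentSpace I y :=
  (trivializationAt E (TangentSpace I : A → Type _) x).symmL ℝ y v

/-- The components of a tangent vector at `x` in the preferred chart at `x`. -/
def comps [IsManifold I 1 A] (x : A) : TangentSpace I x →L[ℝ] E :=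
  (trivializationAt E (TangentSpace I : A → Type _) x).continuousLinearMapAt ℝ x

/-- The components `G_{ij}` of `G` in the preferred chart at `x`, as a function of `y`. -/
def coordForm [IsManifold I 1 A] (G : FormField I A) (x y : A) : E →L[ℝ] E →L[ℝ] ℝ :=
  pullForm ((trivializationAt E (TangentSpace I : A → Type _) x).symmL ℝ y) (G y)

/-- The first partial derivatives `∂_w G(u, v)` (argument order `w, u, v`) of the components
of `G` in the preferred chart at `x`, evaluated at `x`. -/
def coordFormDeriv [IsManifold I 1 A] (G : FormField I A) (x : A) :
    E →L[ℝ] E →L[ℝ] E →L[ℝ] ℝ :=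
  mvfderiv I (coordForm G x) x ∘L
    (trivializationAt E (TangentSpace I : A → Type _) x).symmL ℝ x

/-- The Christoffel symbols of the Levi-Civita connection of `G` at `x`, in the preferred
chart at `x`:
`Γ^k_{ij} = 1/2 G^{kl} (∂_i G_{jl} + ∂_j G_{il} - ∂_l G_{ij})`. -/
def christoffel [IsManifold I 1 A] (G : FormField I A) (x : A) (u v : TangentSpace I x) :
    TangentSpace I x :=
  (G x).inverse (((1 / 2 : ℝ) • (coordFormDeriv G x (comps x u) (comps x v)
    + coordFormDeriv G x (comps x v) (comps x u)
    - ((coordFormDeriv G x).flip (comps x u)).flip (comps x v))) ∘L comps x)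

/-- The Levi-Civita covariant derivative `∇_u W` at `a` of a vector field `W` along the map
`F : A → B`, where `B` carries the metric `G`:
`(∇_u W)^k = u(W^k) + Γ^k_{ij} (dF u)^i W^j` in the preferred chart at `F a`. -/
def nabla [IsManifold I 1 A] [IsManifold I' 1 B] (G : FormField I' B) (F : A → B)
    (W : ∀ a : A, TangentSpace I' (F a)) (a : A) (u : TangentSpace I a) :
    TangentSpace I' (F a) :=
  coordField (I := I') (F a) (mvfderiv I (fun b : A =>
      (trivializationAt E' (TangentSpace I' : B → Type _) (F a) ⟨F b, W b⟩).2) a u) (F a)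
    + christoffel G (F a) (mfderiv I I' F a u) (W a)

/-- The gradient of `f` with respect to the metric `g`. -/
def grad (g : FormField I A) (f : A → ℝ) (x : A) : TangentSpace I x :=
  (g x).inverse (mvfderiv I f x)

/-- `|grad f|²` with respect to the metric `g`. -/
def normSqGrad (g : FormField I A) (f : A → ℝ) (x : A) : ℝ :=
  g x (grad g f x) (grad g f x)

/-- The Hessian `D_i D_j f = g(D_i grad f, ∂_j)` with respect to the metric `g`. -/
def hess [IsManifold I 1 A] (g : FormField I A) (f : A → ℝ) (x : A) (u : TangentSpace I x) :
    TangentSpace I x →L[ℝ] ℝ :=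
  g x (nabla (I := I) g (fun y : A => y) (grad g f) x u)

/-- The second fundamental form `(u, v) ↦ G(∇_u n, dF v)` of `F` in the direction of the
normal vector field `n`. -/
def secondForm [IsManifold I 1 A] [IsManifold I' 1 B] (G : FormField I' B) (F : A → B)
    (n : ∀ a : A, TangentSpace I' (F a)) (a : A) (u : TangentSpace I a) :
    TangentSpace I a →L[ℝ] ℝ :=
  (G (F a) (nabla (I := I) G F n a u)) ∘L (mfderiv I I' F a)

/-- The component of `w` that is `G`-orthogonal to the image of `dF`. -/
def normalPart [IsManifold I 1 A] [IsManifold I' 1 B] (G : FormField I' B) (F : A → B)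
    (a : A) (w : TangentSpace I' (F a)) : TangentSpace I' (F a) :=
  w - mfderiv I I' F a ((pullback (I := I) G F a).inverse ((G (F a) w) ∘L (mfderiv I I' F a)))

/-- `n` is a smooth normal vector field along `F` with `G(n, n) = ε`. -/
structure IsUnitNormal (I : ModelWithCorners ℝ E H) [IsManifold I' ∞ B]
    (G : FormField I' B) (F : A → B) (n : ∀ a : A, TangentSpace I' (F a)) (ε : ℝ) : Prop where
  smooth : ContMDiff I I'.tangent ∞ (fun a => (⟨F a, n a⟩ : TangentBundle I' B))
  unit : ∀ a, G (F a) (n a) (n a) = ε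
  normal : ∀ a (u : TangentSpace I a), G (F a) (n a) (mfderiv I I' F a u) = 0

end Connection

section Trace

variable {n : ℕ} {H : Type*} [TopologicalSpace H]
  {I : ModelWithCorners ℝ (EuclideanSpace ℝ (Fin n)) H}
  {A : Type*} [TopologicalSpace A] [ChartedSpace H A]
  {E' : Type*} [NormedAddCommGroup E'] [NormedSpace ℝ E']
  {H' : Type*} [TopologicalSpace H'] {I' : ModelWithCorners ℝ E' H'}
  {B : Type*} [TopologicalSpace B] [ChartedSpace H' B]

/-- The metric trace `g^{ij} b_{ij}` at `x` of a (scalar or vector valued) bilinear map `b`. -/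
def mtrace [IsManifold I 1 A] {W : Type*} [AddCommGroup W] (g : FormField I A) (x : A)
    (b : TangentSpace I x → TangentSpace I x → W) : W :=
  ∑ i : Fin n, b (coordField x (EuclideanSpace.single i (1 : ℝ)) x)
    ((g x).inverse ((EuclideanSpace.proj i : EuclideanSpace ℝ (Fin n) →L[ℝ] ℝ) ∘L comps x))

/-- The Laplacian of `f` with respect to the metric `g`. -/
def laplacian [IsManifold I 1 A] (g : FormField I A) (f : A → ℝ) (x : A) : ℝ :=
  mtrace g x (fun u v => hess g f x u v)

/-- The mean curvature of the hypersurface `F` with respect to the unit normal `n`: the trace of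
`(u, v) ↦ G(∇_u n, dF v)` with respect to the induced metric. -/
def meanCurvature [IsManifold I 1 A] [IsManifold I' 1 B] (G : FormField I' B) (F : A → B)
    (n : ∀ a : A, TangentSpace I' (F a)) (a : A) : ℝ :=
  mtrace (pullback (I := I) G F) a (fun u v => secondForm (I := I) G F n a u v)

/-- The mean curvature vector of `F`: the trace, with respect to the induced metric, of the vector
valued second fundamental form `(∇_i ∂_j F)^⊥`. -/
def meanCurvatureVector [IsManifold I 1 A] [IsManifold I' 1 B] (G : FormField I' B)
    (F : A → B) (a : A) : TangentSpace I' (F a) :=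
  normalPart (I := I) G F a (mtrace (pullback (I := I) G F) a (fun u v =>
    nabla (I := I) G F (fun b => mfderiv I I' F b (coordField (I := I) a v b)) a u))

end Trace

section Spacetime

/-- A smooth Lorentzian metric of signature `(-, +, +, +)` on a four-manifold. -/
structure LorentzMetric (N : Type*) [TopologicalSpace N]
    [ChartedSpace (EuclideanSpace ℝ (Fin 4)) N] [IsManifold (𝓡 4) ∞ N] where
  form : FormField (𝓡 4) N
  symm : ∀ (x : N) (v w : TangentSpace (𝓡 4) x), form x v w = form x w v
  signature : ∀ x : N, ∃ t : TangentSpace (𝓡 4) x, form x t t < 0 ∧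
    ∀ v : TangentSpace (𝓡 4) x, form x t v = 0 → v ≠ 0 → 0 < form x v v
  smooth : ContMDiff (𝓡 4)
    ((𝓡 4).prod 𝓘(ℝ, EuclideanSpace ℝ (Fin 4) →L[ℝ] EuclideanSpace ℝ (Fin 4) →L[ℝ] ℝ)) ∞
    (fun x => TotalSpace.mk' (EuclideanSpace ℝ (Fin 4) →L[ℝ] EuclideanSpace ℝ (Fin 4) →L[ℝ] ℝ)
      (E := fun x : N => TangentSpace (𝓡 4) x →L[ℝ] TangentSpace (𝓡 4) x →L[ℝ] ℝ) x (form x))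

/-- A time orientation: a continuous timelike vector field, declared to be future directed. -/
structure TimeOrientation {N : Type*} [TopologicalSpace N]
    [ChartedSpace (EuclideanSpace ℝ (Fin 4)) N] [IsManifold (𝓡 4) ∞ N]
    (G : LorentzMetric N) where
  field : ∀ x : N, TangentSpace (𝓡 4) x
  continuous : Continuous (fun x => (⟨x, field x⟩ : TangentBundle (𝓡 4) N))
  timelike : ∀ x, G.form x (field x) (field x) < 0

/-- The Minkowski metric `-dx₀² + dx₁² + dx₂² + dx₃²` on `ℝ⁴`. -/
def minkowski : FormField (𝓡 4) (EuclideanSpace ℝ (Fin 4)) := fun _ =>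
  (innerSL ℝ - (2 : ℝ) • (EuclideanSpace.proj (0 : Fin 4)).smulRight
    (EuclideanSpace.proj (0 : Fin 4) : EuclideanSpace ℝ (Fin 4) →L[ℝ] ℝ) :
    EuclideanSpace ℝ (Fin 4) →L[ℝ] EuclideanSpace ℝ (Fin 4) →L[ℝ] ℝ)

/-- The Euclidean metric on `ℝ³`. -/
def euclidean : FormField (𝓡 3) (EuclideanSpace ℝ (Fin 3)) := fun _ =>
  (innerSL ℝ : EuclideanSpace ℝ (Fin 3) →L[ℝ] EuclideanSpace ℝ (Fin 3) →L[ℝ] ℝ)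

/-- The projection `ℝ⁴ → ℝ³` along the time axis. -/
def spatial (x : EuclideanSpace ℝ (Fin 4)) : EuclideanSpace ℝ (Fin 3) :=
  WithLp.toLp 2 (fun i : Fin 3 => x i.succ)

end Spacetime

section InitialData

variable {M : Type*} [TopologicalSpace M] [ChartedSpace (EuclideanHalfSpace 3) M]
  [IsManifold (𝓡∂ 3) ∞ M]
  {S : Type*} [TopologicalSpace S] [ChartedSpace (EuclideanSpace ℝ (Fin 2)) S]
  [IsManifold (𝓡 2) ∞ S]

/-- `j` is a smooth embedding of the surface `S` onto the boundary of `M`. -/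
structure IsBoundaryEmbedding (j : S → M) : Prop where
  smooth : ContMDiff (𝓡 2) (𝓡∂ 3) ∞ j
  immersion : ∀ s, Function.Injective (mfderiv (𝓡 2) (𝓡∂ 3) j s)
  embedding : Topology.IsEmbedding j
  range_eq : Set.range j = (𝓡∂ 3).boundary M

/-- A tangent vector of `M` at a boundary point points strictly out of `M`: in the preferred
boundary chart, with values in the half space `{y | 0 ≤ y 0}`, its component `0` is negative. -/
def PointsOutward {x : M} (v : TangentSpace (𝓡∂ 3) x) : Prop :=
  (EuclideanSpace.proj (0 : Fin 3) : EuclideanSpace ℝ (Fin 3) →L[ℝ] ℝ) (comps x v) < 0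

/-- `ν` is the outward unit normal of the boundary `j : S → M` with respect to the Riemannian
metric `g` on `M`. -/
structure IsOutwardUnitNormal (g : FormField (𝓡∂ 3) M) (j : S → M)
    (ν : ∀ s : S, TangentSpace (𝓡∂ 3) (j s)) : Prop where
  unitNormal : IsUnitNormal (𝓡 2) g j ν 1
  outward : ∀ s, PointsOutward (ν s)

/-- The metric `g + df ⊗ df`: the metric induced by `g + dt²` on the graph of `f` in `M × ℝ`,
where the graph is parametrised by `x ↦ (x, f x)`. -/
def graphMetric (g : FormField (𝓡∂ 3) M) (f : M → ℝ) : FormField (𝓡∂ 3) M :=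
  fun x => g x + (mvfderiv (𝓡∂ 3) f x).smulRight (mvfderiv (𝓡∂ 3) f x)

/-- The tensor `D_i D_j f / √(1 + |Df|²) - p_{ij}`. -/
def jangTensor (g : FormField (𝓡∂ 3) M)
    (p : ∀ x : M, TangentSpace (𝓡∂ 3) x → TangentSpace (𝓡∂ 3) x →L[ℝ] ℝ) (f : M → ℝ)
    (x : M) (u : TangentSpace (𝓡∂ 3) x) : TangentSpace (𝓡∂ 3) x →L[ℝ] ℝ :=
  (1 / √(1 + normSqGrad g f x)) • hess g f x u - p x u

/-- Jang's equation
`(g^{ij} - f^i f^j / (1 + |Df|²)) (D_i D_j f / √(1 + |Df|²) - p_{ij}) = 0` on all of `M`. -/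
def JangEquation (g : FormField (𝓡∂ 3) M)
    (p : ∀ x : M, TangentSpace (𝓡∂ 3) x → TangentSpace (𝓡∂ 3) x →L[ℝ] ℝ) (f : M → ℝ) : Prop :=
  ∀ x : M, mtrace g x (fun u v => jangTensor g p f x u v)
    - jangTensor g p f x (grad g f x) (grad g f x) / (1 + normSqGrad g f x) = 0

/-- The Schoen-Yau vector field `V` on the graph of `f`, read on `M` through `x ↦ (x, f x)`. It is
dual, with respect to the graph metric, to the one-form
`V_j = f^i / √(1 + |Df|²) * (D_i D_j f / √(1 + |Df|²) - p_{ij})`.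
Equivalently, in `M × ℝ` with the product metric, with all objects extended invariantly along `ℝ`
and `p(∂_t, ·) = 0`, it is the vector field dual to `⟨∇_ñ ñ, ·⟩ - p(ñ, ·)`, where
`ñ = (Df - ∂_t) / √(1 + |Df|²)` is the downward unit normal of the graph. -/
def schoenYauField (g : FormField (𝓡∂ 3) M)
    (p : ∀ x : M, TangentSpace (𝓡∂ 3) x → TangentSpace (𝓡∂ 3) x →L[ℝ] ℝ) (f : M → ℝ)
    (x : M) : TangentSpace (𝓡∂ 3) x :=
  (graphMetric g f x).inverse
    ((1 / √(1 + normSqGrad g f x)) • jangTensor g p f x (grad g f x))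

end InitialData

end QuasiLocal

end

open QuasiLocal

/-! Put w = √(1+|Df|²), W = √(1+|∇τ|²) and a = e₃(f). Along the boundary Df = ∇τ + a e₃, hence w² =
W² + a², sinh φ = -a/W and cosh φ = w/W. Both sides of the main identity equal one expression in the
geometry of the boundary inside M: cosh φ · h + sinh φ · tr p + (dφ(∇τ) + p(∇τ, e₃))/W, where h is
the mean curvature of the boundary in M and tr p is the trace of p over the boundary.

On the spacetime side this is a computation in a boosted frame. The derivatives of cosh φ and sinh φ
multiply normal vectors and drop out of the mean curvature (`form_meanCurvatureVector_boost`), while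
the connection form of the normal bundle changes by dφ (`form_nabla_boost`).

On the graph side the outward normal is ν = (w/W) e₃ - df(ν) Df (`graph_normal_eq`,
`graph_normal_coeff`). Its second fundamental form is (w/W) II - df(ν) Hess f (`secondForm_graph`),
and the trace with respect to σ + dτ ⊗ dτ follows from the Sherman–Morrison formula
(`mtrace_add_rank_one`). What remains differs from the expression above by -a/W times the left side
of Jang's equation (`graph_algebra`, `graph_identity`).

For Minkowskian data the gradient of the time function satisfies dX(Df) = w n - ∂_t. As ∂_t is
parallel, differentiation gives Hess f = w p (`hess_time`), so the tensor in Jang's equation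
vanishes and V with it. The spatial projection Y is a local isometry from the graph metric to ℝ³ and
takes ν to the chosen normal, so k is the mean curvature of the projected surface. Tracing Hess f =
w p over the boundary gives Δτ = w tr p - a h, which is the gauge condition.

The connection is handled pointwise: `christoffel` and `nabla` at a point involve only the preferred
chart there, and every identity is verified in that chart. No transformation law for Christoffel
symbols is needed. -/

noncomputable section

namespace QuasiLocal

set_option linter.unusedSectionVars false

/-! ### Calculus in the preferred chart at a point, and metric compatibility. -/

section Coordinates

variable {E : Type*} [NormedAddCommGroup E] [NormedSpace ℝ E]
  {H : Type*} [TopologicalSpace H] {I : ModelWithCorners ℝ E H}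
  {A : Type*} [TopologicalSpace A] [ChartedSpace H A]
  {E' : Type*} [NormedAddCommGroup E'] [NormedSpace ℝ E']
  {H' : Type*} [TopologicalSpace H'] {I' : ModelWithCorners ℝ E' H'}
  {B : Type*} [TopologicalSpace B] [ChartedSpace H' B]
  {P : Type*} [NormedAddCommGroup P] [NormedSpace ℝ P]
  {Q : Type*} [NormedAddCommGroup Q] [NormedSpace ℝ Q]

theorem mvfderiv_eq_of_hasMFDerivAt {h : A → Q} {x : A} {L : TangentSpace I x →L[ℝ] Q}
    (hh : HasMFDerivAt I 𝓘(ℝ, Q) h x L) : mvfderiv I h x = L := by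
  unfold mvfderiv
  rw [hh.mfderiv]
  rfl

theorem mvfderiv_comp_differentiable {c : A → P} {h : P → Q} {x : A}
    (hh : DifferentiableAt ℝ h (c x)) (hc : MDifferentiableAt I 𝓘(ℝ, P) c x) :
    mvfderiv I (fun y => h (c y)) x = (fderiv ℝ h (c x)) ∘L mvfderiv I c x :=
  mvfderiv_eq_of_hasMFDerivAt (hh.hasFDerivAt.hasMFDerivAt.comp x hc.hasMFDerivAt)

theorem mvfderiv_clm_apply {c : A → P →L[ℝ] Q} {u : A → P} {x : A}
    (hc : MDifferentiableAt I 𝓘(ℝ, P →L[ℝ] Q) c x) (hu : MDifferentiableAt I 𝓘(ℝ, P) u x)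
    (t : TangentSpace I x) :
    mvfderiv I (fun y => c y (u y)) x t = mvfderiv I c x t (u x) + c x (mvfderiv I u x t) := by
  have h1 : HasMFDerivAt I 𝓘(ℝ, (P →L[ℝ] Q) × P) (fun y => (c y, u y)) x
      ((mvfderiv I c x).prod (mvfderiv I u x)) :=
    ⟨hc.continuousAt.prodMk hu.continuousAt, hc.hasMFDerivAt.2.prodMk hu.hasMFDerivAt.2⟩
  have h2 := ((isBoundedBilinearMap_apply (𝕜 := ℝ) (E := P) (F := Q)).hasFDerivAt
    (c x, u x)).hasMFDerivAt.comp x h1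
  have h3 := mvfderiv_eq_of_hasMFDerivAt (h := fun y => c y (u y)) h2
  rw [h3]
  exact add_comm _ _

theorem mvfderiv_congr {h k : A → Q} {x : A} (e : h =ᶠ[nhds x] k) :
    mvfderiv I h x = mvfderiv I k x := by
  unfold mvfderiv
  rw [e.mfderiv_eq]
  rfl

theorem mvfderiv_chain {j : B → A} {h : A → Q} {s : B}
    (hh : MDifferentiableAt I 𝓘(ℝ, Q) h (j s)) (hj : MDifferentiableAt I' I j s)
    (t : TangentSpace I' s) :
    mvfderiv I' (fun b => h (j b)) s t = mvfderiv I h (j s) (mfderiv I' I j s t) :=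
  congrArg (fun L => L t)
    (mvfderiv_eq_of_hasMFDerivAt (h := fun b => h (j b)) (hh.hasMFDerivAt.comp s hj.hasMFDerivAt))

section Charts

variable [IsManifold I 1 A] [IsManifold I' 1 B]

/-- The components at `y` of a tangent vector at `y`, in the preferred chart at `x`. -/
def toChart (x y : A) : TangentSpace I y →L[ℝ] E :=
  (trivializationAt E (TangentSpace I : A → Type _) x).continuousLinearMapAt ℝ y

/-- The tangent vector at `y` with given components in the preferred chart at `x`. -/
def ofChart (x y : A) : E →L[ℝ] TangentSpace I y :=
  (trivializationAt E (TangentSpace I : A → Type _) x).symmL ℝ y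

theorem mem_baseSet_trivializationAt_tangent (x : A) :
    ∀ᶠ y in nhds x, y ∈ (trivializationAt E (TangentSpace I : A → Type _) x).baseSet :=
  (trivializationAt E (TangentSpace I : A → Type _) x).open_baseSet.mem_nhds
    (mem_baseSet_trivializationAt E _ x)

theorem ofChart_toChart {x y : A}
    (hy : y ∈ (trivializationAt E (TangentSpace I : A → Type _) x).baseSet)
    (v : TangentSpace I y) : ofChart x y (toChart x y v) = v :=
  (trivializationAt E (TangentSpace I : A → Type _) x).symmL_continuousLinearMapAt hy v

theorem toChart_ofChart {x y : A}
    (hy : y ∈ (trivializationAt E (TangentSpace I : A → Type _) x).baseSet)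
    (v : E) : toChart (I := I) x y (ofChart x y v) = v :=
  (trivializationAt E (TangentSpace I : A → Type _) x).continuousLinearMapAt_symmL hy v

theorem trivializationAt_snd {x y : A}
    (hy : y ∈ (trivializationAt E (TangentSpace I : A → Type _) x).baseSet)
    (v : TangentSpace I y) :
    (trivializationAt E (TangentSpace I : A → Type _) x ⟨y, v⟩).2 = toChart x y v :=
  ((trivializationAt E (TangentSpace I : A → Type _) x).continuousLinearMapAt_apply_of_mem
    (R := ℝ) hy v).symm

theorem ofChart_comps (x : A) (v : TangentSpace I x) : ofChart x x (comps x v) = v :=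
  ofChart_toChart (mem_baseSet_trivializationAt E _ x) v

theorem comps_ofChart (x : A) (v : E) : comps (I := I) x (ofChart x x v) = v :=
  toChart_ofChart (mem_baseSet_trivializationAt E _ x) v

theorem coordForm_apply (G : FormField I A) (x y : A) (u v : E) :
    coordForm G x y u v = G y (ofChart x y u) (ofChart x y v) := rfl

theorem form_eq_coordForm (G : FormField I A) {x y : A}
    (hy : y ∈ (trivializationAt E (TangentSpace I : A → Type _) x).baseSet)
    (u v : TangentSpace I y) : G y u v = coordForm G x y (toChart x y u) (toChart x y v) := by
  rw [coordForm_apply, ofChart_toChart hy, ofChart_toChart hy]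

/-- The components, in the preferred chart at `F a`, of a vector field along `F`. -/
def coordAlong (I' : ModelWithCorners ℝ E' H') [IsManifold I' 1 B] {A : Type*} (F : A → B)
    (W : ∀ a : A, TangentSpace I' (F a)) (a b : A) : E' :=
  (trivializationAt E' (TangentSpace I' : B → Type _) (F a) ⟨F b, W b⟩).2

/-- Differentiability of a vector field along a map. -/
def DiffAlong (I : ModelWithCorners ℝ E H) (F : A → B)
    (W : ∀ a : A, TangentSpace I' (F a)) (a : A) : Prop :=
  MDifferentiableAt I I'.tangent (fun b => (⟨F b, W b⟩ : TangentBundle I' B)) a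

theorem diffAlong_iff {F : A → B} {W : ∀ a : A, TangentSpace I' (F a)} {a : A} :
    DiffAlong I F W a ↔ MDifferentiableAt I I' F a ∧
      MDifferentiableAt I 𝓘(ℝ, E') (coordAlong I' F W a) a :=
  mdifferentiableAt_totalSpace _ _

theorem coordAlong_self (F : A → B) (W : ∀ a : A, TangentSpace I' (F a)) (a : A) :
    coordAlong I' F W a a = comps (F a) (W a) :=
  trivializationAt_snd (mem_baseSet_trivializationAt E' _ (F a)) _

theorem eventually_mem_baseSet {F : A → B} {a : A} (hF : ContinuousAt F a) :
    ∀ᶠ b in nhds a, F b ∈ (trivializationAt E' (TangentSpace I' : B → Type _) (F a)).baseSet :=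
  hF.eventually (mem_baseSet_trivializationAt_tangent (I := I') (F a))

theorem eventually_coordAlong {F : A → B} {a : A} (hF : ContinuousAt F a)
    (W : ∀ a : A, TangentSpace I' (F a)) :
    ∀ᶠ b in nhds a, coordAlong I' F W a b = toChart (F a) (F b) (W b) := by
  filter_upwards [eventually_mem_baseSet (I' := I') hF] with b hb
  exact trivializationAt_snd hb _

theorem DiffAlong.comp {S : Type*} [TopologicalSpace S] {E₀ : Type*} [NormedAddCommGroup E₀]
    [NormedSpace ℝ E₀] {H₀ : Type*} [TopologicalSpace H₀] {I₀ : ModelWithCorners ℝ E₀ H₀}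
    [ChartedSpace H₀ S] {F : A → B} {W : ∀ a : A, TangentSpace I' (F a)} {j : S → A} {s : S}
    (hW : DiffAlong I F W (j s)) (hj : MDifferentiableAt I₀ I j s) :
    DiffAlong I₀ (fun s => F (j s)) (fun s => W (j s)) s :=
  MDifferentiableAt.comp s hW hj

theorem comps_nabla (G : FormField I' B) (F : A → B) (W : ∀ a : A, TangentSpace I' (F a)) (a : A)
    (u : TangentSpace I a) : nabla G F W a u =
      ofChart (F a) (F a) (mvfderiv I (coordAlong I' F W a) a u) +
        christoffel G (F a) (mfderiv I I' F a u) (W a) := rfl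

/-- Christoffel symbols with lowered index. Invertibility matters because
`ContinuousLinearMap.inverse` is zero on maps that are not invertible. -/
theorem form_christoffel {G : FormField I A} {x : A} (hG : (G x).IsInvertible)
    (u v z : TangentSpace I x) :
    G x (christoffel G x u v) z = 1 / 2 * (coordFormDeriv G x (comps x u) (comps x v) (comps x z)
      + coordFormDeriv G x (comps x v) (comps x u) (comps x z)
      - coordFormDeriv G x (comps x z) (comps x u) (comps x v)) := by
  unfold christoffel
  rw [hG.self_apply_inverse]
  simp

theorem coordFormDeriv_comps (G : FormField I A) (x : A) (u : TangentSpace I x) :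
    coordFormDeriv G x (comps x u) = mvfderiv I (coordForm G x) x u := by
  change mvfderiv I (coordForm G x) x (ofChart x x (comps x u)) = _
  rw [ofChart_comps]

/-- Differentiability at `x` of the components of a form field. -/
def FormDiffAt (G : FormField I A) (x : A) : Prop :=
  MDifferentiableAt I 𝓘(ℝ, E →L[ℝ] E →L[ℝ] ℝ) (coordForm G x) x

theorem mvfderiv_coordForm_symm {G : FormField I A} (hs : ∀ y u v, G y u v = G y v u) {x : A}
    (hG : FormDiffAt G x) (t : TangentSpace I x) (u v : E) :
    mvfderiv I (coordForm G x) x t u v = mvfderiv I (coordForm G x) x t v u := by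
  have key : ∀ a b : E, mvfderiv I (fun y => coordForm G x y a b) x t
      = mvfderiv I (coordForm G x) x t a b := by
    intro a b
    rw [mvfderiv_clm_apply (c := fun y => coordForm G x y a) (u := fun _ => b),
      mvfderiv_clm_apply (c := coordForm G x) (u := fun _ => a)]
    · simp [mvfderiv_const]
    · exact hG
    · exact mdifferentiableAt_const
    · exact hG.clm_apply mdifferentiableAt_const
    · exact mdifferentiableAt_const
  rw [← key, ← key]
  congr 2
  funext y
  exact hs _ _ _

/-- In the chart at `F a` the product rule leaves the derivative of the metric components in the
direction dF(u). The two lowered Christoffel terms add up to exactly this, since their other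
derivatives cancel by the symmetry of G. -/
theorem nabla_metric {G : FormField I' B} (hs : ∀ y u v, G y u v = G y v u) {F : A → B} {a : A}
    (hG : (G (F a)).IsInvertible) (hd : FormDiffAt G (F a))
    {W Z : ∀ a : A, TangentSpace I' (F a)} (hW : DiffAlong I F W a) (hZ : DiffAlong I F Z a)
    (u : TangentSpace I a) :
    mvfderiv I (fun b => G (F b) (W b) (Z b)) a u
      = G (F a) (nabla G F W a u) (Z a) + G (F a) (W a) (nabla G F Z a u) := by
  obtain ⟨hF, hw⟩ := diffAlong_iff.1 hW
  obtain ⟨-, hz⟩ := diffAlong_iff.1 hZ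
  have hc : MDifferentiableAt I 𝓘(ℝ, E' →L[ℝ] E' →L[ℝ] ℝ)
      (fun b => coordForm G (F a) (F b)) a := MDifferentiableAt.comp a hd hF
  have e : (fun b => G (F b) (W b) (Z b)) =ᶠ[nhds a]
      fun b => coordForm G (F a) (F b) (coordAlong I' F W a b) (coordAlong I' F Z a b) := by
    filter_upwards [eventually_mem_baseSet (I' := I') hF.continuousAt,
      eventually_coordAlong hF.continuousAt W, eventually_coordAlong hF.continuousAt Z]
      with b h1 h2 h3
    rw [h2, h3, form_eq_coordForm G h1]
  rw [mvfderiv_congr e, mvfderiv_clm_apply (hc.clm_apply hw) hz, mvfderiv_clm_apply hc hw,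
    mvfderiv_chain (h := coordForm G (F a)) hd hF, comps_nabla, comps_nabla]
  simp only [add_apply, map_add]
  rw [hs _ (W a) (christoffel _ _ _ _), form_christoffel hG, form_christoffel hG]
  simp only [coordFormDeriv_comps, coordAlong_self]
  simp only [coordForm_apply, ofChart_comps]
  rw [mvfderiv_coordForm_symm hs hd (mfderiv I I' F a u) (comps _ (Z a)),
    mvfderiv_coordForm_symm hs hd (Z a) (comps _ _) (comps _ (W a)),
    mvfderiv_coordForm_symm hs hd (W a) (comps _ _) (comps _ (Z a))]
  ring

end Charts

end Coordinates

/-! ### Linearity, Leibniz rule and chain rule for the covariant derivative. -/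

section Leibniz

variable {E : Type*} [NormedAddCommGroup E] [NormedSpace ℝ E]
  {H : Type*} [TopologicalSpace H] {I : ModelWithCorners ℝ E H}
  {A : Type*} [TopologicalSpace A] [ChartedSpace H A]
  {E' : Type*} [NormedAddCommGroup E'] [NormedSpace ℝ E']
  {H' : Type*} [TopologicalSpace H'] {I' : ModelWithCorners ℝ E' H'}
  {B : Type*} [TopologicalSpace B] [ChartedSpace H' B]
  {E₀ : Type*} [NormedAddCommGroup E₀] [NormedSpace ℝ E₀]
  {H₀ : Type*} [TopologicalSpace H₀] {I₀ : ModelWithCorners ℝ E₀ H₀}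
  {S : Type*} [TopologicalSpace S] [ChartedSpace H₀ S]
  [IsManifold I 1 A] [IsManifold I' 1 B] [IsManifold I₀ 1 S]

set_option synthInstance.maxHeartbeats 200000 in
theorem christoffel_add_left (G : FormField I A) (x : A) (u u' v : TangentSpace I x) :
    christoffel G x (u + u') v = christoffel G x u v + christoffel G x u' v := by
  unfold christoffel
  rw [← map_add]
  congr 1
  ext z
  simp
  ring

set_option synthInstance.maxHeartbeats 200000 in
theorem christoffel_smul_left (G : FormField I A) (x : A) (c : ℝ) (u v : TangentSpace I x) :
    christoffel G x (c • u) v = c • christoffel G x u v := by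
  unfold christoffel
  rw [← map_smul]
  congr 1
  ext z
  simp
  ring

set_option synthInstance.maxHeartbeats 200000 in
theorem christoffel_add_right (G : FormField I A) (x : A) (u v v' : TangentSpace I x) :
    christoffel G x u (v + v') = christoffel G x u v + christoffel G x u v' := by
  unfold christoffel
  rw [← map_add]
  congr 1
  ext z
  simp
  ring

set_option synthInstance.maxHeartbeats 200000 in
theorem christoffel_smul_right (G : FormField I A) (x : A) (c : ℝ) (u v : TangentSpace I x) :
    christoffel G x u (c • v) = c • christoffel G x u v := by
  unfold christoffel
  rw [← map_smul]
  congr 1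
  ext z
  simp
  ring

theorem nabla_add_left (G : FormField I' B) (F : A → B) (W : ∀ a : A, TangentSpace I' (F a))
    (a : A) (u u' : TangentSpace I a) :
    nabla G F W a (u + u') = nabla G F W a u + nabla G F W a u' := by
  simp only [comps_nabla, map_add, christoffel_add_left]
  abel

theorem nabla_smul_left (G : FormField I' B) (F : A → B) (W : ∀ a : A, TangentSpace I' (F a))
    (a : A) (c : ℝ) (u : TangentSpace I a) :
    nabla G F W a (c • u) = c • nabla G F W a u := by
  simp only [comps_nabla, map_smul, christoffel_smul_left, smul_add]

theorem nabla_congr (G : FormField I' B) {F : A → B} {W Z : ∀ a : A, TangentSpace I' (F a)}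
    {a : A} (e : ∀ᶠ b in nhds a, W b = Z b) (u : TangentSpace I a) :
    nabla G F W a u = nabla G F Z a u := by
  have h : coordAlong I' F W a =ᶠ[nhds a] coordAlong I' F Z a := by
    filter_upwards [e] with b hb
    simp only [coordAlong, hb]
  rw [comps_nabla, comps_nabla, mvfderiv_congr h, e.self_of_nhds]

theorem coordAlong_add {F : A → B} {a : A} (hF : ContinuousAt F a)
    (W Z : ∀ a : A, TangentSpace I' (F a)) :
    coordAlong I' F (fun b => W b + Z b) a =ᶠ[nhds a]
      fun b => coordAlong I' F W a b + coordAlong I' F Z a b := by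
  filter_upwards [eventually_coordAlong hF W, eventually_coordAlong hF Z,
    eventually_coordAlong hF (fun b => W b + Z b)] with b h1 h2 h3
  rw [h1, h2, h3, map_add]

theorem coordAlong_smul {F : A → B} {a : A} (hF : ContinuousAt F a) (c : A → ℝ)
    (W : ∀ a : A, TangentSpace I' (F a)) :
    coordAlong I' F (fun b => c b • W b) a =ᶠ[nhds a] fun b => c b • coordAlong I' F W a b := by
  filter_upwards [eventually_coordAlong hF W,
    eventually_coordAlong hF (fun b => c b • W b)] with b h1 h3
  rw [h1, h3, map_smul]

theorem DiffAlong.add {F : A → B} {W Z : ∀ a : A, TangentSpace I' (F a)} {a : A}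
    (hW : DiffAlong I F W a) (hZ : DiffAlong I F Z a) :
    DiffAlong I F (fun b => W b + Z b) a := by
  rw [diffAlong_iff] at *
  exact ⟨hW.1, (hW.2.add hZ.2).congr_of_eventuallyEq (coordAlong_add hW.1.continuousAt W Z)⟩

theorem DiffAlong.smul {F : A → B} {c : A → ℝ} {W : ∀ a : A, TangentSpace I' (F a)} {a : A}
    (hc : MDifferentiableAt I 𝓘(ℝ, ℝ) c a) (hW : DiffAlong I F W a) :
    DiffAlong I F (fun b => c b • W b) a := by
  rw [diffAlong_iff] at *
  exact ⟨hW.1, (hc.smul hW.2).congr_of_eventuallyEq (coordAlong_smul hW.1.continuousAt c W)⟩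

theorem nabla_add (G : FormField I' B) {F : A → B} {W Z : ∀ a : A, TangentSpace I' (F a)} {a : A}
    (hW : DiffAlong I F W a) (hZ : DiffAlong I F Z a) (u : TangentSpace I a) :
    nabla G F (fun b => W b + Z b) a u = nabla G F W a u + nabla G F Z a u := by
  obtain ⟨hF, hw⟩ := diffAlong_iff.1 hW
  obtain ⟨-, hz⟩ := diffAlong_iff.1 hZ
  simp only [comps_nabla]
  rw [mvfderiv_congr (coordAlong_add hF.continuousAt W Z), mvfderiv_fun_add hw hz,
    christoffel_add_right, add_apply, map_add]
  abel

theorem nabla_smul (G : FormField I' B) {F : A → B} {c : A → ℝ}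
    {W : ∀ a : A, TangentSpace I' (F a)} {a : A} (hc : MDifferentiableAt I 𝓘(ℝ, ℝ) c a)
    (hW : DiffAlong I F W a) (u : TangentSpace I a) :
    nabla G F (fun b => c b • W b) a u = (mvfderiv I c a u) • W a + c a • nabla G F W a u := by
  obtain ⟨hF, hw⟩ := diffAlong_iff.1 hW
  simp only [comps_nabla]
  rw [mvfderiv_congr (coordAlong_smul hF.continuousAt c W), mvfderiv_fun_smul hc hw,
    christoffel_smul_right]
  simp only [add_apply, smul_apply, ContinuousLinearMap.smulRight_apply, map_add, map_smul,
    coordAlong_self, ofChart_comps, smul_add]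
  abel

/-- Both sides are computed in the same chart, the one at `F (j s)`, so this is only the chain rule.
-/
theorem nabla_comp (G : FormField I' B) {F : A → B} {W : ∀ a : A, TangentSpace I' (F a)}
    {j : S → A} {s : S} (hj : MDifferentiableAt I₀ I j s) (hW : DiffAlong I F W (j s))
    (u : TangentSpace I₀ s) :
    nabla G (fun s => F (j s)) (fun s => W (j s)) s u = nabla G F W (j s) (mfderiv I₀ I j s u) := by
  obtain ⟨hF, hw⟩ := diffAlong_iff.1 hW
  have h1 : mfderiv I₀ I' (fun s => F (j s)) s u = mfderiv I I' F (j s) (mfderiv I₀ I j s u) :=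
    mfderiv_comp_apply s hF hj u
  have h2 : mvfderiv I₀ (coordAlong I' (fun s => F (j s)) (fun s => W (j s)) s) s u =
      mvfderiv I (coordAlong I' F W (j s)) (j s) (mfderiv I₀ I j s u) :=
    mvfderiv_chain (h := coordAlong I' F W (j s)) hw hj u
  rw [comps_nabla, comps_nabla, h1, h2]

end Leibniz

/-! ### Symmetry of second derivatives and the Christoffel symbols of a pulled-back metric. -/

section SecondDerivatives

variable {E : Type*} [NormedAddCommGroup E] [NormedSpace ℝ E]
  {H : Type*} [TopologicalSpace H] {I : ModelWithCorners ℝ E H}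
  {A : Type*} [TopologicalSpace A] [ChartedSpace H A]
  {E' : Type*} [NormedAddCommGroup E'] [NormedSpace ℝ E']
  {H' : Type*} [TopologicalSpace H'] {I' : ModelWithCorners ℝ E' H'}
  {B : Type*} [TopologicalSpace B] [ChartedSpace H' B]
  [IsManifold I 1 A] [IsManifold I' 1 B]

/-- The derivative of `F` at `y`, in the preferred charts at `x` and `F x`. -/
def coordDeriv (I : ModelWithCorners ℝ E H) (I' : ModelWithCorners ℝ E' H') [IsManifold I 1 A]
    [IsManifold I' 1 B] (F : A → B) (x y : A) : E →L[ℝ] E' :=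
  toChart (I := I') (F x) (F y) ∘L mfderiv I I' F y ∘L ofChart (I := I) x y

theorem mdifferentiableAt_coordDeriv {F : A → B} {x : A} (hF : ContMDiff I I' 2 F) :
    MDifferentiableAt I 𝓘(ℝ, E →L[ℝ] E') (coordDeriv I I' F x) x :=
  ((hF x).mfderiv_const (m := 1) (by norm_num)).mdifferentiableAt one_ne_zero

/-- Identifies the derivative in bundle coordinates with an ordinary derivative in the model space,
so that the symmetry of second derivatives becomes available. It is taken within `Set.range I`
because the source may have a boundary. -/
theorem coordDeriv_eq_fderivWithin {F : A → B} {x : A} (hF : ContMDiff I I' 2 F) :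
    ∀ᶠ y in nhds x, coordDeriv I I' F x y =
      fderivWithin ℝ (writtenInExtChartAt I I' x F) (Set.range I) (extChartAt I x y) := by
  filter_upwards [chart_source_mem_nhds H x,
    (hF x).continuousAt.eventually (chart_source_mem_nhds H' (F x))] with y hx hFx
  have hy : MDifferentiableAt I I' F y := (hF y).mdifferentiableAt (by simp)
  unfold coordDeriv toChart ofChart
  rw [TangentBundle.continuousLinearMapAt_trivializationAt hFx,
    TangentBundle.symmL_trivializationAt hx]
  have hy' : (extChartAt I x).symm (extChartAt I x y) = y :=
    (extChartAt I x).left_inv (by simpa using hx)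
  have hr : extChartAt I x y ∈ Set.range I := by
    exact extChartAt_target_subset_range x ((extChartAt I x).map_source (by simpa using hx))
  have d1 : MDifferentiableWithinAt 𝓘(ℝ, E) I (extChartAt I x).symm (Set.range I)
      (extChartAt I x y) :=
    mdifferentiableWithinAt_extChartAt_symm ((extChartAt I x).map_source (by simpa using hx))
  have d2 : HasMFDerivAt I' 𝓘(ℝ, E') (extChartAt I' (F x)) (F y)
      (mfderiv I' 𝓘(ℝ, E') (extChartAt I' (F x)) (F y)) :=
    (mdifferentiableAt_extChartAt hFx).hasMFDerivAt
  have d3 : HasMFDerivAt I 𝓘(ℝ, E') (extChartAt I' (F x) ∘ F)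
      ((extChartAt I x).symm (extChartAt I x y))
      (show E →L[ℝ] E' from mfderiv I' 𝓘(ℝ, E') (extChartAt I' (F x)) (F y) ∘L
        mfderiv I I' F y) := by
    rw [hy']
    exact d2.comp y hy.hasMFDerivAt
  have d4 : HasFDerivWithinAt (writtenInExtChartAt I I' x F)
      (show E →L[ℝ] E' from (mfderiv I' 𝓘(ℝ, E') (extChartAt I' (F x)) (F y) ∘L
        mfderiv I I' F y) ∘L mfderivWithin 𝓘(ℝ, E) I (extChartAt I x).symm (Set.range I)
          (extChartAt I x y)) (Set.range I) (extChartAt I x y) :=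
    hasMFDerivWithinAt_iff_hasFDerivWithinAt.1
      (d3.comp_hasMFDerivWithinAt (extChartAt I x y) d1.hasMFDerivWithinAt)
  exact (d4.fderivWithin (I.uniqueDiffOn _ hr)).symm

/-- This is what makes the connection torsion-free along maps. It holds at boundary points too: the
range of the model has unique derivatives and lies in the closure of its interior. -/
theorem mvfderiv_coordDeriv_symm {F : A → B} {x : A} (hF : ContMDiff I I' 2 F)
    (u v : TangentSpace I x) :
    mvfderiv I (coordDeriv I I' F x) x u (comps x v) =
      mvfderiv I (coordDeriv I I' F x) x v (comps x u) := by
  -- A tangent vector at x is by construction its component vector in the preferred chart at x.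
  have hc : ∀ v : TangentSpace I x, comps x v = (v : E) := by
    intro v
    change (trivializationAt E (TangentSpace I : A → Type _) x).continuousLinearMapAt ℝ x v = _
    rw [TangentBundle.continuousLinearMapAt_trivializationAt_eq_core (mem_chart_source H x)]
    exact (tangentBundleCore I A).coordChange_self _ _ (mem_chart_source H x) _
  have hr : extChartAt I x x ∈ Set.range I := Set.mem_range_self _
  set Φ := fderivWithin ℝ (writtenInExtChartAt I I' x F) (Set.range I) with hΦ
  have hA : mvfderiv I (coordDeriv I I' F x) x = fderivWithin ℝ Φ (Set.range I)
      (extChartAt I x x) := by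
    rw [(mdifferentiableAt_coordDeriv hF).mvfderiv]
    apply Filter.EventuallyEq.fderivWithin_eq_of_mem _ hr
    have hcont : Filter.Tendsto (extChartAt I x).symm (nhdsWithin (extChartAt I x x) (Set.range I))
        (nhds x) := by
      have := (continuousAt_extChartAt_symm (I := I) x).tendsto
      rw [extChartAt_to_inv] at this
      exact this.mono_left nhdsWithin_le_nhds
    filter_upwards [hcont.eventually (coordDeriv_eq_fderivWithin hF),
      extChartAt_target_mem_nhdsWithin (I := I) x] with z h1 h2
    simp only [writtenInExtChartAt, extChartAt_model_space_eq_id, Function.comp,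
      PartialEquiv.refl_coe, id]
    rw [h1, (extChartAt I x).right_inv h2]
  rw [hA, hc, hc]
  have hsm := (contMDiffAt_iff.1 (hF x)).2
  exact ContDiffWithinAt.isSymmSndFDerivWithinAt (n := 2) hsm (by simp) I.uniqueDiffOn
    (I.range_subset_closure_interior hr) hr _ _

theorem coordDeriv_comps (F : A → B) (x : A) (v : TangentSpace I x) :
    coordDeriv I I' F x x (comps x v) = comps (F x) (mfderiv I I' F x v) := by
  change comps (F x) (mfderiv I I' F x (ofChart x x (comps x v))) = _
  rw [ofChart_comps]

theorem mvfderiv_form_apply {c : A → E' →L[ℝ] E' →L[ℝ] ℝ} {x : A}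
    (hc : MDifferentiableAt I 𝓘(ℝ, E' →L[ℝ] E' →L[ℝ] ℝ) c x) {a b : A → E'}
    (ha : MDifferentiableAt I 𝓘(ℝ, E') a x) (hb : MDifferentiableAt I 𝓘(ℝ, E') b x)
    (t : TangentSpace I x) :
    mvfderiv I (fun y => c y (a y) (b y)) x t = mvfderiv I c x t (a x) (b x)
      + c x (mvfderiv I a x t) (b x) + c x (a x) (mvfderiv I b x t) := by
  rw [mvfderiv_clm_apply (hc.clm_apply ha) hb, mvfderiv_clm_apply hc ha]
  rfl

theorem mvfderiv_const_apply (c : E') {x : A} (t : TangentSpace I x) :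
    mvfderiv I (fun _ : A => c) x t = 0 := by
  rw [mvfderiv_const]
  rfl

theorem coordForm_pullback (G : FormField I' B) {F : A → B} {x : A} (hF : ContinuousAt F x) :
    ∀ᶠ y in nhds x, coordForm (pullback (I := I) G F) x y =
      pullForm (coordDeriv I I' F x y) (coordForm G (F x) (F y)) := by
  filter_upwards [eventually_mem_baseSet (I' := I') hF] with y hy
  ext u v
  exact form_eq_coordForm G hy _ _

theorem formDiffAt_pullback {G : FormField I' B} {F : A → B} {x : A} (hF : ContMDiff I I' 2 F)
    (hG : FormDiffAt G (F x)) : FormDiffAt (pullback (I := I) G F) x := by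
  have h1 := mdifferentiableAt_coordDeriv hF (x := x)
  have h2 : MDifferentiableAt I 𝓘(ℝ, E' →L[ℝ] E' →L[ℝ] ℝ) (fun y => coordForm G (F x) (F y)) x :=
    MDifferentiableAt.comp x hG ((hF x).mdifferentiableAt (by simp))
  have h3 : MDifferentiableAt I 𝓘(ℝ, E →L[ℝ] E →L[ℝ] ℝ)
      (fun y => pullForm (coordDeriv I I' F x y) (coordForm G (F x) (F y))) x :=
    (h1.clm_precomp (F₃ := ℝ)).clm_comp (h2.clm_comp h1)
  exact h3.congr_of_eventuallyEq (coordForm_pullback G (hF x).continuousAt)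

theorem mvfderiv_coordForm_pullback {G : FormField I' B} {F : A → B} {x : A}
    (hF : ContMDiff I I' 2 F) (hG : FormDiffAt G (F x)) (t u v : TangentSpace I x) :
    mvfderiv I (coordForm (pullback (I := I) G F) x) x t (comps x u) (comps x v) =
      mvfderiv I' (coordForm G (F x)) (F x) (mfderiv I I' F x t)
          (comps (F x) (mfderiv I I' F x u)) (comps (F x) (mfderiv I I' F x v))
        + coordForm G (F x) (F x) (mvfderiv I (coordDeriv I I' F x) x t (comps x u))
            (comps (F x) (mfderiv I I' F x v))
        + coordForm G (F x) (F x) (comps (F x) (mfderiv I I' F x u))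
            (mvfderiv I (coordDeriv I I' F x) x t (comps x v)) := by
  have hF1 : MDifferentiableAt I I' F x := (hF x).mdifferentiableAt (by simp)
  have h1 := mdifferentiableAt_coordDeriv hF (x := x)
  have h2 : MDifferentiableAt I 𝓘(ℝ, E' →L[ℝ] E' →L[ℝ] ℝ) (fun y => coordForm G (F x) (F y)) x :=
    MDifferentiableAt.comp x hG hF1
  have hd : ∀ w : E, MDifferentiableAt I 𝓘(ℝ, E') (fun y => coordDeriv I I' F x y w) x :=
    fun w => h1.clm_apply mdifferentiableAt_const
  have hdd : ∀ w : E, mvfderiv I (fun y => coordDeriv I I' F x y w) x t =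
      mvfderiv I (coordDeriv I I' F x) x t w := by
    intro w
    rw [mvfderiv_clm_apply h1 mdifferentiableAt_const, mvfderiv_const_apply, map_zero, add_zero]
  have e : (fun y => coordForm (pullback (I := I) G F) x y (comps x u) (comps x v)) =ᶠ[nhds x]
      fun y => coordForm G (F x) (F y) (coordDeriv I I' F x y (comps x u))
        (coordDeriv I I' F x y (comps x v)) := by
    filter_upwards [coordForm_pullback G (I := I) (hF x).continuousAt] with y hy
    rw [hy]
    rfl
  have h3 := mvfderiv_form_apply (formDiffAt_pullback (I := I) hF hG)
    (mdifferentiableAt_const (c := comps x u)) (mdifferentiableAt_const (c := comps x v)) t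
  rw [mvfderiv_const_apply, mvfderiv_const_apply, map_zero, map_zero, zero_apply, add_zero,
    add_zero] at h3
  rw [← h3, mvfderiv_congr e, mvfderiv_form_apply h2 (hd _) (hd _), hdd, hdd,
    mvfderiv_chain (h := coordForm G (F x)) hG hF1, coordDeriv_comps, coordDeriv_comps]

/-- Differentiating the pulled-back components three times over produces six terms with second
derivatives of F. By symmetry four of them cancel and two agree; the factor 1/2 leaves one copy of
the second derivative in the directions u, v. -/
theorem form_christoffel_pullback {G : FormField I' B} (hs : ∀ y u v, G y u v = G y v u)
    {F : A → B} {x : A} (hF : ContMDiff I I' 2 F) (hG : (G (F x)).IsInvertible)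
    (hd : FormDiffAt G (F x)) (hg : (pullback (I := I) G F x).IsInvertible)
    (u v z : TangentSpace I x) :
    pullback G F x (christoffel (pullback G F) x u v) z =
      G (F x) (ofChart (F x) (F x) (mvfderiv I (coordDeriv I I' F x) x u (comps x v))
        + christoffel G (F x) (mfderiv I I' F x u) (mfderiv I I' F x v)) (mfderiv I I' F x z) := by
  have hc : ∀ a b, coordForm G (F x) (F x) a b = coordForm G (F x) (F x) b a :=
    fun a b => hs _ _ _
  rw [form_christoffel hg, map_add, add_apply, form_christoffel hG]
  simp only [coordFormDeriv_comps, mvfderiv_coordForm_pullback hF hd]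
  have h1 : G (F x) (ofChart (F x) (F x) (mvfderiv I (coordDeriv I I' F x) x u (comps x v)))
      (mfderiv I I' F x z) = coordForm G (F x) (F x)
        (mvfderiv I (coordDeriv I I' F x) x u (comps x v)) (comps (F x) (mfderiv I I' F x z)) := by
    rw [coordForm_apply, ofChart_comps]
  rw [h1, mvfderiv_coordDeriv_symm hF v u, mvfderiv_coordDeriv_symm hF z u,
    mvfderiv_coordDeriv_symm hF z v, hc (comps (F x) (mfderiv I I' F x v)),
    hc (comps (F x) (mfderiv I I' F x u))]
  rw [hc (mvfderiv I (coordDeriv I I' F x) x u (comps x z))]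
  ring

end SecondDerivatives

/-! ### The Gauss formula for vector fields along a map. -/

section Gauss

variable {E : Type*} [NormedAddCommGroup E] [NormedSpace ℝ E]
  {H : Type*} [TopologicalSpace H] {I : ModelWithCorners ℝ E H}
  {A : Type*} [TopologicalSpace A] [ChartedSpace H A]
  {E' : Type*} [NormedAddCommGroup E'] [NormedSpace ℝ E']
  {H' : Type*} [TopologicalSpace H'] {I' : ModelWithCorners ℝ E' H'}
  {B : Type*} [TopologicalSpace B] [ChartedSpace H' B]
  {E₀ : Type*} [NormedAddCommGroup E₀] [NormedSpace ℝ E₀]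
  {H₀ : Type*} [TopologicalSpace H₀] {I₀ : ModelWithCorners ℝ E₀ H₀}
  {S : Type*} [TopologicalSpace S] [ChartedSpace H₀ S]
  [IsManifold I 1 A] [IsManifold I' 1 B] [IsManifold I₀ 1 S]

theorem coordAlong_mfderiv {F : A → B} (hF : ContMDiff I I' 2 F) {j : S → A} {s : S}
    (hj : ContinuousAt j s) (W : ∀ s : S, TangentSpace I (j s)) :
    coordAlong I' (fun s => F (j s)) (fun s => mfderiv I I' F (j s) (W s)) s =ᶠ[nhds s]
      fun b => coordDeriv I I' F (j s) (j b) (coordAlong I j W s b) := by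
  have hFj : ContinuousAt (fun s => F (j s)) s := (hF (j s)).continuousAt.comp hj
  filter_upwards [eventually_coordAlong hFj (fun s => mfderiv I I' F (j s) (W s)),
    eventually_coordAlong hj W, eventually_mem_baseSet (I' := I) hj] with b h1 h2 h3
  rw [h1, h2]
  change _ = toChart (F (j s)) (F (j b)) (mfderiv I I' F (j b) (ofChart (j s) (j b) _))
  rw [ofChart_toChart h3]

theorem DiffAlong.mfderiv {F : A → B} (hF : ContMDiff I I' 2 F) {j : S → A} {s : S}
    {W : ∀ s : S, TangentSpace I (j s)} (hW : DiffAlong I₀ j W s) :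
    DiffAlong I₀ (fun s => F (j s)) (fun s => mfderiv I I' F (j s) (W s)) s := by
  obtain ⟨hj, hw⟩ := diffAlong_iff.1 hW
  refine diffAlong_iff.2 ⟨((hF (j s)).mdifferentiableAt (by simp)).comp s hj, ?_⟩
  have h1 : MDifferentiableAt I₀ 𝓘(ℝ, E →L[ℝ] E') (fun b => coordDeriv I I' F (j s) (j b)) s :=
    MDifferentiableAt.comp s (mdifferentiableAt_coordDeriv hF) hj
  exact (h1.clm_apply hw).congr_of_eventuallyEq (coordAlong_mfderiv hF hj.continuousAt W)

/-- The tangential part of the derivative of a tangential vector field is its intrinsic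
derivative. -/
theorem form_nabla_mfderiv {G : FormField I' B} (hs : ∀ y u v, G y u v = G y v u)
    {F : A → B} (hF : ContMDiff I I' 2 F) {j : S → A} {s : S} (hG : (G (F (j s))).IsInvertible)
    (hd : FormDiffAt G (F (j s))) (hg : (pullback (I := I) G F (j s)).IsInvertible)
    {W : ∀ s : S, TangentSpace I (j s)} (hW : DiffAlong I₀ j W s) (u : TangentSpace I₀ s)
    (z : TangentSpace I (j s)) :
    G (F (j s)) (nabla G (fun s => F (j s)) (fun s => mfderiv I I' F (j s) (W s)) s u)
      (mfderiv I I' F (j s) z) = pullback G F (j s) (nabla (pullback G F) j W s u) z := by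
  obtain ⟨hj, hw⟩ := diffAlong_iff.1 hW
  have hF1 : MDifferentiableAt I I' F (j s) := (hF (j s)).mdifferentiableAt (by simp)
  have h1 : MDifferentiableAt I₀ 𝓘(ℝ, E →L[ℝ] E') (fun b => coordDeriv I I' F (j s) (j b)) s :=
    MDifferentiableAt.comp s (mdifferentiableAt_coordDeriv hF) hj
  have h2 : mfderiv I₀ I' (fun s => F (j s)) s u = mfderiv I I' F (j s) (mfderiv I₀ I j s u) :=
    mfderiv_comp_apply s hF1 hj u
  have h3 : ofChart (F (j s)) (F (j s))
      (coordDeriv I I' F (j s) (j s) (mvfderiv I₀ (coordAlong I j W s) s u)) =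
      mfderiv I I' F (j s) (ofChart (j s) (j s) (mvfderiv I₀ (coordAlong I j W s) s u)) := by
    have := coordDeriv_comps (I' := I') F (j s)
      (ofChart (I := I) (j s) (j s) (mvfderiv I₀ (coordAlong I j W s) s u))
    rw [comps_ofChart] at this
    rw [this, ofChart_comps]
  rw [comps_nabla, comps_nabla, h2, mvfderiv_congr (coordAlong_mfderiv hF hj.continuousAt W),
    mvfderiv_clm_apply h1 hw, mvfderiv_chain (h := coordDeriv I I' F (j s))
      (mdifferentiableAt_coordDeriv hF) hj]
  simp only [map_add, add_apply]
  -- The derivative of dF(W) splits into the second derivative of F and dF of the derivative of the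
  -- components of W. The first joins the ambient Christoffel term to form the intrinsic one.
  rw [form_christoffel_pullback hs hF hG hd hg, h3, coordAlong_self]
  simp only [map_add, add_apply]
  have h4 : pullback G F (j s) (ofChart (j s) (j s) (mvfderiv I₀ (coordAlong I j W s) s u)) z =
    G (F (j s)) (mfderiv I I' F (j s) (ofChart (j s) (j s)
      (mvfderiv I₀ (coordAlong I j W s) s u))) (mfderiv I I' F (j s) z) := rfl
  rw [h4]
  ring

end Gauss

/-! ### Nondegenerate forms and the differentiability of gradients. -/

section Nondegenerate

variable {E : Type*} [NormedAddCommGroup E] [NormedSpace ℝ E] [FiniteDimensional ℝ E]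
  {H : Type*} [TopologicalSpace H] {I : ModelWithCorners ℝ E H}
  {A : Type*} [TopologicalSpace A] [ChartedSpace H A] [IsManifold I 1 A]

theorem isInvertible_of_injective {b : E →L[ℝ] E →L[ℝ] ℝ} (hb : Function.Injective b) :
    b.IsInvertible := by
  have hd : Module.finrank ℝ E = Module.finrank ℝ (E →L[ℝ] ℝ) := by
    rw [← LinearMap.toContinuousLinearMap.finrank_eq]
    exact Subspace.dual_finrank_eq.symm
  refine ⟨(LinearEquiv.ofInjectiveOfFinrankEq (b : E →ₗ[ℝ] E →L[ℝ] ℝ) hb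
    hd).toContinuousLinearEquiv, ?_⟩
  ext u v
  rfl

/-- A form on a tangent space without kernel. -/
def Nondegenerate (G : FormField I A) (x : A) : Prop :=
  ∀ u : TangentSpace I x, (∀ v, G x u v = 0) → u = 0

theorem Nondegenerate.isInvertible {G : FormField I A} {x : A} (h : Nondegenerate G x) :
    (G x).IsInvertible := by
  refine isInvertible_of_injective (E := E) ?_
  intro (u : TangentSpace I x) (v : TangentSpace I x) (huv : G x u = G x v)
  refine sub_eq_zero.1 (h (u - v) fun w => ?_)
  rw [map_sub, huv, sub_self]
  rfl

theorem nondegenerate_of_pos {G : FormField I A} {x : A}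
    (h : ∀ v : TangentSpace I x, v ≠ 0 → 0 < G x v v) : Nondegenerate G x := by
  intro u hu
  by_contra hne
  exact (h u hne).ne' (hu u)

theorem coordForm_isInvertible {G : FormField I A} {x y : A} (h : Nondegenerate G y)
    (hy : y ∈ (trivializationAt E (TangentSpace I : A → Type _) x).baseSet) :
    (coordForm G x y).IsInvertible := by
  refine isInvertible_of_injective ?_
  intro u v huv
  have h0 : ofChart (I := I) x y (u - v) = 0 := by
    refine h _ fun w => ?_
    have h1 : coordForm G x y (u - v) (toChart x y w) = 0 := by
      rw [map_sub, huv, sub_self]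
      rfl
    rw [coordForm_apply, ofChart_toChart hy] at h1
    exact h1
  have h2 := toChart_ofChart (I := I) hy (u - v)
  rw [h0, map_zero] at h2
  exact sub_eq_zero.1 h2.symm

theorem form_grad {g : FormField I A} {x : A} (hg : (g x).IsInvertible) (f : A → ℝ)
    (v : TangentSpace I x) : g x (grad g f x) v = mvfderiv I f x v := by
  unfold grad
  rw [hg.self_apply_inverse]

/-- The differential of `f` at `y`, in the preferred chart at `x`. -/
def coordDiff (I : ModelWithCorners ℝ E H) [IsManifold I 1 A] (f : A → ℝ) (x y : A) : E →L[ℝ] ℝ :=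
  mvfderiv I f y ∘L ofChart x y

theorem coordDiff_eq (f : A → ℝ) (x y : A) : coordDiff I f x y = coordDeriv I 𝓘(ℝ, ℝ) f x y := by
  unfold coordDeriv toChart
  rw [TangentBundle.continuousLinearMapAt_model_space]
  rfl

theorem mdifferentiableAt_coordDiff {f : A → ℝ} (hf : ContMDiff I 𝓘(ℝ, ℝ) 2 f) (x : A) :
    MDifferentiableAt I 𝓘(ℝ, E →L[ℝ] ℝ) (coordDiff I f x) x := by
  have : coordDiff I f x = coordDeriv I 𝓘(ℝ, ℝ) f x := funext (coordDiff_eq f x)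
  rw [this]
  exact mdifferentiableAt_coordDeriv hf

theorem mvfderiv_coordDiff_symm {f : A → ℝ} (hf : ContMDiff I 𝓘(ℝ, ℝ) 2 f) {x : A}
    (u v : TangentSpace I x) :
    mvfderiv I (coordDiff I f x) x u (comps x v) = mvfderiv I (coordDiff I f x) x v (comps x u) := by
  have : coordDiff I f x = coordDeriv I 𝓘(ℝ, ℝ) f x := funext (coordDiff_eq f x)
  rw [this]
  exact mvfderiv_coordDeriv_symm hf u v

theorem coordDiff_comps (f : A → ℝ) (x : A) (v : TangentSpace I x) :
    coordDiff I f x x (comps x v) = mvfderiv I f x v := by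
  change mvfderiv I f x (ofChart x x (comps x v)) = _
  rw [ofChart_comps]

/-- In the chart the gradient is the inverse metric matrix applied to the differential, and
inversion is differentiable at an invertible map. -/
theorem diffAlong_grad {g : FormField I A} {f : A → ℝ} {x : A} (hnd : ∀ y, Nondegenerate g y)
    (hd : FormDiffAt g x) (hf : ContMDiff I 𝓘(ℝ, ℝ) 2 f) :
    DiffAlong I (fun y => y) (grad g f) x := by
  refine diffAlong_iff.2 ⟨mdifferentiableAt_id, ?_⟩
  have e : coordAlong I (fun y => y) (grad g f) x =ᶠ[nhds x]
      fun y => (coordForm g x y).inverse (coordDiff I f x y) := by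
    filter_upwards [eventually_coordAlong continuousAt_id (grad g f),
      mem_baseSet_trivializationAt_tangent (I := I) x] with y h1 h2
    refine h1.trans ?_
    change toChart x y _ = _
    symm
    rw [(coordForm_isInvertible (hnd y) h2).inverse_apply_eq]
    ext w
    rw [coordForm_apply, ofChart_toChart h2, form_grad (hnd y).isInvertible]
    rfl
  refine MDifferentiableAt.congr_of_eventuallyEq ?_ e
  refine MDifferentiableAt.clm_apply ?_ (mdifferentiableAt_coordDiff hf x)
  obtain ⟨L, hL⟩ := coordForm_isInvertible (hnd x) (mem_baseSet_trivializationAt E _ x)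
  refine DifferentiableAt.comp_mdifferentiableAt
    (g := (ContinuousLinearMap.inverse : (E →L[ℝ] E →L[ℝ] ℝ) → _)) ?_ hd
  rw [← hL]
  have : CompleteSpace E := FiniteDimensional.complete ℝ E
  exact (contDiffAt_map_inverse (n := 1) L).differentiableAt one_ne_zero

end Nondegenerate

/-! ### The graph metric g + df ⊗ df and its connection. -/

section Graph

variable {M : Type*} [TopologicalSpace M] [ChartedSpace (EuclideanHalfSpace 3) M]
  [IsManifold (𝓡∂ 3) ∞ M]
  {E₀ : Type*} [NormedAddCommGroup E₀] [NormedSpace ℝ E₀]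
  {H₀ : Type*} [TopologicalSpace H₀] {I₀ : ModelWithCorners ℝ E₀ H₀}
  {S : Type*} [TopologicalSpace S] [ChartedSpace H₀ S] [IsManifold I₀ 1 S]

theorem graphMetric_apply (g : FormField (𝓡∂ 3) M) (f : M → ℝ) (x : M)
    (u v : TangentSpace (𝓡∂ 3) x) : graphMetric g f x u v =
      g x u v + mvfderiv (𝓡∂ 3) f x u * mvfderiv (𝓡∂ 3) f x v := rfl

theorem graphMetric_symm {g : FormField (𝓡∂ 3) M} (hs : ∀ x u v, g x u v = g x v u) (f : M → ℝ)
    (x : M) (u v : TangentSpace (𝓡∂ 3) x) : graphMetric g f x u v = graphMetric g f x v u := by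
  rw [graphMetric_apply, graphMetric_apply, hs, mul_comm]

theorem graphMetric_pos {g : FormField (𝓡∂ 3) M} {x : M}
    (hpos : ∀ v : TangentSpace (𝓡∂ 3) x, v ≠ 0 → 0 < g x v v) (f : M → ℝ)
    (v : TangentSpace (𝓡∂ 3) x) (hv : v ≠ 0) : 0 < graphMetric g f x v v := by
  rw [graphMetric_apply]
  have := hpos v hv
  nlinarith [mul_self_nonneg (mvfderiv (𝓡∂ 3) f x v)]

theorem coordForm_graphMetric (g : FormField (𝓡∂ 3) M) (f : M → ℝ) (x : M) :
    coordForm (graphMetric g f) x = fun y => coordForm g x y +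
      ContinuousLinearMap.smulRightL ℝ _ _ (coordDiff (𝓡∂ 3) f x y) (coordDiff (𝓡∂ 3) f x y) := by
  funext y
  ext u v
  rfl

theorem mvfderiv_coordForm_apply {g : FormField (𝓡∂ 3) M} {x : M} (hd : FormDiffAt g x)
    (t : TangentSpace (𝓡∂ 3) x) (a b : EuclideanSpace ℝ (Fin 3)) :
    mvfderiv (𝓡∂ 3) (fun y => coordForm g x y a b) x t =
      mvfderiv (𝓡∂ 3) (coordForm g x) x t a b := by
  rw [mvfderiv_form_apply hd mdifferentiableAt_const mdifferentiableAt_const,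
    mvfderiv_const_apply, mvfderiv_const_apply, map_zero, map_zero, zero_apply, add_zero, add_zero]

theorem formDiffAt_graphMetric {g : FormField (𝓡∂ 3) M} {f : M → ℝ} {x : M} (hd : FormDiffAt g x)
    (hf : ContMDiff (𝓡∂ 3) 𝓘(ℝ, ℝ) 2 f) : FormDiffAt (graphMetric g f) x := by
  unfold FormDiffAt
  rw [coordForm_graphMetric]
  have h := mdifferentiableAt_coordDiff hf x
  refine MDifferentiableAt.add hd (MDifferentiableAt.clm_apply ?_ h)
  exact (ContinuousLinearMap.differentiableAt _).comp_mdifferentiableAt h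

theorem mvfderiv_coordForm_graphMetric {g : FormField (𝓡∂ 3) M} {f : M → ℝ} {x : M}
    (hd : FormDiffAt g x) (hf : ContMDiff (𝓡∂ 3) 𝓘(ℝ, ℝ) 2 f) (t : TangentSpace (𝓡∂ 3) x)
    (a b : EuclideanSpace ℝ (Fin 3)) :
    mvfderiv (𝓡∂ 3) (coordForm (graphMetric g f) x) x t a b =
      mvfderiv (𝓡∂ 3) (coordForm g x) x t a b
        + mvfderiv (𝓡∂ 3) (coordDiff (𝓡∂ 3) f x) x t a * coordDiff (𝓡∂ 3) f x x b
        + coordDiff (𝓡∂ 3) f x x a * mvfderiv (𝓡∂ 3) (coordDiff (𝓡∂ 3) f x) x t b := by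
  have h := mdifferentiableAt_coordDiff hf x
  have ha : ∀ a, MDifferentiableAt (𝓡∂ 3) 𝓘(ℝ, ℝ) (fun y => coordDiff (𝓡∂ 3) f x y a) x :=
    fun a => h.clm_apply mdifferentiableAt_const
  have hda : ∀ a, mvfderiv (𝓡∂ 3) (fun y => coordDiff (𝓡∂ 3) f x y a) x t =
      mvfderiv (𝓡∂ 3) (coordDiff (𝓡∂ 3) f x) x t a := by
    intro a
    rw [mvfderiv_clm_apply h mdifferentiableAt_const, mvfderiv_const_apply, map_zero, add_zero]
  rw [← mvfderiv_coordForm_apply (formDiffAt_graphMetric hd hf)]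
  change mvfderiv (𝓡∂ 3) (fun y => coordForm g x y a b +
    coordDiff (𝓡∂ 3) f x y a * coordDiff (𝓡∂ 3) f x y b) x t = _
  rw [mvfderiv_fun_add (g := fun y => coordForm g x y a b)
    (g' := fun y => coordDiff (𝓡∂ 3) f x y a * coordDiff (𝓡∂ 3) f x y b)
    ((hd.clm_apply mdifferentiableAt_const).clm_apply mdifferentiableAt_const)
    ((ha a).mul (ha b)), add_apply, mvfderiv_coordForm_apply hd, mvfderiv_fun_mul (ha a) (ha b)]
  simp only [add_apply, smul_apply, smul_eq_mul, hda]
  ring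

/-- In M × ℝ the field W lifts to (W, df(W)). Its product derivative is (∇W, u(df(W))), and pairing
with the lift (z, df(z)) gives the right side. In the chart, the extra Christoffel term is the
second derivative of f times df. -/
theorem form_nabla_graphMetric {g : FormField (𝓡∂ 3) M} {f : M → ℝ} {j : S → M} {s : S}
    (hg : (g (j s)).IsInvertible) (hg' : (graphMetric g f (j s)).IsInvertible)
    (hd : FormDiffAt g (j s)) (hf : ContMDiff (𝓡∂ 3) 𝓘(ℝ, ℝ) 2 f)
    {W : ∀ s : S, TangentSpace (𝓡∂ 3) (j s)} (hW : DiffAlong I₀ j W s) (u : TangentSpace I₀ s)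
    (z : TangentSpace (𝓡∂ 3) (j s)) :
    graphMetric g f (j s) (nabla (graphMetric g f) j W s u) z = g (j s) (nabla g j W s u) z
      + mvfderiv I₀ (fun b => mvfderiv (𝓡∂ 3) f (j b) (W b)) s u * mvfderiv (𝓡∂ 3) f (j s) z := by
  obtain ⟨hj, hw⟩ := diffAlong_iff.1 hW
  have h := mdifferentiableAt_coordDiff hf (j s)
  have h1 : MDifferentiableAt I₀ 𝓘(ℝ, EuclideanSpace ℝ (Fin 3) →L[ℝ] ℝ)
      (fun b => coordDiff (𝓡∂ 3) f (j s) (j b)) s := MDifferentiableAt.comp s h hj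
  have e : (fun b => mvfderiv (𝓡∂ 3) f (j b) (W b)) =ᶠ[nhds s]
      fun b => coordDiff (𝓡∂ 3) f (j s) (j b) (coordAlong (𝓡∂ 3) j W s b) := by
    filter_upwards [eventually_coordAlong hj.continuousAt W,
      eventually_mem_baseSet (I' := 𝓡∂ 3) hj.continuousAt] with b h2 h3
    rw [h2]
    change _ = mvfderiv (𝓡∂ 3) f (j b) (ofChart (j s) (j b) _)
    rw [ofChart_toChart h3]
  have hΓ : ∀ v w z : TangentSpace (𝓡∂ 3) (j s),
      graphMetric g f (j s) (christoffel (graphMetric g f) (j s) v w) z =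
      g (j s) (christoffel g (j s) v w) z + mvfderiv (𝓡∂ 3) (coordDiff (𝓡∂ 3) f (j s)) (j s) v
        (comps (j s) w) * mvfderiv (𝓡∂ 3) f (j s) z := by
    intro v w z
    rw [form_christoffel hg', form_christoffel hg]
    simp only [coordFormDeriv_comps, mvfderiv_coordForm_graphMetric hd hf, coordDiff_comps]
    rw [mvfderiv_coordDiff_symm hf w v, mvfderiv_coordDiff_symm hf z v,
      mvfderiv_coordDiff_symm hf z w]
    ring
  rw [comps_nabla, comps_nabla, mvfderiv_congr e, mvfderiv_clm_apply h1 hw,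
    mvfderiv_chain (h := coordDiff (𝓡∂ 3) f (j s)) h hj, map_add, map_add, add_apply, add_apply,
    hΓ, coordAlong_self, graphMetric_apply]
  have h5 : coordDiff (𝓡∂ 3) f (j s) (j s) (mvfderiv I₀ (coordAlong (𝓡∂ 3) j W s) s u) =
    mvfderiv (𝓡∂ 3) f (j s) (ofChart (j s) (j s) (mvfderiv I₀ (coordAlong (𝓡∂ 3) j W s) s u)) := rfl
  rw [h5]
  ring

end Graph

/-! ### Linearity of the second fundamental form and of the Hessian in the first slot. -/

section Linearity

variable {E : Type*} [NormedAddCommGroup E] [NormedSpace ℝ E]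
  {H : Type*} [TopologicalSpace H] {I : ModelWithCorners ℝ E H}
  {A : Type*} [TopologicalSpace A] [ChartedSpace H A] [IsManifold I 1 A]
  {E' : Type*} [NormedAddCommGroup E'] [NormedSpace ℝ E']
  {H' : Type*} [TopologicalSpace H'] {I' : ModelWithCorners ℝ E' H'}
  {B : Type*} [TopologicalSpace B] [ChartedSpace H' B] [IsManifold I' 1 B]

theorem isLinearMap_secondForm (G : FormField I' B) (F : A → B)
    (n : ∀ a : A, TangentSpace I' (F a)) (a : A) :
    IsLinearMap ℝ (secondForm (I := I) G F n a) := by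
  constructor
  · intro u v
    ext w
    simp only [secondForm, nabla_add_left, map_add, add_apply, ContinuousLinearMap.comp_apply]
  · intro c u
    ext w
    simp only [secondForm, nabla_smul_left, map_smul, smul_apply, ContinuousLinearMap.comp_apply]

theorem isLinearMap_hess (g : FormField I A) (f : A → ℝ) (x : A) :
    IsLinearMap ℝ (hess g f x) := by
  constructor
  · intro u v
    simp only [hess, nabla_add_left, map_add]
  · intro c u
    simp only [hess, nabla_smul_left, map_smul]

end Linearity

/-! ### Metric traces as traces of endomorphisms. -/

section Traces

variable {n : ℕ} {H : Type*} [TopologicalSpace H]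
  {I : ModelWithCorners ℝ (EuclideanSpace ℝ (Fin n)) H}
  {A : Type*} [TopologicalSpace A] [ChartedSpace H A] [IsManifold I 1 A]
  {m : ℕ} {H' : Type*} [TopologicalSpace H']
  {I' : ModelWithCorners ℝ (EuclideanSpace ℝ (Fin m)) H'}
  {B : Type*} [TopologicalSpace B] [ChartedSpace H' B] [IsManifold I' 1 B]

instance finiteDimensional_tangentSpace (x : A) : FiniteDimensional ℝ (TangentSpace I x) :=
  inferInstanceAs (FiniteDimensional ℝ (EuclideanSpace ℝ (Fin n)))

/-- The components of tangent vectors at `x` in the preferred chart at `x`, as an equivalence. -/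
def compsEquiv (x : A) : TangentSpace I x ≃ₗ[ℝ] EuclideanSpace ℝ (Fin n) where
  toLinearMap := (comps (I := I) x).toLinearMap
  invFun := ofChart x x
  left_inv := ofChart_comps x
  right_inv := comps_ofChart x

/-- Replaces the trace in chart components by a basis-free one, so that later trace formulas follow
from the trace of a rank-one map and from cyclicity, without orthonormal frames. -/
theorem mtrace_eq_trace {g : FormField I A} {x : A} (hg : (g x).IsInvertible)
    (hs : ∀ u v, g x u v = g x v u) (L : TangentSpace I x →ₗ[ℝ] TangentSpace I x)
    {b : TangentSpace I x → TangentSpace I x → ℝ} (hb : ∀ u v, b u v = g x (L u) v) :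
    mtrace g x b = LinearMap.trace ℝ _ L := by
  rw [LinearMap.trace_eq_matrix_trace ℝ
    ((EuclideanSpace.basisFun (Fin n) ℝ).toBasis.map (compsEquiv (I := I) x).symm) L, mtrace,
    Matrix.trace]
  refine Finset.sum_congr rfl fun i _ => ?_
  rw [hb, hs, hg.self_apply_inverse, Matrix.diag_apply, LinearMap.toMatrix_apply]
  simp only [Module.Basis.map_apply, Module.Basis.map_repr, LinearEquiv.trans_apply,
    LinearEquiv.symm_symm, OrthonormalBasis.coe_toBasis, EuclideanSpace.basisFun_apply,
    OrthonormalBasis.coe_toBasis_repr_apply, EuclideanSpace.basisFun_repr]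
  rfl

theorem mtrace_congr {W : Type*} [AddCommGroup W] (g : FormField I A) (x : A)
    {b b' : TangentSpace I x → TangentSpace I x → W} (h : ∀ u v, b u v = b' u v) :
    mtrace g x b = mtrace g x b' :=
  Finset.sum_congr rfl fun _ _ => h _ _

theorem mtrace_add {W : Type*} [AddCommGroup W] (g : FormField I A) (x : A)
    (b b' : TangentSpace I x → TangentSpace I x → W) :
    mtrace g x (fun u v => b u v + b' u v) = mtrace g x b + mtrace g x b' :=
  Finset.sum_add_distrib

theorem mtrace_mul (g : FormField I A) (x : A) (c : ℝ)
    (b : TangentSpace I x → TangentSpace I x → ℝ) :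
    mtrace g x (fun u v => c * b u v) = c * mtrace g x b :=
  (Finset.mul_sum _ _ _).symm

theorem map_mtrace {W W' : Type*} [AddCommGroup W] [AddCommGroup W'] {K : Type*}
    [FunLike K W W'] [AddMonoidHomClass K W W'] (φ : K) (g : FormField I A) (x : A)
    (b : TangentSpace I x → TangentSpace I x → W) :
    φ (mtrace g x b) = mtrace g x (fun u v => φ (b u v)) :=
  map_sum φ _ _

/-- The endomorphism associated with a bilinear form by a metric. -/
def formEndo (g : FormField I A) (x : A) {b : TangentSpace I x → TangentSpace I x →L[ℝ] ℝ}
    (hb : IsLinearMap ℝ b) : TangentSpace I x →ₗ[ℝ] TangentSpace I x :=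
  (g x).inverse.toLinearMap ∘ₗ hb.mk' b

theorem form_formEndo {g : FormField I A} {x : A} (hg : (g x).IsInvertible)
    {b : TangentSpace I x → TangentSpace I x →L[ℝ] ℝ} (hb : IsLinearMap ℝ b)
    (u v : TangentSpace I x) : g x (formEndo g x hb u) v = b u v := by
  change g x ((g x).inverse (b u)) v = _
  rw [hg.self_apply_inverse]

/-- The Sherman–Morrison formula: if L represents b with respect to g, then v ↦ L v - α(L v)/(1 +
α(w)) w represents b with respect to g'. The correction has rank one and trace α(L w)/(1 + α(w)). -/
theorem mtrace_add_rank_one {g g' : FormField I A} {x : A} (hg : (g x).IsInvertible)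
    (hg' : (g' x).IsInvertible) (hs : ∀ u v, g x u v = g x v u) (α : TangentSpace I x →L[ℝ] ℝ)
    (h : ∀ u v, g' x u v = g x u v + α u * α v) {w : TangentSpace I x}
    (hw : ∀ v, g x w v = α v) (hα : 1 + α w ≠ 0)
    {b : TangentSpace I x → TangentSpace I x →L[ℝ] ℝ} (hb : IsLinearMap ℝ b) :
    mtrace g' x (fun u v => b u v) = mtrace g x (fun u v => b u v) - b w w / (1 + α w) := by
  have hs' : ∀ u v, g' x u v = g' x v u := fun u v => by rw [h, h, hs, mul_comm]
  set L := formEndo g x hb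
  have hL := form_formEndo hg hb
  rw [mtrace_eq_trace hg hs L (fun u v => (hL u v).symm),
    mtrace_eq_trace hg' hs' (L - (((1 + α w)⁻¹ • α.toLinearMap ∘ₗ L).smulRight w))]
  · rw [map_sub, LinearMap.trace_smulRight]
    have : α (L w) = b w w := by rw [← hw, hs, hL]
    simp only [LinearMap.smul_apply, LinearMap.comp_apply, ContinuousLinearMap.coe_coe, this,
      smul_eq_mul]
    ring
  · intro u v
    rw [h]
    simp only [LinearMap.sub_apply, LinearMap.smulRight_apply, LinearMap.smul_apply,
      LinearMap.comp_apply, ContinuousLinearMap.coe_coe, map_sub, map_smul, sub_apply, smul_apply,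
      smul_eq_mul, hw]
    rw [hL]
    field_simp
    ring

/-- With P the orthogonal projection to the hypersurface, the identity is D ∘ P plus the projection
to e. Then tr L = tr(L D P) + g(e, L e), and tr(L D P) = tr(P L D) is the trace over the
hypersurface. -/
theorem mtrace_hypersurface {g : FormField I A} {j : B → A} {s : B}
    (hg : (g (j s)).IsInvertible) (hσ : (pullback (I := I') g j s).IsInvertible)
    (hs : ∀ u v, g (j s) u v = g (j s) v u) {e : TangentSpace I (j s)}
    (he : ∀ u, g (j s) e (mfderiv I' I j s u) = 0)
    (hd : ∀ v, ∃ u, v = mfderiv I' I j s u + g (j s) v e • e)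
    {b : TangentSpace I (j s) → TangentSpace I (j s) →L[ℝ] ℝ} (hb : IsLinearMap ℝ b) :
    mtrace g (j s) (fun u v => b u v) = mtrace (pullback g j) s
      (fun u v => b (mfderiv I' I j s u) (mfderiv I' I j s v)) + b e e := by
  set D := mfderiv I' I j s
  have hσa : ∀ u v, pullback g j s u v = g (j s) (D u) (D v) := fun u v => rfl
  have hσs : ∀ u v, pullback g j s u v = pullback g j s v u := fun u v => by
    rw [hσa, hσa, hs]
  set L := formEndo g (j s) hb
  have hL := form_formEndo hg hb
  let P : TangentSpace I (j s) →ₗ[ℝ] TangentSpace I' s :=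
    (pullback g j s).inverse.toLinearMap ∘ₗ
      ((ContinuousLinearMap.precomp ℝ D) ∘L (g (j s))).toLinearMap
  have hP : ∀ v u, pullback g j s (P v) u = g (j s) v (D u) := by
    intro v u
    change pullback g j s ((pullback g j s).inverse ((g (j s) v) ∘L D)) u = _
    rw [hσ.self_apply_inverse]
    rfl
  have hdec : ∀ v, D (P v) + g (j s) v e • e = v := by
    intro v
    obtain ⟨u, hu⟩ := hd v
    have : P v = u := by
      apply hσ.injective
      ext z
      rw [hP]
      conv_lhs => rw [hu]
      rw [map_add, map_smul, add_apply, smul_apply, he, smul_zero, add_zero]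
      rfl
    rw [this]
    exact hu.symm
  have hsum : L = L ∘ₗ D.toLinearMap ∘ₗ P + ((g (j s) e).toLinearMap).smulRight (L e) := by
    ext v
    conv_lhs => rw [← hdec v]
    rw [map_add, map_smul, hs v e]
    rfl
  rw [mtrace_eq_trace hg hs L (fun u v => (hL u v).symm),
    mtrace_eq_trace hσ hσs (P ∘ₗ L ∘ₗ D.toLinearMap)]
  · conv_lhs => rw [hsum]
    rw [map_add, LinearMap.trace_smulRight, ← LinearMap.comp_assoc, LinearMap.trace_comp_comm']
    congr 1
    change g (j s) e (L e) = _
    rw [hs, hL]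
  · intro u v
    change _ = pullback g j s (P (L (D u))) v
    rw [hP, hL]

end Traces

/-! ### Tangent vectors of the boundary. -/

section Boundary

variable {M : Type*} [TopologicalSpace M] [ChartedSpace (EuclideanHalfSpace 3) M]
  [IsManifold (𝓡∂ 3) ∞ M]
  {S : Type*} [TopologicalSpace S] [ChartedSpace (EuclideanSpace ℝ (Fin 2)) S]
  [IsManifold (𝓡 2) ∞ S]

theorem mvfderiv_eq_zero_of_isLocalMin {h : S → ℝ} {s : S} (hm : IsLocalMin h s)
    (hd : MDifferentiableAt (𝓡 2) 𝓘(ℝ, ℝ) h s) : mvfderiv (𝓡 2) h s = 0 := by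
  rw [hd.mvfderiv]
  have hr : Set.range (𝓡 2) = Set.univ := (𝓡 2).range_eq_univ
  rw [hr, fderivWithin_univ]
  apply IsLocalMin.fderiv_eq_zero
  have hc : Filter.Tendsto (extChartAt (𝓡 2) s).symm (nhds (extChartAt (𝓡 2) s s)) (nhds s) := by
    have := (continuousAt_extChartAt_symm (I := 𝓡 2) s).tendsto
    rwa [extChartAt_to_inv] at this
  filter_upwards [hc.eventually hm] with z hz
  simpa only [writtenInExtChartAt, extChartAt_model_space_eq_id, Function.comp,
      PartialEquiv.refl_coe, id, extChartAt_to_inv] using hz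

/-- The coordinate that vanishes on the boundary of the half space has a minimum along `j` at s, so
its differential kills tangent vectors of the surface. -/
theorem IsBoundaryEmbedding.comps_mfderiv_zero {j : S → M} (hj : IsBoundaryEmbedding j) (s : S)
    (u : TangentSpace (𝓡 2) s) :
    (EuclideanSpace.proj (0 : Fin 3) : EuclideanSpace ℝ (Fin 3) →L[ℝ] ℝ)
      (comps (j s) (mfderiv (𝓡 2) (𝓡∂ 3) j s u)) = 0 := by
  set π₀ := (EuclideanSpace.proj (0 : Fin 3) : EuclideanSpace ℝ (Fin 3) →L[ℝ] ℝ)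
  have hj1 : MDifferentiableAt (𝓡 2) (𝓡∂ 3) j s := (hj.smooth s).mdifferentiableAt (by simp)
  have hχ : MDifferentiableAt (𝓡∂ 3) 𝓘(ℝ, EuclideanSpace ℝ (Fin 3)) (extChartAt (𝓡∂ 3) (j s))
      (j s) := mdifferentiableAt_extChartAt (mem_chart_source _ _)
  have hk : MDifferentiableAt (𝓡∂ 3) 𝓘(ℝ, ℝ) (fun y => π₀ (extChartAt (𝓡∂ 3) (j s) y)) (j s) :=
    π₀.differentiableAt.comp_mdifferentiableAt hχ
  have h1 : mvfderiv (𝓡∂ 3) (fun y => π₀ (extChartAt (𝓡∂ 3) (j s) y)) (j s)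
      (mfderiv (𝓡 2) (𝓡∂ 3) j s u) = π₀ (comps (j s) (mfderiv (𝓡 2) (𝓡∂ 3) j s u)) := by
    rw [mvfderiv_comp_differentiable π₀.differentiableAt hχ, π₀.fderiv]
    unfold comps
    rw [TangentBundle.continuousLinearMapAt_trivializationAt (mem_chart_source _ _)]
    rfl
  rw [← h1, ← mvfderiv_chain (h := fun y => π₀ (extChartAt (𝓡∂ 3) (j s) y)) hk hj1,
    mvfderiv_eq_zero_of_isLocalMin]
  · rfl
  · have hb : (𝓡∂ 3).IsBoundaryPoint (j s) := by
      have : j s ∈ (𝓡∂ 3).boundary M := by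
        rw [← hj.range_eq]
        exact Set.mem_range_self s
      exact this
    have h0 : π₀ (extChartAt (𝓡∂ 3) (j s) (j s)) = 0 := by
      rw [ModelWithCorners.IsBoundaryPoint, frontier_range_modelWithCornersEuclideanHalfSpace] at hb
      exact hb.symm
    -- The chart is a total map whose values always lie in the half space, even outside its source,
    -- so the inequality needs no neighbourhood.
    refine Filter.Eventually.of_forall fun b => ?_
    simp only [h0]
    have h2 : extChartAt (𝓡∂ 3) (j s) (j b) ∈ Set.range (𝓡∂ 3) := by
      exact Set.mem_range_self _
    rw [range_modelWithCornersEuclideanHalfSpace] at h2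
    exact h2
  · exact MDifferentiableAt.comp (g := fun y => π₀ (extChartAt (𝓡∂ 3) (j s) y)) s hk hj1

/-- The functional α separates e from the image of D, so a dimension count suffices. It serves both
for the boundary in M and for M in Minkowski space. -/
theorem exists_eq_map_add_smul {V W : Type*} [AddCommGroup V] [Module ℝ V]
    [FiniteDimensional ℝ V] [AddCommGroup W] [Module ℝ W] [FiniteDimensional ℝ W]
    (hdim : Module.finrank ℝ V + 1 = Module.finrank ℝ W) {D : V →ₗ[ℝ] W}
    (hD : Function.Injective D) {e : W} {α : W →ₗ[ℝ] ℝ} (he : α e ≠ 0) (hα : ∀ u, α (D u) = 0)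
    (v : W) : ∃ (u : V) (c : ℝ), v = D u + c • e := by
  let Φ : (V × ℝ) →ₗ[ℝ] W := D.coprod (LinearMap.toSpanSingleton ℝ _ e)
  have hΦ : ∀ q, Φ q = D q.1 + q.2 • e := fun q => by simp [Φ]
  have hinj : Function.Injective Φ := by
    refine (injective_iff_map_eq_zero Φ).2 fun q hq => ?_
    rw [hΦ] at hq
    have h2 : q.2 = 0 := by
      have := congrArg α hq
      rw [map_add, hα, map_smul, map_zero, zero_add, smul_eq_mul] at this
      exact (mul_eq_zero.1 this).resolve_right he
    rw [h2, zero_smul, add_zero] at hq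
    exact Prod.ext (hD (hq.trans (map_zero D).symm)) h2
  have hdim' : Module.finrank ℝ (V × ℝ) = Module.finrank ℝ W := by
    rw [Module.finrank_prod, Module.finrank_self, hdim]
  obtain ⟨q, hq⟩ := (LinearMap.injective_iff_surjective_of_finrank_eq_finrank hdim').1 hinj v
  exact ⟨q.1, q.2, hq.symm.trans (hΦ q)⟩

theorem exists_tangent_decomposition {g : FormField (𝓡∂ 3) M} {j : S → M} {s : S}
    (hj : Function.Injective (mfderiv (𝓡 2) (𝓡∂ 3) j s)) {e : TangentSpace (𝓡∂ 3) (j s)}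
    (hs : ∀ u v, g (j s) u v = g (j s) v u) (he1 : g (j s) e e = 1)
    (he : ∀ u, g (j s) e (mfderiv (𝓡 2) (𝓡∂ 3) j s u) = 0) (v : TangentSpace (𝓡∂ 3) (j s)) :
    ∃ u, v = mfderiv (𝓡 2) (𝓡∂ 3) j s u + g (j s) v e • e := by
  have hdim : Module.finrank ℝ (TangentSpace (𝓡 2) s) + 1 =
      Module.finrank ℝ (TangentSpace (𝓡∂ 3) (j s)) := by
    change Module.finrank ℝ (EuclideanSpace ℝ (Fin 2)) + _ =
      Module.finrank ℝ (EuclideanSpace ℝ (Fin 3))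
    simp
  obtain ⟨u, c, hv⟩ := exists_eq_map_add_smul hdim (D := (mfderiv (𝓡 2) (𝓡∂ 3) j s).toLinearMap)
    hj (e := e) (α := (g (j s) e).toLinearMap) (by simp [he1]) he v
  refine ⟨u, ?_⟩
  have h1 : g (j s) v e = c := by
    rw [hs, hv, map_add, map_smul, he1, ContinuousLinearMap.coe_coe, he]
    simp
  rw [h1]
  exact hv

end Boundary

/-! ### The mean curvature vector paired with a normal field. -/

section MeanCurvature

variable {n : ℕ} {H : Type*} [TopologicalSpace H]
  {I : ModelWithCorners ℝ (EuclideanSpace ℝ (Fin n)) H}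
  {A : Type*} [TopologicalSpace A] [ChartedSpace H A] [IsManifold I 1 A]
  {E' : Type*} [NormedAddCommGroup E'] [NormedSpace ℝ E']
  {H' : Type*} [TopologicalSpace H'] {I' : ModelWithCorners ℝ E' H'}
  {B : Type*} [TopologicalSpace B] [ChartedSpace H' B] [IsManifold I' 1 B]

theorem coordField_self (x : A) (v : TangentSpace I x) : coordField (I := I) x v x = v := by
  have hc : comps x v = v := by
    change (trivializationAt _ (TangentSpace I : A → Type _) x).continuousLinearMapAt ℝ x v = _
    rw [TangentBundle.continuousLinearMapAt_trivializationAt_eq_core (mem_chart_source H x)]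
    exact (tangentBundleCore I A).coordChange_self _ _ (mem_chart_source H x) _
  have := ofChart_comps x v
  rw [hc] at this
  exact this

theorem diffAlong_coordField (x : A) (v : EuclideanSpace ℝ (Fin n)) :
    DiffAlong I (fun y => y) (coordField (I := I) x v) x := by
  refine diffAlong_iff.2 ⟨mdifferentiableAt_id, ?_⟩
  refine (mdifferentiableAt_const (c := v)).congr_of_eventuallyEq ?_
  filter_upwards [eventually_coordAlong continuousAt_id (coordField (I := I) x v),
    mem_baseSet_trivializationAt_tangent (I := I) x] with y h1 h2
  refine h1.trans ?_
  exact toChart_ofChart h2 v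

/-- Weingarten relation: differentiate ⟨dF(∂_v), m⟩ = 0 and trace. The tangential part removed by
`normalPart` does not pair with m. -/
theorem form_meanCurvatureVector {G : FormField I' B} (hs : ∀ y u v, G y u v = G y v u)
    {F : A → B} (hF : ContMDiff I I' 2 F) {a : A} (hG : (G (F a)).IsInvertible)
    (hd : FormDiffAt G (F a)) {m : ∀ a : A, TangentSpace I' (F a)} (hm : DiffAlong I F m a)
    (hn : ∀ b (u : TangentSpace I b), G (F b) (m b) (mfderiv I I' F b u) = 0) :
    G (F a) (meanCurvatureVector (I := I) G F a) (m a) = -meanCurvature (I := I) G F m a := by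
  unfold meanCurvatureVector normalPart meanCurvature
  rw [map_sub, sub_apply, hs _ (mfderiv I I' F a _) (m a), hn, sub_zero, hs,
    map_mtrace (G (F a) (m a)), ← neg_one_mul, ← mtrace_mul]
  refine mtrace_congr _ _ fun u v => ?_
  have h1 : DiffAlong I F (fun b => mfderiv I I' F b (coordField (I := I) a v b)) a :=
    (diffAlong_coordField a v).mfderiv hF
  have h2 := nabla_metric hs hG hd h1 hm u
  have h3 : (fun b => G (F b) (mfderiv I I' F b (coordField (I := I) a v b)) (m b)) =
      fun _ => 0 := by
    funext b
    rw [hs, hn]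
  rw [h3, mvfderiv_const_apply] at h2
  rw [hs, eq_neg_of_add_eq_zero_left h2.symm, neg_one_mul, hs]
  rw [coordField_self]
  rfl

end MeanCurvature

/-! ### The boost angle as a function on the surface. -/

section RealFunctions

variable {E : Type*} [NormedAddCommGroup E] [NormedSpace ℝ E]
  {H : Type*} [TopologicalSpace H] {I : ModelWithCorners ℝ E H}
  {A : Type*} [TopologicalSpace A] [ChartedSpace H A]

theorem mvfderiv_comp_real {c : A → ℝ} {h : ℝ → ℝ} {h' : ℝ} {x : A} (hh : HasDerivAt h h' (c x))
    (hc : MDifferentiableAt I 𝓘(ℝ, ℝ) c x) (t : TangentSpace I x) :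
    mvfderiv I (fun y => h (c y)) x t = h' * mvfderiv I c x t := by
  rw [mvfderiv_comp_differentiable hh.differentiableAt hc, ContinuousLinearMap.comp_apply,
    hh.hasFDerivAt.fderiv]
  simp [mul_comm]

theorem mdifferentiableAt_boost {a q φ : A → ℝ} {x : A} (ha : MDifferentiableAt I 𝓘(ℝ, ℝ) a x)
    (hq : MDifferentiableAt I 𝓘(ℝ, ℝ) q x) (hq0 : 0 ≤ q x)
    (hφ : ∀ y, Real.sinh (φ y) = -a y / √(1 + q y)) : MDifferentiableAt I 𝓘(ℝ, ℝ) φ x := by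
  have e : φ = fun y => Real.arsinh (-a y / √(1 + q y)) := by
    funext y
    rw [← hφ, Real.arsinh_sinh]
  have hpos : 0 < 1 + q x := by linarith
  have h1 : DifferentiableAt ℝ (fun r : ℝ × ℝ => Real.arsinh (-r.1 / √(1 + r.2))) (a x, q x) := by
    have h2 : DifferentiableAt ℝ (fun r : ℝ × ℝ => √(1 + r.2)) (a x, q x) :=
      (differentiableAt_snd.const_add 1).sqrt hpos.ne'
    have h3 : DifferentiableAt ℝ (fun r : ℝ × ℝ => -r.1) (a x, q x) := differentiableAt_fst.fun_neg
    have h4 : DifferentiableAt ℝ (fun r : ℝ × ℝ => -r.1 / √(1 + r.2)) (a x, q x) :=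
      h3.fun_mul (h2.fun_inv (Real.sqrt_pos.2 hpos).ne')
    exact h4.arsinh
  rw [e]
  exact h1.comp_mdifferentiableAt (f := fun y => (a y, q y)) (ha.prodMk_space hq)

/-- Obtained by differentiating sinh φ · √(1+q) = -a, once φ is known to be differentiable through
`Real.arsinh`. -/
theorem mvfderiv_boost {a q φ : A → ℝ} {x : A} (ha : MDifferentiableAt I 𝓘(ℝ, ℝ) a x)
    (hq : MDifferentiableAt I 𝓘(ℝ, ℝ) q x) (hq0 : ∀ y, 0 ≤ q y)
    (hφ : ∀ y, Real.sinh (φ y) = -a y / √(1 + q y)) (t : TangentSpace I x) :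
    Real.cosh (φ x) * √(1 + q x) * mvfderiv I φ x t =
      -mvfderiv I a x t + a x * mvfderiv I q x t / (2 * (1 + q x)) := by
  have hφd := mdifferentiableAt_boost ha hq (hq0 x) hφ
  have hpos : ∀ y, 0 < 1 + q y := fun y => by linarith [hq0 y]
  have hW : HasDerivAt (fun r : ℝ => √(1 + r)) (1 / (2 * √(1 + q x))) (q x) := by
    simpa using ((hasDerivAt_id (q x)).const_add 1).sqrt (hpos x).ne'
  have h1 := mvfderiv_comp_real (Real.hasDerivAt_sinh (φ x)) hφd t
  have h2 := mvfderiv_comp_real hW hq t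
  have d1 : MDifferentiableAt I 𝓘(ℝ, ℝ) (fun y => Real.sinh (φ y)) x :=
    (Real.hasDerivAt_sinh (φ x)).differentiableAt.comp_mdifferentiableAt hφd
  have d2 : MDifferentiableAt I 𝓘(ℝ, ℝ) (fun y => √(1 + q y)) x :=
    DifferentiableAt.comp_mdifferentiableAt (g := fun r : ℝ => √(1 + r)) hW.differentiableAt hq
  have e : (fun y => Real.sinh (φ y) * √(1 + q y)) = fun y => -a y := by
    funext y
    rw [hφ, div_mul_cancel₀ _ (Real.sqrt_pos.2 (hpos y)).ne']
  have h3 := congrArg (fun L => L t) (mvfderiv_fun_mul d1 d2)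
  rw [e] at h3
  simp only [mvfderiv_fun_neg, neg_apply, add_apply, smul_apply, smul_eq_mul,
    h1, h2] at h3
  have hs : √(1 + q x) ^ 2 = 1 + q x := Real.sq_sqrt (hpos x).le
  have hs0 := (Real.sqrt_pos.2 (hpos x)).ne'
  rw [hφ] at h3
  generalize √(1 + q x) = r at h3 hs hs0 ⊢
  have h4 : Real.cosh (φ x) * r * mvfderiv I φ x t =
      -mvfderiv I a x t - -a x / r * (1 / (2 * r) * mvfderiv I q x t) := by
    linear_combination -h3
  rw [h4, ← hs]
  field_simp
  ring

end RealFunctions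

/-! ### Differentiability of inner products of vector fields along a map. -/

section FormDifferentiable

variable {E : Type*} [NormedAddCommGroup E] [NormedSpace ℝ E]
  {H : Type*} [TopologicalSpace H] {I : ModelWithCorners ℝ E H}
  {A : Type*} [TopologicalSpace A] [ChartedSpace H A] [IsManifold I 1 A]
  {E' : Type*} [NormedAddCommGroup E'] [NormedSpace ℝ E']
  {H' : Type*} [TopologicalSpace H'] {I' : ModelWithCorners ℝ E' H'}
  {B : Type*} [TopologicalSpace B] [ChartedSpace H' B] [IsManifold I' 1 B]

theorem mdifferentiableAt_form {G : FormField I' B} {F : A → B} {a : A}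
    (hd : FormDiffAt G (F a)) {W Z : ∀ a : A, TangentSpace I' (F a)} (hW : DiffAlong I F W a)
    (hZ : DiffAlong I F Z a) :
    MDifferentiableAt I 𝓘(ℝ, ℝ) (fun b => G (F b) (W b) (Z b)) a := by
  obtain ⟨hF, hw⟩ := diffAlong_iff.1 hW
  obtain ⟨-, hz⟩ := diffAlong_iff.1 hZ
  have hc : MDifferentiableAt I 𝓘(ℝ, E' →L[ℝ] E' →L[ℝ] ℝ)
      (fun b => coordForm G (F a) (F b)) a := MDifferentiableAt.comp a hd hF
  refine ((hc.clm_apply hw).clm_apply hz).congr_of_eventuallyEq ?_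
  filter_upwards [eventually_mem_baseSet (I' := I') hF.continuousAt,
    eventually_coordAlong hF.continuousAt W, eventually_coordAlong hF.continuousAt Z]
    with b h1 h2 h3
  rw [h2, h3, form_eq_coordForm G h1]

end FormDifferentiable

/-! ### The gradient and Hessian of f along the boundary, split into tangential and normal parts. -/

section BoundaryData

variable {M : Type*} [TopologicalSpace M] [ChartedSpace (EuclideanHalfSpace 3) M]
  [IsManifold (𝓡∂ 3) ∞ M]
  {S : Type*} [TopologicalSpace S] [ChartedSpace (EuclideanSpace ℝ (Fin 2)) S]
  [IsManifold (𝓡 2) ∞ S]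

/-- A Riemannian three-manifold with boundary surface `j`, outward unit normal `e` and a smooth
function `f`. -/
structure BoundaryData (g : FormField (𝓡∂ 3) M) (j : S → M)
    (e : ∀ s : S, TangentSpace (𝓡∂ 3) (j s)) (f : M → ℝ) : Prop where
  symm : ∀ x u v, g x u v = g x v u
  pos : ∀ (x : M) (v : TangentSpace (𝓡∂ 3) x), v ≠ 0 → 0 < g x v v
  diff : ∀ x, FormDiffAt g x
  emb : IsBoundaryEmbedding j
  normal : IsOutwardUnitNormal g j e
  smooth : ContMDiff (𝓡∂ 3) 𝓘(ℝ, ℝ) ∞ f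

variable {g : FormField (𝓡∂ 3) M} {j : S → M} {e : ∀ s : S, TangentSpace (𝓡∂ 3) (j s)} {f : M → ℝ}

namespace BoundaryData

theorem smooth_two (h : BoundaryData g j e f) : ContMDiff (𝓡∂ 3) 𝓘(ℝ, ℝ) 2 f :=
  h.smooth.of_le (WithTop.coe_le_coe.2 (le_top : (2 : ℕ∞) ≤ ⊤))

theorem emb_two (h : BoundaryData g j e f) : ContMDiff (𝓡 2) (𝓡∂ 3) 2 j :=
  h.emb.smooth.of_le (WithTop.coe_le_coe.2 (le_top : (2 : ℕ∞) ≤ ⊤))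

theorem mdifferentiableAt_emb (h : BoundaryData g j e f) (s : S) :
    MDifferentiableAt (𝓡 2) (𝓡∂ 3) j s := (h.emb_two s).mdifferentiableAt (by simp)

theorem mdifferentiableAt_fun (h : BoundaryData g j e f) (x : M) :
    MDifferentiableAt (𝓡∂ 3) 𝓘(ℝ, ℝ) f x := (h.smooth_two x).mdifferentiableAt (by simp)

theorem isInvertible (h : BoundaryData g j e f) (x : M) : (g x).IsInvertible :=
  (nondegenerate_of_pos (h.pos x)).isInvertible

theorem isInvertible_graphMetric (h : BoundaryData g j e f) (x : M) :
    (graphMetric g f x).IsInvertible :=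
  (nondegenerate_of_pos (graphMetric_pos (h.pos x) f)).isInvertible

theorem boundary_pos {b : FormField (𝓡∂ 3) M} (hb : ∀ (x : M) (v : TangentSpace (𝓡∂ 3) x),
    v ≠ 0 → 0 < b x v v) (hj : IsBoundaryEmbedding j) (s : S) (v : TangentSpace (𝓡 2) s)
    (hv : v ≠ 0) : 0 < pullback b j s v v :=
  hb _ _ fun h0 => hv (hj.immersion s (h0.trans (map_zero _).symm))

theorem boundary_nondegenerate (h : BoundaryData g j e f) (s : S) :
    Nondegenerate (pullback (I := 𝓡 2) g j) s :=
  nondegenerate_of_pos (boundary_pos h.pos h.emb s)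

theorem boundary_isInvertible (h : BoundaryData g j e f) (s : S) :
    (pullback (I := 𝓡 2) g j s).IsInvertible := (h.boundary_nondegenerate s).isInvertible

theorem boundary_symm (h : BoundaryData g j e f) (s : S) (u v : TangentSpace (𝓡 2) s) :
    pullback g j s u v = pullback g j s v u := h.symm (j s) _ _

theorem boundary_diff (h : BoundaryData g j e f) (s : S) :
    FormDiffAt (pullback (I := 𝓡 2) g j) s := formDiffAt_pullback h.emb_two (h.diff _)

theorem boundary_smooth (h : BoundaryData g j e f) :
    ContMDiff (𝓡 2) 𝓘(ℝ, ℝ) 2 (fun s => f (j s)) := h.smooth_two.comp h.emb_two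

theorem mvfderiv_boundary (h : BoundaryData g j e f) (s : S) (u : TangentSpace (𝓡 2) s) :
    mvfderiv (𝓡 2) (fun s => f (j s)) s u =
      mvfderiv (𝓡∂ 3) f (j s) (mfderiv (𝓡 2) (𝓡∂ 3) j s u) :=
  mvfderiv_chain (h.mdifferentiableAt_fun _) (h.mdifferentiableAt_emb s) u

theorem form_normal_tangent (h : BoundaryData g j e f) (s : S) (u : TangentSpace (𝓡 2) s) :
    g (j s) (e s) (mfderiv (𝓡 2) (𝓡∂ 3) j s u) = 0 := h.normal.unitNormal.normal s u

theorem form_normal_normal (h : BoundaryData g j e f) (s : S) : g (j s) (e s) (e s) = 1 :=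
  h.normal.unitNormal.unit s

theorem diffAlong_normal (h : BoundaryData g j e f) (s : S) : DiffAlong (𝓡 2) j e s :=
  (h.normal.unitNormal.smooth s).mdifferentiableAt (by simp)

theorem decomposition (h : BoundaryData g j e f) (s : S) (v : TangentSpace (𝓡∂ 3) (j s)) :
    ∃ u, v = mfderiv (𝓡 2) (𝓡∂ 3) j s u + g (j s) v (e s) • e s :=
  exists_tangent_decomposition (h.emb.immersion s) (h.symm _) (h.form_normal_normal s)
    (h.form_normal_tangent s) v

theorem eq_smul_normal (h : BoundaryData g j e f) (s : S) {v : TangentSpace (𝓡∂ 3) (j s)}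
    (hv : ∀ u, g (j s) v (mfderiv (𝓡 2) (𝓡∂ 3) j s u) = 0) : v = g (j s) v (e s) • e s := by
  obtain ⟨u, hu⟩ := h.decomposition s v
  have hu0 : u = 0 := by
    refine h.boundary_nondegenerate s u fun z => ?_
    have h1 := hv z
    rw [hu, map_add, map_smul, add_apply, smul_apply, h.form_normal_tangent, smul_zero,
      add_zero] at h1
    exact h1
  rw [hu0, map_zero, zero_add] at hu
  exact hu

theorem form_grad (h : BoundaryData g j e f) (x : M) (v : TangentSpace (𝓡∂ 3) x) :
    g x (grad g f x) v = mvfderiv (𝓡∂ 3) f x v := QuasiLocal.form_grad (h.isInvertible x) f v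

theorem form_boundary_grad (h : BoundaryData g j e f) (s : S) (v : TangentSpace (𝓡 2) s) :
    g (j s) (mfderiv (𝓡 2) (𝓡∂ 3) j s (grad (pullback (I := 𝓡 2) g j) (fun s => f (j s)) s))
      (mfderiv (𝓡 2) (𝓡∂ 3) j s v) = mvfderiv (𝓡∂ 3) f (j s) (mfderiv (𝓡 2) (𝓡∂ 3) j s v) := by
  rw [← h.mvfderiv_boundary]
  exact QuasiLocal.form_grad (h.boundary_isInvertible s) _ v

theorem grad_eq (h : BoundaryData g j e f) (s : S) :
    grad g f (j s) = mfderiv (𝓡 2) (𝓡∂ 3) j s (grad (pullback (I := 𝓡 2) g j) (fun s => f (j s)) s)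
      + mvfderiv (𝓡∂ 3) f (j s) (e s) • e s := by
  have h1 := h.eq_smul_normal s (v := grad g f (j s) -
    mfderiv (𝓡 2) (𝓡∂ 3) j s (grad (pullback (I := 𝓡 2) g j) (fun s => f (j s)) s)) fun u => by
      rw [map_sub, sub_apply, h.form_grad, h.form_boundary_grad, sub_self]
  rw [map_sub, sub_apply, h.form_grad, h.symm _ _ (e s), h.form_normal_tangent, sub_zero] at h1
  rw [← h1, add_sub_cancel]

theorem normSqGrad_boundary (h : BoundaryData g j e f) (s : S) :
    normSqGrad (pullback (I := 𝓡 2) g j) (fun s => f (j s)) s =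
      normSqGrad g f (j s) - mvfderiv (𝓡∂ 3) f (j s) (e s) * mvfderiv (𝓡∂ 3) f (j s) (e s) := by
  have h1 : normSqGrad (pullback (I := 𝓡 2) g j) (fun s => f (j s)) s =
    g (j s) (mfderiv (𝓡 2) (𝓡∂ 3) j s (grad (pullback (I := 𝓡 2) g j) (fun s => f (j s)) s))
      (mfderiv (𝓡 2) (𝓡∂ 3) j s (grad (pullback (I := 𝓡 2) g j) (fun s => f (j s)) s)) := rfl
  rw [h1, normSqGrad, h.grad_eq]
  simp only [map_add, map_smul, add_apply, smul_apply, smul_eq_mul, h.form_normal_tangent,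
    h.form_normal_normal]
  rw [h.symm _ _ (e s), h.form_normal_tangent]
  ring

theorem normSqGrad_nonneg (h : BoundaryData g j e f) (s : S) :
    0 ≤ normSqGrad (pullback (I := 𝓡 2) g j) (fun s => f (j s)) s := by
  by_cases h0 : grad (pullback (I := 𝓡 2) g j) (fun s => f (j s)) s = 0
  · rw [normSqGrad, h0, map_zero]
  · exact (boundary_pos h.pos h.emb s _ h0).le

theorem diffAlong_grad (h : BoundaryData g j e f) (s : S) :
    DiffAlong (𝓡 2) j (fun s => grad g f (j s)) s :=
  (QuasiLocal.diffAlong_grad (fun y => nondegenerate_of_pos (h.pos y)) (h.diff (j s))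
    h.smooth_two).comp (h.mdifferentiableAt_emb s)

theorem form_nabla_grad (h : BoundaryData g j e f) (s : S) (u : TangentSpace (𝓡 2) s)
    (z : TangentSpace (𝓡∂ 3) (j s)) :
    g (j s) (nabla g j (fun s => grad g f (j s)) s u) z =
      hess g f (j s) (mfderiv (𝓡 2) (𝓡∂ 3) j s u) z := by
  have h1 := nabla_comp g (F := fun y : M => y) (h.mdifferentiableAt_emb s)
    (QuasiLocal.diffAlong_grad (fun y => nondegenerate_of_pos (h.pos y)) (h.diff (j s))
      h.smooth_two) u
  exact congrArg (fun w => g (j s) w z) h1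

theorem form_nabla_normal_normal (h : BoundaryData g j e f) (s : S) (u : TangentSpace (𝓡 2) s) :
    g (j s) (nabla g j e s u) (e s) = 0 := by
  have h1 := nabla_metric h.symm (h.isInvertible (j s)) (h.diff (j s)) (h.diffAlong_normal s)
    (h.diffAlong_normal s) u
  simp only [h.form_normal_normal, mvfderiv_const_apply] at h1
  rw [h.symm _ (e s)] at h1
  linarith

theorem normalDeriv_eq (h : BoundaryData g j e f) :
    (fun s => mvfderiv (𝓡∂ 3) f (j s) (e s)) = fun s => g (j s) (grad g f (j s)) (e s) := by
  funext s
  rw [h.form_grad]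

theorem mdifferentiableAt_normalDeriv (h : BoundaryData g j e f) (s : S) :
    MDifferentiableAt (𝓡 2) 𝓘(ℝ, ℝ) (fun s => mvfderiv (𝓡∂ 3) f (j s) (e s)) s := by
  rw [h.normalDeriv_eq]
  exact mdifferentiableAt_form (h.diff _) (h.diffAlong_grad s) (h.diffAlong_normal s)

/-- Differentiate g(Df, e). As ∇_u e is tangent to the boundary, only the tangential part of Df
meets it. -/
theorem mvfderiv_normalDeriv (h : BoundaryData g j e f) (s : S) (u : TangentSpace (𝓡 2) s) :
    mvfderiv (𝓡 2) (fun s => mvfderiv (𝓡∂ 3) f (j s) (e s)) s u =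
      hess g f (j s) (mfderiv (𝓡 2) (𝓡∂ 3) j s u) (e s)
        + secondForm g j e s u (grad (pullback (I := 𝓡 2) g j) (fun s => f (j s)) s) := by
  rw [h.normalDeriv_eq, nabla_metric h.symm (h.isInvertible (j s)) (h.diff (j s))
    (h.diffAlong_grad s) (h.diffAlong_normal s), h.form_nabla_grad, h.symm _ (grad g f (j s)),
    h.grad_eq, map_add, map_smul, h.form_nabla_normal_normal, smul_zero, add_zero]
  rfl

theorem normSqGrad_boundary_eq (h : BoundaryData g j e f) :
    normSqGrad (pullback (I := 𝓡 2) g j) (fun s => f (j s)) =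
      fun s => g (j s) (grad g f (j s)) (grad g f (j s)) -
        mvfderiv (𝓡∂ 3) f (j s) (e s) * mvfderiv (𝓡∂ 3) f (j s) (e s) :=
  funext h.normSqGrad_boundary

theorem mdifferentiableAt_normSqGrad (h : BoundaryData g j e f) (s : S) :
    MDifferentiableAt (𝓡 2) 𝓘(ℝ, ℝ) (normSqGrad (pullback (I := 𝓡 2) g j) (fun s => f (j s))) s := by
  rw [h.normSqGrad_boundary_eq]
  exact (mdifferentiableAt_form (h.diff _) (h.diffAlong_grad s) (h.diffAlong_grad s)).sub
    ((h.mdifferentiableAt_normalDeriv s).mul (h.mdifferentiableAt_normalDeriv s))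

/-- Differentiates |∇τ|² = |Df|² - e(f)², so the intrinsic connection of the boundary is not needed;
the terms with Hess f(u, e) cancel. -/
theorem mvfderiv_normSqGrad (h : BoundaryData g j e f) (s : S) (u : TangentSpace (𝓡 2) s) :
    mvfderiv (𝓡 2) (normSqGrad (pullback (I := 𝓡 2) g j) (fun s => f (j s))) s u =
      2 * (hess g f (j s) (mfderiv (𝓡 2) (𝓡∂ 3) j s u)
          (mfderiv (𝓡 2) (𝓡∂ 3) j s (grad (pullback (I := 𝓡 2) g j) (fun s => f (j s)) s))
        - mvfderiv (𝓡∂ 3) f (j s) (e s) *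
          secondForm g j e s u (grad (pullback (I := 𝓡 2) g j) (fun s => f (j s)) s)) := by
  have d1 := mdifferentiableAt_form (h.diff (j s)) (h.diffAlong_grad s) (h.diffAlong_grad s)
  have d2 := h.mdifferentiableAt_normalDeriv s
  have h1 := mvfderiv_fun_mul d2 d2
  rw [h.normSqGrad_boundary_eq, mvfderiv_fun_sub
    (g' := fun s => mvfderiv (𝓡∂ 3) f (j s) (e s) * mvfderiv (𝓡∂ 3) f (j s) (e s))
    d1 (d2.mul d2)]
  have h2 := nabla_metric h.symm (h.isInvertible (j s)) (h.diff (j s)) (h.diffAlong_grad s)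
    (h.diffAlong_grad s) u
  rw [sub_apply, h2, h1, h.symm _ (grad g f (j s)), h.form_nabla_grad]
  simp only [add_apply, smul_apply, smul_eq_mul, h.mvfderiv_normalDeriv]
  rw [h.grad_eq]
  simp only [map_add, map_smul, smul_eq_mul]
  ring

/-- Differentiate ∇τ = Df - e(f) e along the boundary and keep the tangential part, in which the
derivative of the coefficient e(f) is lost. -/
theorem hess_boundary (h : BoundaryData g j e f) (s : S) (u v : TangentSpace (𝓡 2) s) :
    hess (pullback (I := 𝓡 2) g j) (fun s => f (j s)) s u v =
      hess g f (j s) (mfderiv (𝓡 2) (𝓡∂ 3) j s u) (mfderiv (𝓡 2) (𝓡∂ 3) j s v)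
        - mvfderiv (𝓡∂ 3) f (j s) (e s) * secondForm g j e s u v := by
  have h1 : DiffAlong (𝓡 2) (fun s : S => s) (grad (pullback (I := 𝓡 2) g j) (fun s => f (j s))) s :=
    QuasiLocal.diffAlong_grad h.boundary_nondegenerate (h.boundary_diff s) h.boundary_smooth
  have h2 := form_nabla_mfderiv h.symm h.emb_two (j := fun s : S => s) (h.isInvertible _)
    (h.diff _) (h.boundary_isInvertible s) h1 u v
  have h3 : (fun s => mfderiv (𝓡 2) (𝓡∂ 3) j s (grad (pullback (I := 𝓡 2) g j) (fun s => f (j s)) s)) =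
      fun s => grad g f (j s) + (-mvfderiv (𝓡∂ 3) f (j s) (e s)) • e s := by
    funext s
    rw [h.grad_eq, neg_smul, add_neg_cancel_right]
  have d2 : MDifferentiableAt (𝓡 2) 𝓘(ℝ, ℝ) (fun s => -mvfderiv (𝓡∂ 3) f (j s) (e s)) s :=
    (h.mdifferentiableAt_normalDeriv s).neg
  refine h2.symm.trans ?_
  rw [h3, nabla_add g (h.diffAlong_grad s) (DiffAlong.smul d2 (h.diffAlong_normal s)),
    nabla_smul g d2 (h.diffAlong_normal s)]
  simp only [map_add, map_smul, add_apply, smul_apply, smul_eq_mul, h.form_nabla_grad,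
    h.form_normal_tangent]
  unfold secondForm
  rw [ContinuousLinearMap.comp_apply]
  ring

theorem laplacian_boundary (h : BoundaryData g j e f) (s : S) :
    laplacian (pullback (I := 𝓡 2) g j) (fun s => f (j s)) s =
      mtrace (pullback (I := 𝓡 2) g j) s (fun u v => hess g f (j s) (mfderiv (𝓡 2) (𝓡∂ 3) j s u)
        (mfderiv (𝓡 2) (𝓡∂ 3) j s v))
      - mvfderiv (𝓡∂ 3) f (j s) (e s) * meanCurvature (I := 𝓡 2) g j e s := by
  unfold laplacian meanCurvature
  rw [mtrace_congr _ _ (h.hess_boundary s), sub_eq_add_neg, neg_mul_eq_neg_mul, ← mtrace_mul,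
    ← mtrace_add]
  exact mtrace_congr _ _ fun u v => by ring

end BoundaryData

end BoundaryData

/-! ### The normal and the mean curvature of the boundary of the graph. -/

section GraphBoundary

variable {M : Type*} [TopologicalSpace M] [ChartedSpace (EuclideanHalfSpace 3) M]
  [IsManifold (𝓡∂ 3) ∞ M]
  {S : Type*} [TopologicalSpace S] [ChartedSpace (EuclideanSpace ℝ (Fin 2)) S]
  [IsManifold (𝓡 2) ∞ S]
  {g : FormField (𝓡∂ 3) M} {j : S → M} {e : ∀ s : S, TangentSpace (𝓡∂ 3) (j s)} {f : M → ℝ}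
  {ν : ∀ s : S, TangentSpace (𝓡∂ 3) (j s)}

namespace BoundaryData

/-- The graph metric pairs ν with u as g pairs ν + df(ν) Df with u. That vector is therefore
g-orthogonal to the boundary and a multiple of e. -/
theorem graph_normal_eq (h : BoundaryData g j e f)
    (hν : IsOutwardUnitNormal (graphMetric g f) j ν) (s : S) :
    ν s = graphMetric g f (j s) (ν s) (e s) • e s
      - mvfderiv (𝓡∂ 3) f (j s) (ν s) • grad g f (j s) := by
  have h1 := h.eq_smul_normal s (v := ν s + mvfderiv (𝓡∂ 3) f (j s) (ν s) • grad g f (j s))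
    fun u => by
      have := hν.unitNormal.normal s u
      rw [graphMetric_apply] at this
      rw [map_add, map_smul, add_apply, smul_apply, h.form_grad, smul_eq_mul, this]
  rw [map_add, map_smul, add_apply, smul_apply, h.form_grad, smul_eq_mul, ← graphMetric_apply] at h1
  rw [← h1, add_sub_cancel_right]

/-- Modulo tangent vectors of the boundary ν is a multiple of e, and both point outward. This fixes
the sign in `graph_normal_coeff`. -/
theorem form_graph_normal_pos (h : BoundaryData g j e f)
    (hν : IsOutwardUnitNormal (graphMetric g f) j ν) (s : S) : 0 < g (j s) (ν s) (e s) := by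
  obtain ⟨u, hu⟩ := h.decomposition s (ν s)
  have h1 := hν.outward s
  have h2 := h.normal.outward s
  unfold PointsOutward at h1 h2
  rw [hu, map_add, map_add, h.emb.comps_mfderiv_zero, map_smul, map_smul, zero_add,
    smul_eq_mul] at h1
  by_contra hc
  exact absurd h1 (not_lt.2 (mul_nonneg_of_nonpos_of_nonpos (not_lt.1 hc) h2.le))

theorem sqrt_boundary_pos (h : BoundaryData g j e f) (s : S) :
    0 < √(1 + normSqGrad (pullback (I := 𝓡 2) g j) (fun s => f (j s)) s) :=
  Real.sqrt_pos.2 (by linarith [h.normSqGrad_nonneg s])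

theorem one_add_normSqGrad_pos (h : BoundaryData g j e f) (s : S) :
    0 < 1 + normSqGrad g f (j s) := by
  have h1 := h.normSqGrad_nonneg s
  rw [h.normSqGrad_boundary] at h1
  nlinarith [mul_self_nonneg (mvfderiv (𝓡∂ 3) f (j s) (e s))]

theorem mvfderiv_graph_normal (h : BoundaryData g j e f)
    (hν : IsOutwardUnitNormal (graphMetric g f) j ν) (s : S) :
    mvfderiv (𝓡∂ 3) f (j s) (ν s) * (1 + normSqGrad g f (j s)) =
      graphMetric g f (j s) (ν s) (e s) * mvfderiv (𝓡∂ 3) f (j s) (e s) := by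
  have h1 := congrArg (mvfderiv (𝓡∂ 3) f (j s)) (h.graph_normal_eq hν s)
  have h2 : mvfderiv (𝓡∂ 3) f (j s) (grad g f (j s)) = normSqGrad g f (j s) :=
    (h.form_grad _ _).symm
  rw [map_sub, map_smul, map_smul, h2, smul_eq_mul, smul_eq_mul] at h1
  linear_combination h1

/-- With l the coefficient, m = df(ν) and a = e(f), unit length reads l(l - m a) = 1 and applying df
to the decomposition of ν reads m w² = l a. Together l² W² = w², and l > 0. -/
theorem graph_normal_coeff (h : BoundaryData g j e f)
    (hν : IsOutwardUnitNormal (graphMetric g f) j ν) (s : S) :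
    graphMetric g f (j s) (ν s) (e s) = √(1 + normSqGrad g f (j s)) /
      √(1 + normSqGrad (pullback (I := 𝓡 2) g j) (fun s => f (j s)) s) := by
  have hW := h.sqrt_boundary_pos s
  have hw := h.one_add_normSqGrad_pos s
  have hWsq : √(1 + normSqGrad (pullback (I := 𝓡 2) g j) (fun s => f (j s)) s) ^ 2 = _ :=
    Real.sq_sqrt (by linarith [h.normSqGrad_nonneg s])
  have hwsq : √(1 + normSqGrad g f (j s)) ^ 2 = _ := Real.sq_sqrt hw.le
  have hw0 := Real.sqrt_pos.2 hw
  have hμ := h.mvfderiv_graph_normal hν s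
  have hp := h.form_graph_normal_pos hν s
  rw [h.normSqGrad_boundary] at hWsq hW ⊢
  set l := graphMetric g f (j s) (ν s) (e s)
  set m := mvfderiv (𝓡∂ 3) f (j s) (ν s)
  set a := mvfderiv (𝓡∂ 3) f (j s) (e s)
  have h1 : g (j s) (ν s) (e s) = l - m * a := by
    have : l = g (j s) (ν s) (e s) + m * a := rfl
    linarith
  have h2 : l * (l - m * a) = 1 := by
    rw [← hν.unitNormal.unit s, ← h1, graphMetric_apply]
    have h3 := congrArg (g (j s) (ν s)) (h.graph_normal_eq hν s)
    rw [map_sub, map_smul, map_smul, h.symm _ _ (grad g f (j s)), h.form_grad] at h3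
    rw [h3]
    simp only [smul_eq_mul]
    ring
  rw [h1] at hp
  have hl : 0 < l := by
    by_contra hc
    nlinarith [mul_nonneg_of_nonpos_of_nonpos (not_lt.1 hc) (neg_nonpos.2 hp.le)]
  rw [eq_div_iff hW.ne', ← sq_eq_sq₀ (by positivity) (by positivity), mul_pow, hWsq, hwsq]
  linear_combination (1 + normSqGrad g f (j s)) * h2 + l * a * hμ

/-- Differentiate ν = l e - m Df. The term with dl is normal, and the term with dm cancels against
the correction in `form_nabla_graphMetric`. -/
theorem secondForm_graph (h : BoundaryData g j e f)
    (hν : IsOutwardUnitNormal (graphMetric g f) j ν) (s : S) (u v : TangentSpace (𝓡 2) s) :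
    secondForm (graphMetric g f) j ν s u v =
      graphMetric g f (j s) (ν s) (e s) * secondForm g j e s u v
      - mvfderiv (𝓡∂ 3) f (j s) (ν s) * hess g f (j s) (mfderiv (𝓡 2) (𝓡∂ 3) j s u)
          (mfderiv (𝓡 2) (𝓡∂ 3) j s v) := by
  have hνd : DiffAlong (𝓡 2) j ν s := (hν.unitNormal.smooth s).mdifferentiableAt (by simp)
  have hl : MDifferentiableAt (𝓡 2) 𝓘(ℝ, ℝ)
      (fun s => graphMetric g f (j s) (ν s) (e s)) s :=
    mdifferentiableAt_form (formDiffAt_graphMetric (h.diff _) h.smooth_two) hνd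
      (h.diffAlong_normal s)
  have em : (fun s => mvfderiv (𝓡∂ 3) f (j s) (ν s)) =
      fun s => g (j s) (grad g f (j s)) (ν s) := by
    funext s
    rw [h.form_grad]
  have hm : MDifferentiableAt (𝓡 2) 𝓘(ℝ, ℝ) (fun s => mvfderiv (𝓡∂ 3) f (j s) (ν s)) s := by
    rw [em]
    exact mdifferentiableAt_form (h.diff _) (h.diffAlong_grad s) hνd
  have hmn : MDifferentiableAt (𝓡 2) 𝓘(ℝ, ℝ) (fun s => -mvfderiv (𝓡∂ 3) f (j s) (ν s)) s := hm.neg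
  have eν : ∀ᶠ b in nhds s, ν b = graphMetric g f (j b) (ν b) (e b) • e b +
      (-mvfderiv (𝓡∂ 3) f (j b) (ν b)) • grad g f (j b) := by
    refine Filter.Eventually.of_forall fun b => ?_
    conv_lhs => rw [h.graph_normal_eq hν b]
    rw [neg_smul, sub_eq_add_neg]
  have key : nabla g j ν s u = _ := nabla_congr g eν u
  rw [nabla_add g (DiffAlong.smul hl (h.diffAlong_normal s))
    (DiffAlong.smul hmn (h.diffAlong_grad s)), nabla_smul g hl (h.diffAlong_normal s),
    nabla_smul g hmn (h.diffAlong_grad s)] at key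
  unfold secondForm
  rw [ContinuousLinearMap.comp_apply, ContinuousLinearMap.comp_apply,
    form_nabla_graphMetric (h.isInvertible _) (h.isInvertible_graphMetric _) (h.diff _)
      h.smooth_two hνd, key, mvfderiv_fun_neg]
  simp only [map_add, map_smul, add_apply, smul_apply, neg_apply, smul_eq_mul,
    h.form_nabla_grad, h.form_normal_tangent, h.form_grad]
  ring

/-- The boundary of the graph has metric σ + dτ ⊗ dτ, so `mtrace_add_rank_one` applies with α = dτ
to each of the two terms of `secondForm_graph`. -/
theorem meanCurvature_graph (h : BoundaryData g j e f)
    (hν : IsOutwardUnitNormal (graphMetric g f) j ν) (s : S) :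
    meanCurvature (I := 𝓡 2) (graphMetric g f) j ν s =
      graphMetric g f (j s) (ν s) (e s) * (meanCurvature (I := 𝓡 2) g j e s -
        secondForm g j e s (grad (pullback (I := 𝓡 2) g j) (fun s => f (j s)) s)
          (grad (pullback (I := 𝓡 2) g j) (fun s => f (j s)) s) /
        (1 + normSqGrad (pullback (I := 𝓡 2) g j) (fun s => f (j s)) s))
      - mvfderiv (𝓡∂ 3) f (j s) (ν s) *
        (mtrace (pullback (I := 𝓡 2) g j) s (fun u v =>
          hess g f (j s) (mfderiv (𝓡 2) (𝓡∂ 3) j s u) (mfderiv (𝓡 2) (𝓡∂ 3) j s v)) -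
        hess g f (j s)
          (mfderiv (𝓡 2) (𝓡∂ 3) j s (grad (pullback (I := 𝓡 2) g j) (fun s => f (j s)) s))
          (mfderiv (𝓡 2) (𝓡∂ 3) j s (grad (pullback (I := 𝓡 2) g j) (fun s => f (j s)) s)) /
        (1 + normSqGrad (pullback (I := 𝓡 2) g j) (fun s => f (j s)) s)) := by
  set σ := pullback (I := 𝓡 2) g j with hσ
  set D := mfderiv (𝓡 2) (𝓡∂ 3) j s with hD
  set τ := fun s => f (j s) with hτ
  have hq : mvfderiv (𝓡 2) τ s (grad σ τ s) = normSqGrad σ τ s :=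
    (QuasiLocal.form_grad (h.boundary_isInvertible s) τ _).symm
  have hinv : (pullback (I := 𝓡 2) (graphMetric g f) j s).IsInvertible :=
    (nondegenerate_of_pos (boundary_pos (fun x => graphMetric_pos (h.pos x) f) h.emb s)).isInvertible
  have hr : ∀ u v, pullback (I := 𝓡 2) (graphMetric g f) j s u v =
      σ s u v + mvfderiv (𝓡 2) τ s u * mvfderiv (𝓡 2) τ s v := by
    intro u v
    rw [h.mvfderiv_boundary, h.mvfderiv_boundary]
    rfl
  have hne : 1 + mvfderiv (𝓡 2) τ s (grad σ τ s) ≠ 0 := by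
    rw [hq]
    linarith [h.normSqGrad_nonneg s]
  have t1 := mtrace_add_rank_one (h.boundary_isInvertible s) hinv (h.boundary_symm s) _ hr
    (QuasiLocal.form_grad (h.boundary_isInvertible s) τ) hne (isLinearMap_secondForm g j e s)
  have hlin : IsLinearMap ℝ (fun u : TangentSpace (𝓡 2) s => (hess g f (j s) (D u)) ∘L D) := by
    have := isLinearMap_hess g f (j s)
    constructor
    · intro u v
      simp only [map_add, this.map_add, ContinuousLinearMap.add_comp]
    · intro c u
      simp only [map_smul, this.map_smul, ContinuousLinearMap.smul_comp]
  have t2 := mtrace_add_rank_one (h.boundary_isInvertible s) hinv (h.boundary_symm s) _ hr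
    (QuasiLocal.form_grad (h.boundary_isInvertible s) τ) hne hlin
  rw [hq] at t1 t2
  unfold meanCurvature
  rw [mtrace_congr _ _ (h.secondForm_graph hν s)]
  set l := graphMetric g f (j s) (ν s) (e s)
  set m := mvfderiv (𝓡∂ 3) f (j s) (ν s)
  have hsplit : mtrace (pullback (I := 𝓡 2) (graphMetric g f) j) s (fun u v =>
      l * secondForm g j e s u v - m * hess g f (j s) (D u) (D v)) =
      l * mtrace (pullback (I := 𝓡 2) (graphMetric g f) j) s (fun u v => secondForm g j e s u v)
      - m * mtrace (pullback (I := 𝓡 2) (graphMetric g f) j) s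
        (fun u v => ((hess g f (j s) (D u)) ∘L D) v) := by
    rw [sub_eq_add_neg, neg_mul_eq_neg_mul, ← mtrace_mul, ← mtrace_mul, ← mtrace_add]
    refine mtrace_congr _ _ fun u v => ?_
    rw [ContinuousLinearMap.comp_apply]
    ring
  rw [hsplit, t1, t2]
  rfl

end BoundaryData

end GraphBoundary

/-- The scalar identity behind the Jang graph identity. -/
theorem graph_algebra {W w a C m d II trII trh trp h11 h13 h31 h33 p11 p13 p31 p33 : ℝ}
    (hW : 0 < W) (hw : 0 < w) (hrel : w ^ 2 = W ^ 2 + a ^ 2) (hC : C * W = w)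
    (hm : m * w ^ 2 = w / W * a)
    (hd : w * d = -(h13 + II) + a * (2 * (h11 - a * II)) / (2 * W ^ 2))
    (hJ : 1 / w * trh - trp + (1 / w * h33 - p33)
      - (1 / w * h11 - p11 + a * (1 / w * h31 - p31)
        + a * (1 / w * h13 - p13 + a * (1 / w * h33 - p33))) / w ^ 2 = 0) :
    w / W * (trII - II / W ^ 2) - m * (trh - h11 / W ^ 2)
      - 1 / w * (w / W * (1 / w * h13 - p13 + a * (1 / w * h33 - p33))
        - m * (1 / w * h11 - p11 + a * (1 / w * h13 - p13)
          + a * (1 / w * h31 - p31 + a * (1 / w * h33 - p33)))) =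
      C * trII + -a / W * trp + 1 / W * (d + p13) := by
  have hC' : C = w / W := by field_simp; exact hC
  have hm' : m = a / (w * W) := by field_simp at hm ⊢; linarith
  have hd' : d = (-(h13 + II) + a * (2 * (h11 - a * II)) / (2 * W ^ 2)) / w := by
    field_simp; field_simp at hd; linarith
  have hw2 : W ^ 2 = w ^ 2 - a ^ 2 := by linarith
  -- Index 1 stands for ∇τ (not normalised) and 3 for e; C is cosh φ, d is dφ(∇τ), m is df(ν) and a
  -- is e(f). The multiplier a/W of Jang's equation is the one that removes tr p, and tr Hess f goes
  -- with it. The rest is rational algebra modulo w² = W² + a².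
  have key : w / W * (trII - II / W ^ 2) - m * (trh - h11 / W ^ 2)
      - 1 / w * (w / W * (1 / w * h13 - p13 + a * (1 / w * h33 - p33))
        - m * (1 / w * h11 - p11 + a * (1 / w * h13 - p13)
          + a * (1 / w * h31 - p31 + a * (1 / w * h33 - p33)))) -
      (C * trII + -a / W * trp + 1 / W * (d + p13)) + a / W * (1 / w * trh - trp + (1 / w * h33 - p33)
      - (1 / w * h11 - p11 + a * (1 / w * h31 - p31)
        + a * (1 / w * h13 - p13 + a * (1 / w * h33 - p33))) / w ^ 2) = 0 := by
    rw [hC', hm', hd']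
    field_simp
    linear_combination (-II * w ^ 2) * hrel
  rw [hJ] at key
  linarith

/-! ### The Jang graph identity in terms of data in M. -/

section Jang

variable {M : Type*} [TopologicalSpace M] [ChartedSpace (EuclideanHalfSpace 3) M]
  [IsManifold (𝓡∂ 3) ∞ M]
  {S : Type*} [TopologicalSpace S] [ChartedSpace (EuclideanSpace ℝ (Fin 2)) S]
  [IsManifold (𝓡 2) ∞ S]
  {g : FormField (𝓡∂ 3) M} {j : S → M} {e : ∀ s : S, TangentSpace (𝓡∂ 3) (j s)} {f : M → ℝ}
  {p : ∀ x : M, TangentSpace (𝓡∂ 3) x → TangentSpace (𝓡∂ 3) x →L[ℝ] ℝ}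
  {ν : ∀ s : S, TangentSpace (𝓡∂ 3) (j s)}

theorem isLinearMap_jangTensor {x : M} (hp : IsLinearMap ℝ (p x)) :
    IsLinearMap ℝ (jangTensor g p f x) := by
  have hh := isLinearMap_hess g f x
  constructor
  · intro u v
    simp only [jangTensor, hh.map_add, hp.map_add, smul_add]
    abel
  · intro c u
    simp only [jangTensor, hh.map_smul, hp.map_smul, smul_sub, smul_comm c]

theorem jangTensor_apply (x : M) (u v : TangentSpace (𝓡∂ 3) x) :
    jangTensor g p f x u v = 1 / √(1 + normSqGrad g f x) * hess g f x u v - p x u v := rfl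

namespace BoundaryData

theorem form_schoenYauField (h : BoundaryData g j e f) (s : S)
    (v : TangentSpace (𝓡∂ 3) (j s)) :
    graphMetric g f (j s) (schoenYauField g p f (j s)) v =
      1 / √(1 + normSqGrad g f (j s)) * jangTensor g p f (j s) (grad g f (j s)) v := by
  unfold schoenYauField
  rw [(h.isInvertible_graphMetric (j s)).self_apply_inverse]
  rfl

/-- Splits the full trace in Jang's equation into the trace over the boundary and the normal
component, the form in which `graph_algebra` uses it. -/
theorem jang_boundary (h : BoundaryData g j e f) {s : S} (hp : IsLinearMap ℝ (p (j s)))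
    (hJ : JangEquation g p f) :
    1 / √(1 + normSqGrad g f (j s)) * mtrace (pullback (I := 𝓡 2) g j) s (fun u v =>
        hess g f (j s) (mfderiv (𝓡 2) (𝓡∂ 3) j s u) (mfderiv (𝓡 2) (𝓡∂ 3) j s v))
      - mtrace (pullback (I := 𝓡 2) g j) s (fun u v =>
        p (j s) (mfderiv (𝓡 2) (𝓡∂ 3) j s u) (mfderiv (𝓡 2) (𝓡∂ 3) j s v))
      + jangTensor g p f (j s) (e s) (e s)
      - jangTensor g p f (j s) (grad g f (j s)) (grad g f (j s)) /
        (1 + normSqGrad g f (j s)) = 0 := by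
  have h1 := hJ (j s)
  rw [mtrace_hypersurface (h.isInvertible _) (h.boundary_isInvertible s) (h.symm _)
    (h.form_normal_tangent s) (h.decomposition s) (isLinearMap_jangTensor hp)] at h1
  have h2 : mtrace (pullback (I := 𝓡 2) g j) s (fun u v => jangTensor g p f (j s)
        (mfderiv (𝓡 2) (𝓡∂ 3) j s u) (mfderiv (𝓡 2) (𝓡∂ 3) j s v)) =
      1 / √(1 + normSqGrad g f (j s)) * mtrace (pullback (I := 𝓡 2) g j) s (fun u v =>
        hess g f (j s) (mfderiv (𝓡 2) (𝓡∂ 3) j s u) (mfderiv (𝓡 2) (𝓡∂ 3) j s v))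
      - mtrace (pullback (I := 𝓡 2) g j) s (fun u v =>
        p (j s) (mfderiv (𝓡 2) (𝓡∂ 3) j s u) (mfderiv (𝓡 2) (𝓡∂ 3) j s v)) := by
    rw [sub_eq_add_neg, ← neg_one_mul (mtrace _ _ _), ← mtrace_mul, ← mtrace_mul, ← mtrace_add]
    refine mtrace_congr _ _ fun u v => ?_
    rw [jangTensor_apply]
    ring
  rw [← h2]
  exact h1

theorem cosh_mul_sqrt (h : BoundaryData g j e f) {φ : S → ℝ}
    (hφ : ∀ s, Real.sinh (φ s) = -(mvfderiv (𝓡∂ 3) f (j s) (e s)) /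
      √(1 + normSqGrad (pullback (I := 𝓡 2) g j) (fun s => f (j s)) s)) (s : S) :
    Real.cosh (φ s) * √(1 + normSqGrad (pullback (I := 𝓡 2) g j) (fun s => f (j s)) s) =
      √(1 + normSqGrad g f (j s)) := by
  have hW := h.sqrt_boundary_pos s
  have hw := h.one_add_normSqGrad_pos s
  have hWsq : √(1 + normSqGrad (pullback (I := 𝓡 2) g j) (fun s => f (j s)) s) ^ 2 = _ :=
    Real.sq_sqrt (by linarith [h.normSqGrad_nonneg s])
  have hc := Real.cosh_sq (φ s)
  rw [← sq_eq_sq₀ (mul_nonneg (Real.cosh_pos _).le hW.le) (Real.sqrt_nonneg _), mul_pow, hc, hφ,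
    Real.sq_sqrt hw.le, div_pow, add_mul, div_mul_cancel₀ _ (by positivity), hWsq,
    h.normSqGrad_boundary]
  ring

/-- The right side is the expression in which graph and spacetime geometry meet. All terms are
expanded in ∇τ and e, and `graph_algebra` finishes. -/
theorem graph_identity (h : BoundaryData g j e f)
    (hν : IsOutwardUnitNormal (graphMetric g f) j ν) {s : S} (hp : IsLinearMap ℝ (p (j s)))
    (hJ : JangEquation g p f) {φ : S → ℝ}
    (hφ : ∀ s, Real.sinh (φ s) = -(mvfderiv (𝓡∂ 3) f (j s) (e s)) /
      √(1 + normSqGrad (pullback (I := 𝓡 2) g j) (fun s => f (j s)) s)) :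
    meanCurvature (I := 𝓡 2) (graphMetric g f) j ν s
        - graphMetric g f (j s) (schoenYauField g p f (j s)) (ν s) =
      Real.cosh (φ s) * meanCurvature (I := 𝓡 2) g j e s
      + Real.sinh (φ s) * mtrace (pullback (I := 𝓡 2) g j) s (fun u v =>
        p (j s) (mfderiv (𝓡 2) (𝓡∂ 3) j s u) (mfderiv (𝓡 2) (𝓡∂ 3) j s v))
      + 1 / √(1 + normSqGrad (pullback (I := 𝓡 2) g j) (fun s => f (j s)) s) *
        (mvfderiv (𝓡 2) φ s (grad (pullback (I := 𝓡 2) g j) (fun s => f (j s)) s)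
          + p (j s)
            (mfderiv (𝓡 2) (𝓡∂ 3) j s (grad (pullback (I := 𝓡 2) g j) (fun s => f (j s)) s))
            (e s)) := by
  have hW := h.sqrt_boundary_pos s
  have hw := Real.sqrt_pos.2 (h.one_add_normSqGrad_pos s)
  have hWsq : √(1 + normSqGrad (pullback (I := 𝓡 2) g j) (fun s => f (j s)) s) ^ 2 = _ :=
    Real.sq_sqrt (by linarith [h.normSqGrad_nonneg s])
  have hwsq : √(1 + normSqGrad g f (j s)) ^ 2 = _ := Real.sq_sqrt (h.one_add_normSqGrad_pos s).le
  obtain ⟨W, hWd⟩ :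
    ∃ W, √(1 + normSqGrad (pullback (I := 𝓡 2) g j) (fun s => f (j s)) s) = W := ⟨_, rfl⟩
  obtain ⟨w, hwd⟩ : ∃ w, √(1 + normSqGrad g f (j s)) = w := ⟨_, rfl⟩
  have hc := h.cosh_mul_sqrt hφ s
  have hb := mvfderiv_boost (h.mdifferentiableAt_normalDeriv s) (h.mdifferentiableAt_normSqGrad s)
    h.normSqGrad_nonneg hφ (grad (pullback (I := 𝓡 2) g j) (fun s => f (j s)) s)
  rw [hc, h.mvfderiv_normalDeriv, h.mvfderiv_normSqGrad] at hb
  have hJs := h.jang_boundary hp hJ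
  have hJν := congrArg (jangTensor g p f (j s) (grad g f (j s))) (h.graph_normal_eq hν s)
  have hμ := h.mvfderiv_graph_normal hν s
  have hrel := h.normSqGrad_boundary s
  have hlin := isLinearMap_jangTensor (g := g) (f := f) hp
  rw [h.meanCurvature_graph hν, h.form_schoenYauField, hφ, h.graph_normal_coeff hν]
  rw [map_sub, map_smul, map_smul] at hJν
  rw [hJν]
  rw [h.graph_normal_coeff hν] at hμ ⊢
  have hrw : w ^ 2 = W ^ 2 + mvfderiv (𝓡∂ 3) f (j s) (e s) ^ 2 := by
    rw [← hWd, ← hwd, hWsq, hwsq, hrel]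
    ring
  rw [hwd, hWd] at hμ ⊢
  rw [hwd] at hb hc hJs hwsq hw
  rw [hWd] at hc hWsq hW
  rw [← hWsq] at hb ⊢
  rw [← hwsq] at hJs hμ
  -- The two slots of the tensor are expanded separately by Df = ∇τ + e(f) e, so no symmetry of the
  -- tensor enters.
  have hD : jangTensor g p f (j s) (grad g f (j s)) =
      jangTensor g p f (j s) (mfderiv (𝓡 2) (𝓡∂ 3) j s
        (grad (pullback (I := 𝓡 2) g j) (fun s => f (j s)) s))
      + mvfderiv (𝓡∂ 3) f (j s) (e s) • jangTensor g p f (j s) (e s) := by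
    conv_lhs => rw [h.grad_eq]
    rw [hlin.map_add, hlin.map_smul]
  have hDv : ∀ L : TangentSpace (𝓡∂ 3) (j s) →L[ℝ] ℝ, L (grad g f (j s)) =
      L (mfderiv (𝓡 2) (𝓡∂ 3) j s (grad (pullback (I := 𝓡 2) g j) (fun s => f (j s)) s))
      + mvfderiv (𝓡∂ 3) f (j s) (e s) * L (e s) := by
    intro L
    conv_lhs => rw [h.grad_eq]
    rw [map_add, map_smul, smul_eq_mul]
  rw [hDv, hD] at hJs
  rw [hDv, hD]
  simp only [add_apply, smul_apply, smul_eq_mul, jangTensor_apply, hwd] at hJs ⊢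
  have key := graph_algebra hW hw hrw hc hμ hb
    (trII := meanCurvature (I := 𝓡 2) g j e s) hJs
  linear_combination key

end BoundaryData

end Jang

/-! ### Lorentzian metrics are nondegenerate with differentiable components. -/

section Lorentz

variable {N : Type*} [TopologicalSpace N] [ChartedSpace (EuclideanSpace ℝ (Fin 4)) N]
  [IsManifold (𝓡 4) ∞ N]

/-- A vector in the kernel is orthogonal to the timelike t, hence spacelike unless zero. -/
theorem LorentzMetric.nondegenerate (G : LorentzMetric N) (x : N) :
    Nondegenerate G.form x := by
  intro u hu
  obtain ⟨t, -, ht⟩ := G.signature x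
  by_contra hne
  exact (ht u (by rw [G.symm, hu]) hne).ne' (hu u)

theorem LorentzMetric.formDiffAt (G : LorentzMetric N) (x : N) : FormDiffAt G.form x := by
  have h := ((contMDiffAt_hom_bundle _).1 (G.smooth x)).2.mdifferentiableAt (by simp)
  refine h.congr_of_eventuallyEq ?_
  filter_upwards [mem_baseSet_trivializationAt_tangent (I := 𝓡 4) x] with y hy
  ext u v
  refine Eq.trans ?_ (inCoordinates_apply_eq₂ (F₃ := ℝ)
    (E₃ := Bundle.Trivial N ℝ) hy hy (Set.mem_univ _)).symm
  rw [coordForm_apply]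
  change _ = (Trivial.trivialization N ℝ).linearMapAt ℝ y _
  rw [Trivial.linearMapAt_trivialization, ← Trivialization.symmL_apply (R := ℝ) _ hy,
    ← Trivialization.symmL_apply (R := ℝ) _ hy]
  rfl

end Lorentz

/-! ### Boosted normal frames along the boundary of a spacelike hypersurface. -/

section Hypersurface

variable {N : Type*} [TopologicalSpace N] [ChartedSpace (EuclideanSpace ℝ (Fin 4)) N]
  [IsManifold (𝓡 4) ∞ N]
  {M : Type*} [TopologicalSpace M] [ChartedSpace (EuclideanHalfSpace 3) M]
  [IsManifold (𝓡∂ 3) ∞ M]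
  {S : Type*} [TopologicalSpace S] [ChartedSpace (EuclideanSpace ℝ (Fin 2)) S]
  [IsManifold (𝓡 2) ∞ S]

/-- A hypersurface with timelike unit normal `n`. -/
structure HypersurfaceData (G : FormField (𝓡 4) N) (ι : M → N)
    (n : ∀ x : M, TangentSpace (𝓡 4) (ι x)) : Prop where
  symm : ∀ x u v, G x u v = G x v u
  nondegenerate : ∀ x, Nondegenerate G x
  diff : ∀ x, FormDiffAt G x
  smooth : ContMDiff (𝓡∂ 3) (𝓡 4) ∞ ι
  normal : IsUnitNormal (𝓡∂ 3) G ι n (-1)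

variable {G : FormField (𝓡 4) N} {ι : M → N} {n : ∀ x : M, TangentSpace (𝓡 4) (ι x)}
  {j : S → M} {e : ∀ s : S, TangentSpace (𝓡∂ 3) (j s)} {f : M → ℝ}

namespace HypersurfaceData

theorem smooth_two (k : HypersurfaceData G ι n) : ContMDiff (𝓡∂ 3) (𝓡 4) 2 ι :=
  k.smooth.of_le (WithTop.coe_le_coe.2 (le_top : (2 : ℕ∞) ≤ ⊤))

theorem mdifferentiableAt (k : HypersurfaceData G ι n) (x : M) :
    MDifferentiableAt (𝓡∂ 3) (𝓡 4) ι x := (k.smooth_two x).mdifferentiableAt (by simp)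

theorem diffAlong_normal (k : HypersurfaceData G ι n) (x : M) : DiffAlong (𝓡∂ 3) ι n x :=
  (k.normal.smooth x).mdifferentiableAt (by simp)

theorem form_normal_tangent (k : HypersurfaceData G ι n) (x : M) (u : TangentSpace (𝓡∂ 3) x) :
    G (ι x) (n x) (mfderiv (𝓡∂ 3) (𝓡 4) ι x u) = 0 := k.normal.normal x u

theorem form_tangent_normal (k : HypersurfaceData G ι n) (x : M) (u : TangentSpace (𝓡∂ 3) x) :
    G (ι x) (mfderiv (𝓡∂ 3) (𝓡 4) ι x u) (n x) = 0 := by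
  rw [k.symm, k.form_normal_tangent]

theorem form_normal_normal (k : HypersurfaceData G ι n) (x : M) : G (ι x) (n x) (n x) = -1 :=
  k.normal.unit x

theorem form_tangent_tangent (x : M) (u v : TangentSpace (𝓡∂ 3) x) :
    G (ι x) (mfderiv (𝓡∂ 3) (𝓡 4) ι x u) (mfderiv (𝓡∂ 3) (𝓡 4) ι x v) =
      pullback (I := 𝓡∂ 3) G ι x u v := rfl

theorem diffAlong_normal_boundary (k : HypersurfaceData G ι n)
    (h : BoundaryData (pullback G ι) j e f) (s : S) :
    DiffAlong (𝓡 2) (fun s => ι (j s)) (fun s => n (j s)) s :=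
  (k.diffAlong_normal (j s)).comp (h.mdifferentiableAt_emb s)

theorem nabla_normal (k : HypersurfaceData G ι n)
    (h : BoundaryData (pullback G ι) j e f) (s : S) (u : TangentSpace (𝓡 2) s) :
    nabla G (fun s => ι (j s)) (fun s => n (j s)) s u =
      nabla G ι n (j s) (mfderiv (𝓡 2) (𝓡∂ 3) j s u) :=
  nabla_comp G (h.mdifferentiableAt_emb s) (k.diffAlong_normal (j s)) u

theorem form_nabla_normal_normal (k : HypersurfaceData G ι n) (x : M)
    (u : TangentSpace (𝓡∂ 3) x) : G (ι x) (nabla G ι n x u) (n x) = 0 := by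
  have h1 := nabla_metric k.symm (k.nondegenerate (ι x)).isInvertible (k.diff (ι x))
    (k.diffAlong_normal x) (k.diffAlong_normal x) u
  simp only [k.form_normal_normal, mvfderiv_const_apply] at h1
  rw [k.symm _ (n x)] at h1
  linarith

theorem form_nabla_tangent (k : HypersurfaceData G ι n)
    (h : BoundaryData (pullback G ι) j e f) {W : ∀ s : S, TangentSpace (𝓡∂ 3) (j s)} {s : S}
    (hW : DiffAlong (𝓡 2) j W s) (u : TangentSpace (𝓡 2) s) (z : TangentSpace (𝓡∂ 3) (j s)) :
    G (ι (j s)) (nabla G (fun s => ι (j s)) (fun s => mfderiv (𝓡∂ 3) (𝓡 4) ι (j s) (W s)) s u)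
      (mfderiv (𝓡∂ 3) (𝓡 4) ι (j s) z) =
      pullback (I := 𝓡∂ 3) G ι (j s) (nabla (pullback G ι) j W s u) z :=
  form_nabla_mfderiv k.symm k.smooth_two (k.nondegenerate _).isInvertible (k.diff _)
    (h.isInvertible _) hW u z

theorem form_nabla_tangent_normal (k : HypersurfaceData G ι n)
    (h : BoundaryData (pullback G ι) j e f) {W : ∀ s : S, TangentSpace (𝓡∂ 3) (j s)} {s : S}
    (hW : DiffAlong (𝓡 2) j W s) (u : TangentSpace (𝓡 2) s) :
    G (ι (j s)) (nabla G (fun s => ι (j s)) (fun s => mfderiv (𝓡∂ 3) (𝓡 4) ι (j s) (W s)) s u)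
      (n (j s)) = -secondForm G ι n (j s) (mfderiv (𝓡 2) (𝓡∂ 3) j s u) (W s) := by
  have h1 := nabla_metric (F := fun s => ι (j s)) k.symm
    (k.nondegenerate (ι (j s))).isInvertible (k.diff (ι (j s))) (hW.mfderiv k.smooth_two) (k.diffAlong_normal_boundary h s) u
  simp only [k.form_tangent_normal, mvfderiv_const_apply] at h1
  rw [k.nabla_normal h, k.symm _ (mfderiv (𝓡∂ 3) (𝓡 4) ι (j s) (W s))] at h1
  exact eq_neg_of_add_eq_zero_left h1.symm

variable {c d : S → ℝ}

theorem diffAlong_boost (k : HypersurfaceData G ι n) (h : BoundaryData (pullback G ι) j e f)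
    {s : S} (hc : MDifferentiableAt (𝓡 2) 𝓘(ℝ, ℝ) c s)
    (hd : MDifferentiableAt (𝓡 2) 𝓘(ℝ, ℝ) d s) :
    DiffAlong (𝓡 2) (fun s => ι (j s))
      (fun s => c s • mfderiv (𝓡∂ 3) (𝓡 4) ι (j s) (e s) + d s • n (j s)) s :=
  (DiffAlong.smul hc ((h.diffAlong_normal s).mfderiv k.smooth_two)).add
    (DiffAlong.smul hd (k.diffAlong_normal_boundary h s))

theorem nabla_boost (k : HypersurfaceData G ι n) (h : BoundaryData (pullback G ι) j e f)
    {s : S} (hc : MDifferentiableAt (𝓡 2) 𝓘(ℝ, ℝ) c s)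
    (hd : MDifferentiableAt (𝓡 2) 𝓘(ℝ, ℝ) d s) (u : TangentSpace (𝓡 2) s) :
    nabla G (fun s => ι (j s))
      (fun s => c s • mfderiv (𝓡∂ 3) (𝓡 4) ι (j s) (e s) + d s • n (j s)) s u =
      (mvfderiv (𝓡 2) c s u • mfderiv (𝓡∂ 3) (𝓡 4) ι (j s) (e s) + c s •
        nabla G (fun s => ι (j s)) (fun s => mfderiv (𝓡∂ 3) (𝓡 4) ι (j s) (e s)) s u)
      + (mvfderiv (𝓡 2) d s u • n (j s)
        + d s • nabla G ι n (j s) (mfderiv (𝓡 2) (𝓡∂ 3) j s u)) := by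
  have h1 := (h.diffAlong_normal s).mfderiv k.smooth_two
  have h2 := k.diffAlong_normal_boundary h s
  rw [nabla_add G (DiffAlong.smul hc h1) (DiffAlong.smul hd h2), nabla_smul G hc h1,
    nabla_smul G hd h2, k.nabla_normal h]

theorem mfderiv_boundary (k : HypersurfaceData G ι n) (h : BoundaryData (pullback G ι) j e f)
    (s : S) (u : TangentSpace (𝓡 2) s) :
    mfderiv (𝓡 2) (𝓡 4) (fun s => ι (j s)) s u =
      mfderiv (𝓡∂ 3) (𝓡 4) ι (j s) (mfderiv (𝓡 2) (𝓡∂ 3) j s u) :=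
  mfderiv_comp_apply s (k.mdifferentiableAt _) (h.mdifferentiableAt_emb s) u

theorem pullback_boundary (k : HypersurfaceData G ι n) (h : BoundaryData (pullback G ι) j e f) :
    pullback (I := 𝓡 2) G (fun s => ι (j s)) =
      pullback (I := 𝓡 2) (pullback (I := 𝓡∂ 3) G ι) j := by
  funext s
  ext u v
  change G _ (mfderiv (𝓡 2) (𝓡 4) (fun s => ι (j s)) s u)
    (mfderiv (𝓡 2) (𝓡 4) (fun s => ι (j s)) s v) = _
  rw [k.mfderiv_boundary h, k.mfderiv_boundary h]
  rfl

theorem form_boost_tangent (k : HypersurfaceData G ι n)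
    (h : BoundaryData (pullback G ι) j e f) (s : S) (u : TangentSpace (𝓡 2) s) :
    G (ι (j s)) (c s • mfderiv (𝓡∂ 3) (𝓡 4) ι (j s) (e s) + d s • n (j s))
      (mfderiv (𝓡 2) (𝓡 4) (fun s => ι (j s)) s u) = 0 := by
  rw [k.mfderiv_boundary h]
  simp only [map_add, map_smul, add_apply, smul_apply, k.form_normal_tangent,
    form_tangent_tangent, h.form_normal_tangent, smul_zero, add_zero]

/-- The derivatives of c and d multiply vectors normal to the surface, so the second fundamental
form is linear in the normal field. -/
theorem meanCurvature_boost (k : HypersurfaceData G ι n)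
    (h : BoundaryData (pullback G ι) j e f)
    {s : S} (hc : MDifferentiableAt (𝓡 2) 𝓘(ℝ, ℝ) c s)
    (hd : MDifferentiableAt (𝓡 2) 𝓘(ℝ, ℝ) d s) :
    meanCurvature (I := 𝓡 2) G (fun s => ι (j s))
      (fun s => c s • mfderiv (𝓡∂ 3) (𝓡 4) ι (j s) (e s) + d s • n (j s)) s =
      c s * meanCurvature (I := 𝓡 2) (pullback (I := 𝓡∂ 3) G ι) j e s
      + d s * mtrace (pullback (I := 𝓡 2) (pullback (I := 𝓡∂ 3) G ι) j) s (fun u v =>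
        secondForm G ι n (j s) (mfderiv (𝓡 2) (𝓡∂ 3) j s u) (mfderiv (𝓡 2) (𝓡∂ 3) j s v)) := by
  unfold meanCurvature
  rw [k.pullback_boundary h, ← mtrace_mul, ← mtrace_mul, ← mtrace_add]
  refine mtrace_congr _ _ fun u v => ?_
  rw [secondForm, ContinuousLinearMap.comp_apply, k.nabla_boost h hc hd, k.mfderiv_boundary h]
  simp only [map_add, map_smul, add_apply, smul_apply, k.form_normal_tangent,
    form_tangent_tangent, h.form_normal_tangent, mul_zero, zero_add, smul_eq_mul,
    k.form_nabla_tangent h (h.diffAlong_normal s)]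
  rfl

theorem form_meanCurvatureVector_boost (k : HypersurfaceData G ι n)
    (h : BoundaryData (pullback G ι) j e f)
    {s : S} (hc : MDifferentiableAt (𝓡 2) 𝓘(ℝ, ℝ) c s)
    (hd : MDifferentiableAt (𝓡 2) 𝓘(ℝ, ℝ) d s) :
    G (ι (j s)) (meanCurvatureVector (I := 𝓡 2) G (fun s => ι (j s)) s)
      (c s • mfderiv (𝓡∂ 3) (𝓡 4) ι (j s) (e s) + d s • n (j s)) =
      -(c s * meanCurvature (I := 𝓡 2) (pullback (I := 𝓡∂ 3) G ι) j e s
      + d s * mtrace (pullback (I := 𝓡 2) (pullback (I := 𝓡∂ 3) G ι) j) s (fun u v =>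
        secondForm G ι n (j s) (mfderiv (𝓡 2) (𝓡∂ 3) j s u)
          (mfderiv (𝓡 2) (𝓡∂ 3) j s v))) := by
  rw [← k.meanCurvature_boost h hc hd]
  exact form_meanCurvatureVector k.symm (k.smooth_two.comp h.emb_two)
    (k.nondegenerate _).isInvertible (k.diff _) (k.diffAlong_boost h hc hd)
    (k.form_boost_tangent h)

/-- The derivatives of the coefficients contribute (sinh² - cosh²) dφ(u). The derivatives of e and n
contribute (sinh² - cosh²) p(u, e), because ⟨∇_u e, n⟩ = -p(u, e). -/
theorem form_nabla_boost (k : HypersurfaceData G ι n)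
    (h : BoundaryData (pullback G ι) j e f) {φ : S → ℝ} {s : S}
    (hφ : MDifferentiableAt (𝓡 2) 𝓘(ℝ, ℝ) φ s) (u : TangentSpace (𝓡 2) s) :
    G (ι (j s)) (nabla G (fun s => ι (j s)) (fun s =>
        Real.cosh (φ s) • mfderiv (𝓡∂ 3) (𝓡 4) ι (j s) (e s) + Real.sinh (φ s) • n (j s)) s u)
      (Real.sinh (φ s) • mfderiv (𝓡∂ 3) (𝓡 4) ι (j s) (e s) + Real.cosh (φ s) • n (j s)) =
      -(mvfderiv (𝓡 2) φ s u
        + secondForm G ι n (j s) (mfderiv (𝓡 2) (𝓡∂ 3) j s u) (e s)) := by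
  have hc : MDifferentiableAt (𝓡 2) 𝓘(ℝ, ℝ) (fun s => Real.cosh (φ s)) s :=
    (Real.hasDerivAt_cosh (φ s)).differentiableAt.comp_mdifferentiableAt hφ
  have hd : MDifferentiableAt (𝓡 2) 𝓘(ℝ, ℝ) (fun s => Real.sinh (φ s)) s :=
    (Real.hasDerivAt_sinh (φ s)).differentiableAt.comp_mdifferentiableAt hφ
  have hp : G (ι (j s)) (nabla G ι n (j s) (mfderiv (𝓡 2) (𝓡∂ 3) j s u))
      (mfderiv (𝓡∂ 3) (𝓡 4) ι (j s) (e s)) =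
      secondForm G ι n (j s) (mfderiv (𝓡 2) (𝓡∂ 3) j s u) (e s) := rfl
  have he : G (ι (j s)) (nabla G (fun s => ι (j s))
      (fun s => mfderiv (𝓡∂ 3) (𝓡 4) ι (j s) (e s)) s u)
      (mfderiv (𝓡∂ 3) (𝓡 4) ι (j s) (e s)) = 0 := by
    rw [k.form_nabla_tangent h (h.diffAlong_normal s), h.form_nabla_normal_normal]
  rw [k.nabla_boost h hc hd, mvfderiv_comp_real (Real.hasDerivAt_cosh _) hφ,
    mvfderiv_comp_real (Real.hasDerivAt_sinh _) hφ]
  simp only [map_add, map_smul, add_apply, smul_apply, k.form_normal_tangent,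
    k.form_tangent_normal, k.form_normal_normal, form_tangent_tangent, h.form_normal_normal,
    smul_eq_mul, he, hp, k.form_nabla_normal_normal,
    k.form_nabla_tangent_normal h (h.diffAlong_normal s)]
  linear_combination (-(mvfderiv (𝓡 2) φ s u
    + secondForm G ι n (j s) (mfderiv (𝓡 2) (𝓡∂ 3) j s u) (e s))) * Real.cosh_sq (φ s)

/-- The Jang graph identity in terms of the spacetime geometry of the boundary surface. -/
theorem graph_identity_spacetime (k : HypersurfaceData G ι n)
    (h : BoundaryData (pullback G ι) j e f) {ν : ∀ s : S, TangentSpace (𝓡∂ 3) (j s)}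
    (hν : IsOutwardUnitNormal (graphMetric (pullback G ι) f) j ν)
    (hJ : JangEquation (pullback G ι) (secondForm G ι n) f) {φ : S → ℝ}
    (hφ : ∀ s, Real.sinh (φ s) = -(mvfderiv (𝓡∂ 3) f (j s) (e s)) / √(1 + normSqGrad
      (pullback (I := 𝓡 2) (pullback (I := 𝓡∂ 3) G ι) j) (fun s => f (j s)) s)) (s : S) :
    meanCurvature (I := 𝓡 2) (graphMetric (pullback G ι) f) j ν s
        - graphMetric (pullback G ι) f (j s)
          (schoenYauField (pullback G ι) (secondForm G ι n) f (j s)) (ν s) =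
      -(G (ι (j s)) (meanCurvatureVector (I := 𝓡 2) G (fun s => ι (j s)) s)
        (Real.cosh (φ s) • mfderiv (𝓡∂ 3) (𝓡 4) ι (j s) (e s) + Real.sinh (φ s) • n (j s)))
      - 1 / √(1 + normSqGrad (pullback (I := 𝓡 2) (pullback (I := 𝓡∂ 3) G ι) j)
          (fun s => f (j s)) s) *
        G (ι (j s)) (nabla G (fun s => ι (j s)) (fun s =>
          Real.cosh (φ s) • mfderiv (𝓡∂ 3) (𝓡 4) ι (j s) (e s) + Real.sinh (φ s) • n (j s)) s
          (grad (pullback (I := 𝓡 2) (pullback (I := 𝓡∂ 3) G ι) j) (fun s => f (j s)) s))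
        (Real.sinh (φ s) • mfderiv (𝓡∂ 3) (𝓡 4) ι (j s) (e s)
          + Real.cosh (φ s) • n (j s)) := by
  have hφd := mdifferentiableAt_boost (h.mdifferentiableAt_normalDeriv s)
    (h.mdifferentiableAt_normSqGrad s) (h.normSqGrad_nonneg s) hφ
  rw [h.graph_identity hν (isLinearMap_secondForm G ι n (j s)) hJ hφ, k.form_nabla_boost h hφd,
    k.form_meanCurvatureVector_boost h (c := fun s => Real.cosh (φ s))
      (d := fun s => Real.sinh (φ s))
      ((Real.hasDerivAt_cosh (φ s)).differentiableAt.comp_mdifferentiableAt hφd)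
      ((Real.hasDerivAt_sinh (φ s)).differentiableAt.comp_mdifferentiableAt hφd)]
  ring

end HypersurfaceData

end Hypersurface

/-! ### Flat spaces: constant metrics and parallel constant fields. -/

section ConstantForm

variable {E : Type*} [NormedAddCommGroup E] [NormedSpace ℝ E]
  {H : Type*} [TopologicalSpace H] {I : ModelWithCorners ℝ E H}
  {A : Type*} [TopologicalSpace A] [ChartedSpace H A] [IsManifold I 1 A]
  {E' : Type*} [NormedAddCommGroup E'] [NormedSpace ℝ E']
  {G : FormField 𝓘(ℝ, E') E'} {b : E' →L[ℝ] E' →L[ℝ] ℝ}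

theorem coordForm_const (hG : ∀ x, G x = b) (x : E') : coordForm G x = fun _ => b := by
  funext y
  unfold coordForm
  rw [TangentBundle.symmL_model_space, hG]
  rfl

theorem formDiffAt_const (hG : ∀ x, G x = b) (x : E') : FormDiffAt G x := by
  unfold FormDiffAt
  rw [coordForm_const hG]
  exact mdifferentiableAt_const

theorem christoffel_const (hG : ∀ x, G x = b) (x : E') (u v : TangentSpace 𝓘(ℝ, E') x) :
    christoffel G x u v = 0 := by
  have h : ∀ w : TangentSpace 𝓘(ℝ, E') x, coordFormDeriv G x (comps x w) = 0 := by
    intro w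
    rw [coordFormDeriv_comps, coordForm_const hG, mvfderiv_const_apply]
  have h2 : (coordFormDeriv G x).flip (comps x u) = 0 := by
    ext a c
    have := h (ofChart x x a)
    rw [comps_ofChart] at this
    rw [ContinuousLinearMap.flip_apply, this]
    rfl
  unfold christoffel
  rw [h, h, h2]
  simp

/-- The constant vector field `v`. -/
def constField (v x : E') : TangentSpace 𝓘(ℝ, E') x := v

theorem coordAlong_const (F : A → E') (v : E') (a : A) :
    coordAlong 𝓘(ℝ, E') F (fun y => constField v (F y)) a = fun _ => v := by
  funext y
  refine (trivializationAt_snd (I := 𝓘(ℝ, E')) (Set.mem_univ _) _).trans ?_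
  unfold toChart
  rw [TangentBundle.continuousLinearMapAt_model_space]
  rfl

theorem diffAlong_const {F : A → E'} {a : A} (hF : MDifferentiableAt I 𝓘(ℝ, E') F a) (v : E') :
    DiffAlong I F (fun y => constField v (F y)) a := by
  refine diffAlong_iff.2 ⟨hF, ?_⟩
  rw [coordAlong_const]
  exact mdifferentiableAt_const

theorem nabla_const (hG : ∀ x, G x = b) (F : A → E') (v : E') (a : A) (u : TangentSpace I a) :
    nabla G F (fun y => constField v (F y)) a u = 0 := by
  rw [comps_nabla, coordAlong_const, christoffel_const hG, mvfderiv_const_apply, map_zero,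
    add_zero]

end ConstantForm

/-! ### Hypersurfaces of Minkowski space and their time function. -/

section Minkowski

/-- The time coordinate as a linear map. -/
def timeL : EuclideanSpace ℝ (Fin 4) →L[ℝ] ℝ := EuclideanSpace.proj (0 : Fin 4)

/-- The projection along the time axis as a linear map. -/
def spatialL : EuclideanSpace ℝ (Fin 4) →L[ℝ] EuclideanSpace ℝ (Fin 3) :=
  LinearMap.toContinuousLinearMap
    { toFun := spatial
      map_add' := fun _ _ => rfl
      map_smul' := fun _ _ => rfl }

theorem minkowski_apply (x u v : EuclideanSpace ℝ (Fin 4)) :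
    minkowski x u v = inner ℝ (spatialL u) (spatialL v) - timeL u * timeL v := by
  have h1 : minkowski x u v = inner ℝ u v - 2 * (u 0 * v 0) := rfl
  have h2 : (inner ℝ (spatialL u) (spatialL v) : ℝ) = ∑ i : Fin 3, v i.succ * u i.succ := rfl
  have h3 : (inner ℝ u v : ℝ) = ∑ i : Fin 4, v i * u i := rfl
  have h4 : ∀ w, timeL w = w 0 := fun _ => rfl
  rw [h1, h2, h3, h4, h4, Fin.sum_univ_succ]
  ring

theorem minkowski_symm (x : EuclideanSpace ℝ (Fin 4)) (u v : TangentSpace (𝓡 4) x) :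
    minkowski x u v = minkowski x v u := by
  refine (minkowski_apply x u v).trans (Eq.trans ?_ (minkowski_apply x v u).symm)
  rw [real_inner_comm, mul_comm (timeL u)]

theorem minkowski_nondegenerate (x : EuclideanSpace ℝ (Fin 4)) :
    Nondegenerate (I := 𝓡 4) minkowski x := by
  intro (u : EuclideanSpace ℝ (Fin 4)) hu
  -- The test vector is u with its time component reversed; its Minkowski product with u is the
  -- Euclidean norm squared of u.
  have h1 : minkowski x u (u - (2 * u 0) • EuclideanSpace.single 0 1) =
      (inner ℝ u (u - (2 * u 0) • EuclideanSpace.single 0 1) : ℝ) - 2 * (u 0 *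
        (u - (2 * u 0) • EuclideanSpace.single 0 1 : EuclideanSpace ℝ (Fin 4)) 0) := rfl
  have h2 := h1.symm.trans (hu _)
  rw [inner_sub_right, inner_smul_right, EuclideanSpace.inner_single_right] at h2
  simp only [PiLp.sub_apply, PiLp.smul_apply, PiLp.single_apply, if_true, smul_eq_mul,
    conj_trivial] at h2
  have h3 : (inner ℝ u u : ℝ) = 0 := by linear_combination h2
  exact inner_self_eq_zero.1 h3

theorem euclidean_symm (x : EuclideanSpace ℝ (Fin 3)) (u v : TangentSpace (𝓡 3) x) :
    euclidean x u v = euclidean x v u :=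
  real_inner_comm (F := EuclideanSpace ℝ (Fin 3)) _ _

theorem euclidean_nondegenerate (x : EuclideanSpace ℝ (Fin 3)) :
    Nondegenerate (I := 𝓡 3) euclidean x :=
  fun (u : EuclideanSpace ℝ (Fin 3)) hu => inner_self_eq_zero (𝕜 := ℝ).1 (hu u)

/-- The unit vector field along the time axis. -/
def timeVector (x : EuclideanSpace ℝ (Fin 4)) : TangentSpace (𝓡 4) x :=
  constField (EuclideanSpace.single 0 1) x

theorem coordField_single_eq_timeVector (x : EuclideanSpace ℝ (Fin 4)) :
    coordField (I := 𝓡 4) x (EuclideanSpace.single 0 1) x = timeVector x :=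
  coordField_self x (timeVector x)

theorem minkowski_timeVector (x : EuclideanSpace ℝ (Fin 4)) (u : TangentSpace (𝓡 4) x) :
    minkowski x (timeVector x) u = -timeL u := by
  have h : spatialL (timeVector x) = 0 := by
    ext i
    change (EuclideanSpace.single (0 : Fin 4) (1 : ℝ)) i.succ = 0
    simp
  have h' : timeL (timeVector x) = 1 := by
    change (EuclideanSpace.single (0 : Fin 4) (1 : ℝ)) 0 = 1
    simp
  refine (minkowski_apply x (timeVector x) u).trans ?_
  rw [h, h', inner_zero_left]
  ring

variable {M : Type*} [TopologicalSpace M] [ChartedSpace (EuclideanHalfSpace 3) M]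
  [IsManifold (𝓡∂ 3) ∞ M]
  {S : Type*} [TopologicalSpace S] [ChartedSpace (EuclideanSpace ℝ (Fin 2)) S]
  [IsManifold (𝓡 2) ∞ S]
  {X : M → EuclideanSpace ℝ (Fin 4)} {n : ∀ x : M, TangentSpace (𝓡 4) (X x)}
  {j : S → M} {e : ∀ s : S, TangentSpace (𝓡∂ 3) (j s)} {f : M → ℝ}
  {ν : ∀ s : S, TangentSpace (𝓡∂ 3) (j s)}

theorem hypersurfaceData_minkowski (hX : ContMDiff (𝓡∂ 3) (𝓡 4) ∞ X)
    (hn : IsUnitNormal (𝓡∂ 3) minkowski X n (-1)) : HypersurfaceData minkowski X n where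
  symm := minkowski_symm
  nondegenerate := minkowski_nondegenerate
  diff := formDiffAt_const (G := minkowski) fun _ => rfl
  smooth := hX
  normal := hn

namespace HypersurfaceData

theorem mvfderiv_time (k : HypersurfaceData minkowski X n) (hf : ∀ x, f x = X x 0) (x : M)
    (u : TangentSpace (𝓡∂ 3) x) :
    mvfderiv (𝓡∂ 3) f x u =
      timeL (mfderiv (𝓡∂ 3) (𝓡 4) X x u) := by
  have e1 : f = fun x => timeL (X x) :=
    funext hf
  have h1 := timeL.hasFDerivAt (x := X x)
  rw [e1, mvfderiv_chain (I := 𝓡 4) (h := timeL)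
    h1.hasMFDerivAt.mdifferentiableAt (k.mdifferentiableAt x),
    mvfderiv_eq_of_hasMFDerivAt (I := 𝓡 4) h1.hasMFDerivAt]
  rfl

theorem form_timeVector_tangent (k : HypersurfaceData minkowski X n) (hf : ∀ x, f x = X x 0)
    (x : M) (u : TangentSpace (𝓡∂ 3) x) :
    minkowski (X x) (timeVector (X x)) (mfderiv (𝓡∂ 3) (𝓡 4) X x u) = -mvfderiv (𝓡∂ 3) f x u := by
  rw [k.mvfderiv_time hf, minkowski_timeVector]

theorem mfderiv_injective {N : Type*} [TopologicalSpace N]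
    [ChartedSpace (EuclideanSpace ℝ (Fin 4)) N] [IsManifold (𝓡 4) ∞ N] {G : FormField (𝓡 4) N}
    {ι : M → N} (h : BoundaryData (pullback G ι) j e f) (x : M) :
    Function.Injective (mfderiv (𝓡∂ 3) (𝓡 4) ι x) := by
  refine (injective_iff_map_eq_zero _).2 fun v hv => ?_
  by_contra hne
  have h1 := h.pos x v hne
  have h2 : pullback (I := 𝓡∂ 3) G ι x v v =
    G (ι x) (mfderiv (𝓡∂ 3) (𝓡 4) ι x v) (mfderiv (𝓡∂ 3) (𝓡 4) ι x v) := rfl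
  rw [h2, hv, map_zero] at h1
  exact lt_irrefl _ h1

/-- Since ⟨∂_t, dX(z)⟩ = -df(z), the vector dX(Df) + ∂_t is normal to the hypersurface; pairing with
n gives its coefficient. -/
theorem mfderiv_grad_time (k : HypersurfaceData minkowski X n)
    (h : BoundaryData (pullback minkowski X) j e f) (hf : ∀ x, f x = X x 0) (x : M) :
    mfderiv (𝓡∂ 3) (𝓡 4) X x (grad (pullback minkowski X) f x) =
      (-minkowski (X x) (timeVector (X x)) (n x)) • n x + -timeVector (X x) := by
  have hdim : Module.finrank ℝ (TangentSpace (𝓡∂ 3) x) + 1 =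
      Module.finrank ℝ (TangentSpace (𝓡 4) (X x)) := by
    change Module.finrank ℝ (EuclideanSpace ℝ (Fin 3)) + _ =
      Module.finrank ℝ (EuclideanSpace ℝ (Fin 4))
    simp
  obtain ⟨u, c, hv⟩ := exists_eq_map_add_smul hdim
    (D := (mfderiv (𝓡∂ 3) (𝓡 4) X x).toLinearMap) (mfderiv_injective h x) (e := n x)
    (α := (minkowski (X x) (n x)).toLinearMap)
    (by rw [ContinuousLinearMap.coe_coe, k.form_normal_normal]; norm_num)
    (k.form_normal_tangent x) (mfderiv (𝓡∂ 3) (𝓡 4) X x (grad (pullback minkowski X) f x) + timeVector (X x))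
  rw [ContinuousLinearMap.coe_coe] at hv
  have hu : u = 0 := by
    refine nondegenerate_of_pos (h.pos x) u fun z => ?_
    have h1 := congrArg (fun w => minkowski (X x) w (mfderiv (𝓡∂ 3) (𝓡 4) X x z)) hv
    simp only [map_add, map_smul, add_apply, smul_apply, k.form_normal_tangent,
      form_tangent_tangent, h.form_grad] at h1
    rw [k.form_timeVector_tangent hf, add_neg_cancel, smul_zero, add_zero] at h1
    exact h1.symm
  rw [hu, map_zero, zero_add] at hv
  have h3 := congrArg (minkowski (X x) (n x)) hv
  rw [map_add, k.form_normal_tangent, zero_add, map_smul, k.form_normal_normal,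
    minkowski_symm] at h3
  have h4 : c = -minkowski (X x) (timeVector (X x)) (n x) := by
    rw [h3]
    simp
  rw [h4] at hv
  exact eq_sub_of_add_eq hv |>.trans (sub_eq_add_neg _ _)

/-- Pairing the formula for dX(Df) with ∂_t gives 1 + |Df|² = ⟨∂_t, n⟩², and n being future directed
selects the root. -/
theorem sqrt_time (k : HypersurfaceData minkowski X n)
    (h : BoundaryData (pullback minkowski X) j e f) (hf : ∀ x, f x = X x 0) {x : M}
    (hfut : minkowski (X x) (timeVector (X x)) (n x) < 0) :
    √(1 + normSqGrad (pullback (I := 𝓡∂ 3) minkowski X) f x) = -minkowski (X x) (timeVector (X x)) (n x) := by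
  have h1 := congrArg (minkowski (X x) (timeVector (X x))) (k.mfderiv_grad_time h hf x)
  have h2 : timeL (timeVector (X x)) = 1 := by
    change (EuclideanSpace.single (0 : Fin 4) (1 : ℝ)) 0 = 1
    simp
  rw [k.form_timeVector_tangent hf, ← h.form_grad, map_add, map_smul, map_neg,
    minkowski_timeVector _ (timeVector (X x)), h2, smul_eq_mul] at h1
  rw [Real.sqrt_eq_iff_mul_self_eq_of_pos (neg_pos.2 hfut), normSqGrad]
  linear_combination h1

/-- Differentiate dX(Df) = w n - ∂_t and keep the tangential part: ∂_t is parallel and the term dw ·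
n is normal. Hence the tensor in Jang's equation vanishes identically. -/
theorem hess_time (k : HypersurfaceData minkowski X n)
    (h : BoundaryData (pullback minkowski X) j e f) (hf : ∀ x, f x = X x 0) {x : M}
    (hfut : minkowski (X x) (timeVector (X x)) (n x) < 0) (u v : TangentSpace (𝓡∂ 3) x) :
    hess (pullback (I := 𝓡∂ 3) minkowski X) f x u v = √(1 + normSqGrad (pullback (I := 𝓡∂ 3) minkowski X) f x) *
      secondForm minkowski X n x u v := by
  have hgr : DiffAlong (𝓡∂ 3) (fun y : M => y) (grad (pullback minkowski X) f) x :=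
    diffAlong_grad (fun y => nondegenerate_of_pos (h.pos y)) (h.diff x) h.smooth_two
  have hcn := diffAlong_const (k.mdifferentiableAt x) (EuclideanSpace.single (0 : Fin 4) (1 : ℝ))
  have hcn' := diffAlong_const (k.mdifferentiableAt x) (-EuclideanSpace.single (0 : Fin 4) (1 : ℝ))
  have hc : MDifferentiableAt (𝓡∂ 3) 𝓘(ℝ, ℝ) (fun x => -minkowski (X x) (timeVector (X x)) (n x)) x :=
    (mdifferentiableAt_form (k.diff _) hcn (k.diffAlong_normal x)).neg
  have h1 := form_nabla_mfderiv k.symm k.smooth_two (j := fun y : M => y)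
    (k.nondegenerate _).isInvertible (k.diff _) (h.isInvertible x) hgr u v
  refine h1.symm.trans ?_
  have he : ∀ᶠ y in nhds x, mfderiv (𝓡∂ 3) (𝓡 4) X y (grad (pullback minkowski X) f y) =
      (-minkowski (X y) (timeVector (X y)) (n y)) • n y
        + constField (-EuclideanSpace.single (0 : Fin 4) (1 : ℝ)) (X y) :=
    Filter.Eventually.of_forall (k.mfderiv_grad_time h hf)
  rw [k.sqrt_time h hf hfut, nabla_congr (F := X) minkowski he u,
    nabla_add _ (DiffAlong.smul hc (k.diffAlong_normal x)) hcn',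
    nabla_smul _ hc (k.diffAlong_normal x), nabla_const (G := minkowski) (b := minkowski 0) fun _ => rfl]
  simp only [map_add, map_smul, add_apply, smul_apply, k.form_normal_tangent, smul_zero,
    zero_add, add_zero]
  rfl

end HypersurfaceData

end Minkowski

/-! ### Local isometries from M to ℝ³, and consequences of Hess f = w p. -/

section Projection

variable {M : Type*} [TopologicalSpace M] [ChartedSpace (EuclideanHalfSpace 3) M]
  [IsManifold (𝓡∂ 3) ∞ M]
  {S : Type*} [TopologicalSpace S] [ChartedSpace (EuclideanSpace ℝ (Fin 2)) S]
  [IsManifold (𝓡 2) ∞ S]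
  {g : FormField (𝓡∂ 3) M} {p : ∀ x : M, TangentSpace (𝓡∂ 3) x → TangentSpace (𝓡∂ 3) x →L[ℝ] ℝ}
  {j : S → M} {e : ∀ s : S, TangentSpace (𝓡∂ 3) (j s)} {f : M → ℝ}
  {ν : ∀ s : S, TangentSpace (𝓡∂ 3) (j s)} {Y : M → EuclideanSpace ℝ (Fin 3)}
  {n' : ∀ s : S, TangentSpace (𝓡 3) (Y (j s))}

namespace BoundaryData

/-- Regards the graph as a Riemannian manifold with boundary in its own right, so that the lemmas on
local isometries apply to the graph metric and ν. -/
theorem graph (h : BoundaryData g j e f) (hν : IsOutwardUnitNormal (graphMetric g f) j ν) :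
    BoundaryData (graphMetric g f) j ν f where
  symm := graphMetric_symm h.symm f
  pos := fun x => graphMetric_pos (h.pos x) f
  diff := fun x => formDiffAt_graphMetric (h.diff x) h.smooth_two
  emb := h.emb
  normal := hν
  smooth := h.smooth

theorem form_mfderiv_isometry (hY : pullback (I := 𝓡∂ 3) euclidean Y = g) (x : M)
    (u v : TangentSpace (𝓡∂ 3) x) :
    euclidean (Y x) (mfderiv (𝓡∂ 3) (𝓡 3) Y x u) (mfderiv (𝓡∂ 3) (𝓡 3) Y x v) = g x u v := by
  rw [← hY]
  rfl

theorem mfderiv_surjective (h : BoundaryData g j e f)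
    (hY : pullback (I := 𝓡∂ 3) euclidean Y = g) (x : M) :
    Function.Surjective (mfderiv (𝓡∂ 3) (𝓡 3) Y x) := by
  have hinj : Function.Injective (mfderiv (𝓡∂ 3) (𝓡 3) Y x).toLinearMap := by
    refine (injective_iff_map_eq_zero _).2 fun v hv => ?_
    rw [ContinuousLinearMap.coe_coe] at hv
    refine nondegenerate_of_pos (h.pos x) v fun z => ?_
    rw [← form_mfderiv_isometry hY, hv, map_zero]
    rfl
  exact (LinearMap.injective_iff_surjective_of_finrank_eq_finrank rfl).1 hinj

/-- The differential of Y is a linear isometry, so the unit normal is determined up to sign. The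
sign can be tested on any w with g(e, w) > 0, not only on e itself. -/
theorem isometry_normal_eq (h : BoundaryData g j e f)
    (hY : pullback (I := 𝓡∂ 3) euclidean Y = g) (hYs : ContMDiff (𝓡∂ 3) (𝓡 3) 2 Y)
    (hn : IsUnitNormal (𝓡 2) euclidean (fun s => Y (j s)) n' 1) {s : S}
    {w : TangentSpace (𝓡∂ 3) (j s)} (hw : 0 < g (j s) (e s) w)
    (hpos : 0 < euclidean (Y (j s)) (n' s) (mfderiv (𝓡∂ 3) (𝓡 3) Y (j s) w)) :
    n' s = mfderiv (𝓡∂ 3) (𝓡 3) Y (j s) (e s) := by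
  obtain ⟨m, hm⟩ := h.mfderiv_surjective hY (j s) (n' s)
  have h1 := h.eq_smul_normal s (v := m) fun u => by
    have h2 : mfderiv (𝓡 2) (𝓡 3) (fun s => Y (j s)) s u =
        mfderiv (𝓡∂ 3) (𝓡 3) Y (j s) (mfderiv (𝓡 2) (𝓡∂ 3) j s u) :=
      mfderiv_comp_apply s ((hYs (j s)).mdifferentiableAt (by simp)) (h.mdifferentiableAt_emb s) u
    rw [← form_mfderiv_isometry hY, hm, ← h2]
    exact hn.normal s u
  set c := g (j s) m (e s)
  have h3 : c * c = 1 := by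
    have h4 := form_mfderiv_isometry hY (j s) m m
    have h5 := hn.unit s
    rw [hm, h5, h1] at h4
    simp only [map_smul, smul_apply, smul_eq_mul, h.form_normal_normal] at h4
    linear_combination -h4
  rw [← hm, form_mfderiv_isometry hY, h1, map_smul, smul_apply, smul_eq_mul] at hpos
  have hc : 0 < c := pos_of_mul_pos_left hpos hw.le
  have hc1 : c = 1 := by nlinarith
  rw [hc1, one_smul] at h1
  rw [← hm, h1]

theorem meanCurvature_isometry (h : BoundaryData g j e f)
    (hY : pullback (I := 𝓡∂ 3) euclidean Y = g) (hYs : ContMDiff (𝓡∂ 3) (𝓡 3) 2 Y) (s : S) :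
    meanCurvature (I := 𝓡 2) euclidean (fun s => Y (j s))
      (fun s => mfderiv (𝓡∂ 3) (𝓡 3) Y (j s) (e s)) s = meanCurvature (I := 𝓡 2) g j e s := by
  have hd : ∀ s u, mfderiv (𝓡 2) (𝓡 3) (fun s => Y (j s)) s u =
      mfderiv (𝓡∂ 3) (𝓡 3) Y (j s) (mfderiv (𝓡 2) (𝓡∂ 3) j s u) := fun s u =>
    mfderiv_comp_apply s ((hYs (j s)).mdifferentiableAt (by simp)) (h.mdifferentiableAt_emb s) u
  have hp : pullback (I := 𝓡 2) euclidean (fun s => Y (j s)) = pullback (I := 𝓡 2) g j := by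
    funext s
    ext u v
    change euclidean _ (mfderiv (𝓡 2) (𝓡 3) (fun s => Y (j s)) s u)
      (mfderiv (𝓡 2) (𝓡 3) (fun s => Y (j s)) s v) = _
    rw [hd, hd, form_mfderiv_isometry hY]
    rfl
  unfold meanCurvature
  rw [hp]
  refine mtrace_congr _ _ fun u v => ?_
  rw [secondForm, ContinuousLinearMap.comp_apply, hd]
  have h1 := form_nabla_mfderiv (G := euclidean) euclidean_symm hYs (s := s)
    (euclidean_nondegenerate _).isInvertible
    (formDiffAt_const (G := euclidean) (b := euclidean 0) (fun _ => rfl) _)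
    (by rw [hY]; exact h.isInvertible _) (h.diffAlong_normal s) u (mfderiv (𝓡 2) (𝓡∂ 3) j s v)
  rw [hY] at h1
  exact h1

/-- If the tensor of Jang's equation vanishes, then so does the Schoen-Yau vector field. -/
theorem form_schoenYauField_of_hess (h : BoundaryData g j e f)
    (hh : ∀ x u v, hess g f x u v = √(1 + normSqGrad g f x) * p x u v) (s : S)
    (v : TangentSpace (𝓡∂ 3) (j s)) :
    graphMetric g f (j s) (schoenYauField g p f (j s)) v = 0 := by
  have hw := (Real.sqrt_pos.2 (h.one_add_normSqGrad_pos s)).ne'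
  rw [h.form_schoenYauField, jangTensor_apply, hh]
  field_simp
  ring

/-- `laplacian_boundary` becomes Δτ = w tr p - e(f) h, with h the mean curvature of the boundary in
M; division by W turns the coefficients into cosh φ and sinh φ. -/
theorem laplacian_of_hess (h : BoundaryData g j e f)
    (hh : ∀ x u v, hess g f x u v = √(1 + normSqGrad g f x) * p x u v) {φ : S → ℝ}
    (hφ : ∀ s, Real.sinh (φ s) = -(mvfderiv (𝓡∂ 3) f (j s) (e s)) /
      √(1 + normSqGrad (pullback (I := 𝓡 2) g j) (fun s => f (j s)) s)) (s : S) :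
    laplacian (pullback (I := 𝓡 2) g j) (fun s => f (j s)) s /
      √(1 + normSqGrad (pullback (I := 𝓡 2) g j) (fun s => f (j s)) s) =
      Real.sinh (φ s) * meanCurvature (I := 𝓡 2) g j e s
      + Real.cosh (φ s) * mtrace (pullback (I := 𝓡 2) g j) s (fun u v =>
        p (j s) (mfderiv (𝓡 2) (𝓡∂ 3) j s u) (mfderiv (𝓡 2) (𝓡∂ 3) j s v)) := by
  have hW := (h.sqrt_boundary_pos s).ne'
  rw [h.laplacian_boundary, mtrace_congr _ _ (fun u v => hh _ _ _), mtrace_mul,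
    ← h.cosh_mul_sqrt hφ, hφ]
  field_simp
  ring

end BoundaryData

end Projection

/-! ### The spatial projection induces the graph metric. -/

section MinkowskiProjection

variable {M : Type*} [TopologicalSpace M] [ChartedSpace (EuclideanHalfSpace 3) M]
  [IsManifold (𝓡∂ 3) ∞ M] {X : M → EuclideanSpace ℝ (Fin 4)}
  {n : ∀ x : M, TangentSpace (𝓡 4) (X x)} {f : M → ℝ}

theorem contMDiff_spatial {m : WithTop ℕ∞} (hX : ContMDiff (𝓡∂ 3) (𝓡 4) m X) :
    ContMDiff (𝓡∂ 3) (𝓡 3) m (fun x => spatial (X x)) :=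
  spatialL.contDiff.contMDiff.comp hX

theorem mfderiv_spatial {x : M} (hX : MDifferentiableAt (𝓡∂ 3) (𝓡 4) X x)
    (u : TangentSpace (𝓡∂ 3) x) :
    mfderiv (𝓡∂ 3) (𝓡 3) (fun x => spatial (X x)) x u =
      spatialL (mfderiv (𝓡∂ 3) (𝓡 4) X x u) := by
  have h1 := (spatialL.hasFDerivAt (x := X x)).hasMFDerivAt.comp x hX.hasMFDerivAt
  have h2 : mfderiv (𝓡∂ 3) (𝓡 3) (fun x => spatial (X x)) x = _ := h1.mfderiv
  rw [h2]
  rfl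

theorem HypersurfaceData.pullback_spatial (k : HypersurfaceData minkowski X n)
    (hf : ∀ x, f x = X x 0) :
    pullback (I := 𝓡∂ 3) euclidean (fun x => spatial (X x)) =
      graphMetric (pullback (I := 𝓡∂ 3) minkowski X) f := by
  funext x
  ext u v
  change euclidean _ (mfderiv (𝓡∂ 3) (𝓡 3) (fun x => spatial (X x)) x u)
    (mfderiv (𝓡∂ 3) (𝓡 3) (fun x => spatial (X x)) x v) =
    minkowski (X x) (mfderiv (𝓡∂ 3) (𝓡 4) X x u) (mfderiv (𝓡∂ 3) (𝓡 4) X x v)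
      + mvfderiv (𝓡∂ 3) f x u * mvfderiv (𝓡∂ 3) f x v
  rw [mfderiv_spatial (k.mdifferentiableAt x), mfderiv_spatial (k.mdifferentiableAt x),
    k.mvfderiv_time hf, k.mvfderiv_time hf]
  refine Eq.trans ?_ (congrArg (· + _) (minkowski_apply (X x) (mfderiv (𝓡∂ 3) (𝓡 4) X x u)
    (mfderiv (𝓡∂ 3) (𝓡 4) X x v)).symm)
  exact (sub_add_cancel _ _).symm

end MinkowskiProjection

end QuasiLocal

end

/-! ### The Jang graph identity, the canonical gauge and the conservation law. -/

theorem mainTheorem5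
    -- the spacetime `N`
    {N : Type*} [TopologicalSpace N] [ChartedSpace (EuclideanSpace ℝ (Fin 4)) N]
    [IsManifold (𝓡 4) ∞ N] (G : LorentzMetric N) (T : TimeOrientation G)
    -- the spacelike hypersurface `M`, with boundary, and its future unit normal `e₄`
    {M : Type*} [TopologicalSpace M] [ChartedSpace (EuclideanHalfSpace 3) M]
    [IsManifold (𝓡∂ 3) ∞ M] (ι : M → N) (hι : ContMDiff (𝓡∂ 3) (𝓡 4) ∞ ι)
    (g : FormField (𝓡∂ 3) M) (hg : g = pullback G.form ι)
    (hspace : ∀ (x : M) (v : TangentSpace (𝓡∂ 3) x), v ≠ 0 → 0 < g x v v)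
    (e₄ : ∀ x : M, TangentSpace (𝓡 4) (ι x)) (he₄ : IsUnitNormal (𝓡∂ 3) G.form ι e₄ (-1))
    (he₄_future : ∀ x, G.form (ι x) (e₄ x) (T.field (ι x)) < 0)
    (p : ∀ x : M, TangentSpace (𝓡∂ 3) x → TangentSpace (𝓡∂ 3) x →L[ℝ] ℝ)
    (hp : p = secondForm G.form ι e₄)
    -- the boundary surface `Σ` and its outward unit normal `e₃` in `M`
    {S : Type*} [TopologicalSpace S] [ChartedSpace (EuclideanSpace ℝ (Fin 2)) S]
    [IsManifold (𝓡 2) ∞ S] (j : S → M) (hj : IsBoundaryEmbedding j)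
    (e₃ : ∀ s : S, TangentSpace (𝓡∂ 3) (j s)) (he₃ : IsOutwardUnitNormal g j e₃)
    (σ : FormField (𝓡 2) S) (hσ : σ = pullback g j)
    -- the solution of Jang's equation with boundary data `τ`
    (τ : S → ℝ) (f : M → ℝ) (hf : ContMDiff (𝓡∂ 3) 𝓘(ℝ, ℝ) ∞ f)
    (hfτ : ∀ s, f (j s) = τ s) (hJang : JangEquation g p f)
    -- the outward unit normal of the boundary of the graph
    (ν : ∀ s : S, TangentSpace (𝓡∂ 3) (j s))
    (hν : IsOutwardUnitNormal (graphMetric g f) j ν)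
    -- the boosted frame
    (φ : S → ℝ)
    (hφ : ∀ s, Real.sinh (φ s) =
      -(mvfderiv (𝓡∂ 3) f (j s) (e₃ s)) / √(1 + normSqGrad σ τ s))
    (e₃' e₄' : ∀ s : S, TangentSpace (𝓡 4) (ι (j s)))
    (he₃' : ∀ s, e₃' s = Real.cosh (φ s) • mfderiv (𝓡∂ 3) (𝓡 4) ι (j s) (e₃ s)
      + Real.sinh (φ s) • e₄ (j s))
    (he₄' : ∀ s, e₄' s = Real.sinh (φ s) • mfderiv (𝓡∂ 3) (𝓡 4) ι (j s) (e₃ s)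
      + Real.cosh (φ s) • e₄ (j s)) :
    (∀ s : S,
      meanCurvature (I := 𝓡 2) (graphMetric g f) j ν s
          - graphMetric g f (j s) (schoenYauField g p f (j s)) (ν s)
        = -(G.form (ι (j s)) (meanCurvatureVector (I := 𝓡 2) G.form (fun s => ι (j s)) s)
            (e₃' s))
          - 1 / √(1 + normSqGrad σ τ s) *
            G.form (ι (j s))
              (nabla (I := 𝓡 2) G.form (fun s => ι (j s)) e₃' s (grad σ τ s)) (e₄' s))
    ∧
    -- Minkowskian data: `(M, g, p)` is the data of a spacelike hypersurface `X : M → ℝ^{3,1}`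
    -- with time function `f`
    (∀ X : M → EuclideanSpace ℝ (Fin 4), ContMDiff (𝓡∂ 3) (𝓡 4) ∞ X →
      pullback minkowski X = g →
      ∀ n : ∀ x : M, TangentSpace (𝓡 4) (X x), IsUnitNormal (𝓡∂ 3) minkowski X n (-1) →
      (∀ x, minkowski (X x) (n x) (coordField (X x) (EuclideanSpace.single 0 1) (X x)) < 0) →
      secondForm minkowski X n = p →
      (∀ x, f x = X x 0) →
      -- the outward unit normal of the projection of the surface to `ℝ³`
      ∀ n' : ∀ s : S, TangentSpace (𝓡 3) (spatial (X (j s))),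
      IsUnitNormal (𝓡 2) euclidean (fun s => spatial (X (j s))) n' 1 →
      (∀ s, 0 < euclidean (spatial (X (j s))) (n' s)
        (mfderiv (𝓡∂ 3) (𝓡 3) (fun x => spatial (X x)) (j s) (e₃ s))) →
      ∀ s : S,
        meanCurvature (I := 𝓡 2) (graphMetric g f) j ν s
            - graphMetric g f (j s) (schoenYauField g p f (j s)) (ν s)
          = meanCurvature (I := 𝓡 2) euclidean (fun s => spatial (X (j s))) n' s
        ∧ G.form (ι (j s)) (meanCurvatureVector (I := 𝓡 2) G.form (fun s => ι (j s)) s) (e₄' s)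
          = -(laplacian σ τ s) / √(1 + normSqGrad σ τ s)
        ∧ meanCurvature (I := 𝓡 2) euclidean (fun s => spatial (X (j s))) n' s
          = -(G.form (ι (j s)) (meanCurvatureVector (I := 𝓡 2) G.form (fun s => ι (j s)) s)
              (e₃' s))
            - 1 / √(1 + normSqGrad σ τ s) *
              G.form (ι (j s))
                (nabla (I := 𝓡 2) G.form (fun s => ι (j s)) e₃' s (grad σ τ s)) (e₄' s)) := by

  have hτ : τ = fun s => f (j s) := funext fun s => (hfτ s).symm
  have h3 : e₃' = fun s => Real.cosh (φ s) • mfderiv (𝓡∂ 3) (𝓡 4) ι (j s) (e₃ s)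
      + Real.sinh (φ s) • e₄ (j s) := funext he₃'
  have h4 : e₄' = fun s => Real.sinh (φ s) • mfderiv (𝓡∂ 3) (𝓡 4) ι (j s) (e₃ s)
      + Real.cosh (φ s) • e₄ (j s) := funext he₄'
  have k : HypersurfaceData G.form ι e₄ := ⟨G.symm, G.nondegenerate, G.formDiffAt, hι, he₄⟩
  subst hτ h3 h4 hp hσ
  have h : BoundaryData g j e₃ f := by
    refine ⟨?_, hspace, ?_, hj, he₃, hf⟩
    · rw [hg]
      exact fun x u v => G.symm _ _ _
    · rw [hg]
      exact fun x => formDiffAt_pullback k.smooth_two (G.formDiffAt _)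
  have part1 := fun s => by
    have h' := h
    have hν' := hν
    have hJ' := hJang
    have hφ' := hφ
    rw [hg] at h' hν' hJ' hφ'
    exact k.graph_identity_spacetime h' hν' hJ' hφ' s
  rw [← hg] at part1
  refine ⟨part1, ?_⟩
  intro X hX hXg n hn hfut hnp hfX n' hn' hn'pos s
  have kX : HypersurfaceData minkowski X n := hypersurfaceData_minkowski hX hn
  have hfut' : ∀ x, minkowski (X x) (timeVector (X x)) (n x) < 0 := by
    intro x
    rw [minkowski_symm]
    rw [← coordField_single_eq_timeVector]
    exact hfut x
  have hh : ∀ x u v, hess g f x u v =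
      √(1 + normSqGrad g f x) * secondForm G.form ι e₄ x u v := by
    intro x u v
    have h' := h
    rw [← hXg] at h'
    have := kX.hess_time h' hfX (hfut' x) u v
    rw [hXg, hnp] at this
    exact this
  have hY : pullback (I := 𝓡∂ 3) euclidean (fun x => spatial (X x)) = graphMetric g f := by
    rw [kX.pullback_spatial hfX, hXg]
  have hYs := contMDiff_spatial kX.smooth_two
  have hn'eq : n' = fun s =>
      mfderiv (𝓡∂ 3) (𝓡 3) (fun x => spatial (X x)) (j s) (ν s) := by
    funext s
    -- The normal is oriented by e₃, whereas the graph metric has normal ν. The two orientations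
    -- agree because the graph metric pairs ν and e₃ to w/W > 0.
    refine (h.graph hν).isometry_normal_eq hY hYs hn' ?_ (hn'pos s)
    rw [h.graph_normal_coeff hν]
    exact div_pos (Real.sqrt_pos.2 (h.one_add_normSqGrad_pos s)) (h.sqrt_boundary_pos s)
  have hH : meanCurvature (I := 𝓡 2) (graphMetric g f) j ν s
      - graphMetric g f (j s) (schoenYauField g (secondForm G.form ι e₄) f (j s)) (ν s) =
      meanCurvature (I := 𝓡 2) euclidean (fun s => spatial (X (j s))) n' s := by
    rw [h.form_schoenYauField_of_hess hh, sub_zero, hn'eq]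
    exact ((h.graph hν).meanCurvature_isometry hY hYs s).symm
  refine ⟨hH, ?_, hH.symm.trans (part1 s)⟩
  have hφd := mdifferentiableAt_boost (h.mdifferentiableAt_normalDeriv s)
    (h.mdifferentiableAt_normSqGrad s) (h.normSqGrad_nonneg s) hφ
  have h' := h
  rw [hg] at h'
  -- The coefficients of e₄' make the right side the negative of the expression in
  -- `laplacian_of_hess`.
  have hv := k.form_meanCurvatureVector_boost h' (c := fun s => Real.sinh (φ s))
    (d := fun s => Real.cosh (φ s))
    ((Real.hasDerivAt_sinh (φ s)).differentiableAt.comp_mdifferentiableAt hφd)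
    ((Real.hasDerivAt_cosh (φ s)).differentiableAt.comp_mdifferentiableAt hφd)
  rw [← hg, ← h.laplacian_of_hess hh hφ s, ← neg_div] at hv
  exact hv
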